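/- Let $n\ge 1$ and let $L\subset\mathbb R^n$ be a lattice of full rank such that any $l=(l^{(1)},\dots,l^{(n)})\in L$ with some coordinate equal to $0$ is $0$. Put $Nl=\prod_k l^{(k)}$ and $|l|=(|l^{(1)}|,\dots,|l^{(n)}|)$. Let $M\le(\mathbb R^+)^n$ be a discrete subgroup (for coordinatewise multiplication), $M\cong\mathbb Z^{n-1}$, with $N\eta=1$ and $\eta L\subseteq L$ for all $\eta\in M$, and fix generators $\varepsilon_1,\dots,\varepsilon_{n-1}$ of $M$. Let $\mathcal E_M$ be the $n\times n$ matrix whose $k$-th row is $(1,\log\varepsilon_1^{(k)},\dots,\log\varepsilon_{n-1}^{(k)})$, and denote the rows of $\mathcal E_M^{-1}$ after the first one by $(e_j^{(1)},\dots,e_j^{(n)})$, $1\le j\le n-1$. For $m\in\mathbb Z^{n-1}$, $s\in\mathbb C$ and $y\in(\mathbb R^+)^n$ put $$\lambda_m(y)=\exp\Big(\sum_{k=1}^n\sum_{j=1}^{n-1}2\pi i\,m_je_j^{(k)}\log y_k\Big),\qquad s_k=s+\sum_{j=1}^{n-1}2\pi i\,m_je_j^{(k)},\qquad Z_{L,M}(s,m)=\sum_{0\ne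 l\in L/M}\frac{\lambda_{-m}(|l|)}{|Nl|^{s}},$$ where the sum runs over the $M$-orbits of nonzero elements of $L$ (the summand depends only on the orbit). Let $L^*=\{v:\langle v,w\rangle\in\mathbb Z\ \forall w\in L\}$ be the dual lattice, and let $Z_{L^*,M}$ be defined in the same way. Then for every $m\in\mathbb Z^{n-1}$: 1. The series converges absolutely and locally uniformly for $\operatorname{Re}s>1$ and is analytic there. It continues meromorphically to $\mathbb C$. The continuation is entire if $m\ne0$; if $m=0$, its only pole is a simple pole at $s=1$, with residue $\dfrac{2^n|\det\mathcal E_M|}{n\,\mathrm{vol}(\mathbb R^n/L)}$. 2. The completed function $\Xi_{L,M}(s,m)=\pi^{-ns/2}\Big(\prod_{k=1}^n\Gamma\big(\tfrac{s_k}{2}\big)\Big)Z_{L,M}(s,m)$ is meromorphic on $\mathbb C$. It has no poles if $m\neq0$; if $m=0$, its only poles are simple poles at $s=1$ and $s=0$, with residues $\dfrac{2^n|\det\mathcal E_M|}{n\,\mathrm{vol}(\mathbb R^n/L)}$ and $-\dfrac{2^n|\det\mathcal E_M|}{n}$ respectively. 3. The series for $Z_{L^*,M}(s,-m)$ converges absolutely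 for $\operatorname{Re}s>1$ and continues meromorphically to $\mathbb C$, with no poles except possibly at $s=1$ when $m=0$, and, as meromorphic functions of $s$, $$\mathrm{vol}(\mathbb R^n/L)^{1/2}\,\Xi_{L,M}(s,m)=\mathrm{vol}(\mathbb R^n/L^*)^{1/2}\,\Xi_{L^*,M}(1-s,-m);$$ this holds at every $s$ for which no $s_k/2$ and no $(1-s_k)/2$ is a pole of $\Gamma$. 4. For all $\delta,t_0>0$ one has $|Z_{L,M}(s,m)|\le C\,|\operatorname{Im}s|^{n(1-\operatorname{Re}s)/2+\delta}$ whenever $0\le\operatorname{Re}s\le1$ and $|\operatorname{Im}s|\ge t_0$. For every real $A$ one has $|Z_{L,M}(s,m)|\le C_A\,|\operatorname{Im}s|^{\delta}$ whenever $1<\operatorname{Re}s\le A$ and $|\operatorname{Im}s|\ge t_0$. If $|Nl|\ge1$ for all $0\ne l\in L$, then $C_A$ can be chosen independently of $A$. The constants depend on $L,M$, the chosen generators, $m,\delta,t_0$ (and on $A$ where indicated), but not on $s$. -/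

import Mathlib

open Filter Topology

namespace LatticeZeta

/-- The multiplicative group `(ℝ⁺)ⁿ` with coordinatewise product, where `n = r + 1`. -/
abbrev PosVec (r : ℕ) : Type := Fin (r + 1) → {x : ℝ // 0 < x}

/-- Coordinatewise product of a totally positive vector and a real vector. -/
def scale {r : ℕ} (η : PosVec r) (l : Fin (r + 1) → ℝ) : Fin (r + 1) → ℝ :=
  fun k => (η k : ℝ) * l k

/-- The norm of a vector: the product of its coordinates. -/
def vecNorm {r : ℕ} (l : Fin (r + 1) → ℝ) : ℝ := ∏ k, l k

/-- The `n × n` matrix whose first column is constantly `1` and whose other columns are the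
coordinatewise logarithms of the generators `ε 0, …, ε (r - 1)`. -/
noncomputable def logMatrix {r : ℕ} (ε : Fin r → PosVec r) :
    Matrix (Fin (r + 1)) (Fin (r + 1)) ℝ :=
  Matrix.of fun k => Fin.cons 1 fun j => Real.log (ε j k : ℝ)

/-- The entries `e_j^{(k)}` of the rows after the first one of the inverse of `logMatrix ε`. -/
noncomputable def invEntry {r : ℕ} (ε : Fin r → PosVec r) (j : Fin r) (k : Fin (r + 1)) : ℝ :=
  (logMatrix ε)⁻¹ j.succ k

/-- `λ_m(y) = exp (∑ₖ ∑ⱼ 2πi mⱼ e_j^{(k)} log yₖ)`, meant for `y` with positive coordinates. -/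
noncomputable def grossen {r : ℕ} (ε : Fin r → PosVec r) (m : Fin r → ℤ)
    (y : Fin (r + 1) → ℝ) : ℂ :=
  Complex.exp (∑ k, ∑ j, 2 * (Real.pi : ℂ) * Complex.I * (m j : ℂ) * (invEntry ε j k : ℂ) *
    (Real.log (y k) : ℂ))

/-- `s_k = s + ∑ⱼ 2πi mⱼ e_j^{(k)}`. -/
noncomputable def shift {r : ℕ} (ε : Fin r → PosVec r) (m : Fin r → ℤ) (s : ℂ)
    (k : Fin (r + 1)) : ℂ :=
  s + ∑ j, 2 * (Real.pi : ℂ) * Complex.I * (m j : ℂ) * (invEntry ε j k : ℂ)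

/-- The summand `λ_{-m}(|l|) / |N l| ^ s`. -/
noncomputable def zetaTerm {r : ℕ} (ε : Fin r → PosVec r) (m : Fin r → ℤ) (s : ℂ)
    (l : Fin (r + 1) → ℝ) : ℂ :=
  grossen ε (-m) (fun k => |l k|) / ((|vecNorm l| : ℝ) : ℂ) ^ s

/-- Two nonzero elements of `L` are equivalent when they lie in the same `M`-orbit. -/
def orbitSetoid {r : ℕ} (L : Submodule ℤ (Fin (r + 1) → ℝ)) (M : Subgroup (PosVec r)) :
    Setoid {l : Fin (r + 1) → ℝ // l ∈ L ∧ l ≠ 0} where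
  r x y := ∃ η ∈ M, y.1 = scale η x.1
  iseqv :=
    { refl := fun x => ⟨1, M.one_mem, by funext k; simp [scale]⟩
      symm := by
        rintro x y ⟨η, hη, h⟩
        refine ⟨η⁻¹, M.inv_mem hη, ?_⟩
        funext k
        have hk : ((η k : ℝ)) ≠ 0 := (η k).2.ne'
        rw [h]
        simp [scale, hk]
      trans := by
        rintro x y z ⟨η, hη, h⟩ ⟨θ, hθ, h'⟩
        refine ⟨θ * η, M.mul_mem hθ hη, ?_⟩
        funext k
        rw [h', h]
        simp [scale, mul_assoc] }

/-- The set of nonzero `M`-orbits `(L \ {0}) / M`. -/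
abbrev Orbits {r : ℕ} (L : Submodule ℤ (Fin (r + 1) → ℝ)) (M : Subgroup (PosVec r)) : Type :=
  Quotient (orbitSetoid L M)

/-- The summand belonging to an orbit, computed at a representative of the orbit. -/
noncomputable def orbitTerm {r : ℕ} (L : Submodule ℤ (Fin (r + 1) → ℝ)) (M : Subgroup (PosVec r))
    (ε : Fin r → PosVec r) (m : Fin r → ℤ) (o : Orbits L M) (s : ℂ) : ℂ :=
  zetaTerm ε m s (Quotient.out o).1

/-- The series `Z_{L,M}(s, m)`, a sum over nonzero `M`-orbits in `L`. -/
noncomputable def zetaSeries {r : ℕ} (L : Submodule ℤ (Fin (r + 1) → ℝ)) (M : Subgroup (PosVec r))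
    (ε : Fin r → PosVec r) (m : Fin r → ℤ) (s : ℂ) : ℂ :=
  ∑' o : Orbits L M, orbitTerm L M ε m o s

/-- `Z` is a meromorphic function on `ℂ` that agrees with the (absolutely convergent) series
`Z_{L,M}(·, m)` on the half-plane `Re s > 1`. -/
structure IsZetaContinuation {r : ℕ} (L : Submodule ℤ (Fin (r + 1) → ℝ))
    (M : Subgroup (PosVec r)) (ε : Fin r → PosVec r) (m : Fin r → ℤ) (Z : ℂ → ℂ) : Prop where
  summable : ∀ s : ℂ, 1 < s.re → Summable fun o : Orbits L M => ‖orbitTerm L M ε m o s‖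
  eq_series : ∀ s : ℂ, 1 < s.re → Z s = zetaSeries L M ε m s
  meromorphic : Meromorphic Z

/-- `π ^ (-ns/2) * ∏ₖ Γ(s_k / 2) * Z(s)`. The value is the intended one where none of the
numbers `s_k / 2` is a pole of `Γ`. -/
noncomputable def completed {r : ℕ} (ε : Fin r → PosVec r) (m : Fin r → ℤ) (Z : ℂ → ℂ)
    (s : ℂ) : ℂ :=
  (Real.pi : ℂ) ^ (-(((r + 1 : ℕ) : ℂ) * s / 2)) *
    (∏ k, Complex.Gamma (shift ε m s k / 2)) * Z s

/-- The dual lattice `{v | ⟨v, w⟩ ∈ ℤ for all w ∈ L}` for the standard scalar product. -/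
noncomputable def dualLattice {r : ℕ} (L : Submodule ℤ (Fin (r + 1) → ℝ)) :
    Submodule ℤ (Fin (r + 1) → ℝ) :=
  LinearMap.BilinForm.dualSubmodule (R := ℤ) (dotProductBilin ℝ ℝ) L

theorem mem_dualLattice {r : ℕ} (L : Submodule ℤ (Fin (r + 1) → ℝ)) (v : Fin (r + 1) → ℝ) :
    v ∈ dualLattice L ↔ ∀ w ∈ L, ∃ a : ℤ, (a : ℝ) = ∑ k, v k * w k := by
  simp [dualLattice, LinearMap.BilinForm.mem_dualSubmodule, Submodule.mem_one, dotProductBilin,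
    dotProduct]

end LatticeZeta

namespace LatticeZeta

open MeasureTheory

/-! The method is Hecke's: the completed zeta function is a Mellin transform of a theta function
averaged over a period cell of the units. For y in the positive orthant let θ_L(y) be the sum over l
in L of exp(-π ∑ y_k l_k²). Poisson summation for Gaussians relates θ_L(y) to θ_{L*}(1/y)
(`theta_functional_equation`). Points of the orthant are written t·E(x)² with t > 0 and E(x) = ∏
ε_j^{x_j}, x real. Translating x by an integral vector multiplies the lattice by an element of M, so
θ_L is periodic in x. Its Fourier coefficient `thetaAvg` has constant term 1 or 0 according to
whether m = 0, tends to it exponentially fast, and satisfies a relation under t ↦ 1/t because ∏_k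
E(x)_k = 1. It is therefore half of a `WeakFEPair` (`thetaPair`), whose Mellin transform Λ comes
with continuation, explicit poles and a functional equation.

The link with the series is unfolding. M acts freely on L \ {0}, so the integrals over the cell
belonging to one orbit add up to the integral of a single Gaussian over all x
(`hasSum_orbitIntegral`). Its Mellin transform is an integral over the orthant; in logarithmic
coordinates the parametrisation by (t, x) is linear, with determinant 2^(n-1) det E_M, and the
integral splits into n Gamma integrals with arguments s_k/2 (`mellin_orbitIntegral`). Hence Ξ(s, m)
= 2^(n-1) |det E_M| Λ(ns/2). Absolute convergence for Re s > 1 comes from the same computation,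
since for m = 0 all quantities are positive. The zeta function itself is recovered by multiplying
with the entire functions 1/Γ(s_k/2); for m = 0 the zero of one of them cancels the pole of Λ at 0.

The growth bounds are convexity bounds. On Re s = 1 + η the series is bounded; on Re s = -η the
functional equation reduces matters to the quotient Γ((1-s)/2)/Γ(s/2). That quotient has modulus 1
on Re s = 1/2 and is multiplied by a quadratic polynomial when s moves by 2, so it too is estimated
by interpolation. Both interpolations use the Phragmén–Lindelöf principle in the form
`exists_norm_le_of_vertical_strip`, and a small η yields the loss δ. -/

/-- The half-open unit cube `(0, 1]^ι`. -/
def unitCube (ι : Type*) : Set (ι → ℝ) := {x | ∀ i, x i ∈ Set.Ioc (0 : ℝ) 1}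

/-! ### Tiling of real space by integral translates of the unit cube. -/

section Cube

variable {ι : Type*} [Fintype ι]

omit [Fintype ι] in
theorem unitCube_eq_pi : unitCube ι = Set.univ.pi fun _ => Set.Ioc (0 : ℝ) 1 := by
  ext x; simp [unitCube]

theorem measurableSet_unitCube : MeasurableSet (unitCube ι) := by
  rw [unitCube_eq_pi]
  exact MeasurableSet.univ_pi fun _ => measurableSet_Ioc

theorem volume_unitCube : volume (unitCube ι) = 1 := by
  rw [unitCube_eq_pi, Real.volume_pi_Ioc]; simp

instance : IsFiniteMeasure (volume.restrict (unitCube ι)) :=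
  ⟨by simp [volume_unitCube]⟩

theorem norm_le_one_of_mem_unitCube {x : ι → ℝ} (hx : x ∈ unitCube ι) : ‖x‖ ≤ 1 := by
  rw [pi_norm_le_iff_of_nonneg zero_le_one]
  intro i
  rw [Real.norm_eq_abs, abs_le]
  exact ⟨by linarith [(hx i).1], (hx i).2⟩

/-- The translate of the unit cube by an integral vector. -/
def cubeAt (a : ι → ℤ) : Set (ι → ℝ) := {x | (fun i => x i - a i) ∈ unitCube ι}

-- The cube is open below and closed above, so the corner of the cell containing x is ⌈x⌉ - 1, not
-- ⌊x⌋; uniqueness of this corner gives both covering and disjointness.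
omit [Fintype ι] in
theorem mem_cubeAt_iff (a : ι → ℤ) (x : ι → ℝ) :
    x ∈ cubeAt a ↔ a = fun i => ⌈x i⌉ - 1 := by
  simp only [cubeAt, unitCube, Set.mem_ofPred_eq, Set.mem_Ioc, funext_iff]
  refine forall_congr' fun i => ?_
  rw [eq_sub_iff_add_eq, eq_comm, Int.ceil_eq_iff]
  push_cast
  constructor <;> rintro ⟨h1, h2⟩ <;> constructor <;> linarith

theorem measurableSet_cubeAt (a : ι → ℤ) : MeasurableSet (cubeAt a) :=
  measurableSet_unitCube.preimage (by fun_prop)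

omit [Fintype ι] in
theorem iUnion_cubeAt : ⋃ a : ι → ℤ, cubeAt a = Set.univ := by
  ext x
  simp only [Set.mem_iUnion, mem_cubeAt_iff, Set.mem_univ, iff_true]
  exact ⟨_, rfl⟩

omit [Fintype ι] in
theorem pairwise_disjoint_cubeAt :
    Pairwise (Function.onFun Disjoint (cubeAt : (ι → ℤ) → Set (ι → ℝ))) := by
  intro a b hab
  rw [Function.onFun, Set.disjoint_left]
  intro x hx hx'
  rw [mem_cubeAt_iff] at hx hx'
  exact hab (hx.trans hx'.symm)

theorem setIntegral_cubeAt {E : Type*} [NormedAddCommGroup E] [NormedSpace ℝ E]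
    (f : (ι → ℝ) → E) (a : ι → ℤ) :
    ∫ x in cubeAt a, f x = ∫ x in unitCube ι, f (x + fun i => (a i : ℝ)) := by
  have hmp : MeasurePreserving (fun x : ι → ℝ => x + fun i => (a i : ℝ)) volume volume :=
    measurePreserving_add_right _ _
  have := hmp.setIntegral_preimage_emb (measurableEmbedding_addRight _) f (cubeAt a)
  rw [← this]
  congr 2
  ext x
  simp [cubeAt]

/-- The unfolding step in its bare form. It serves twice: for the Fourier coefficients in Poisson
summation, and for collecting the cell integrals of one orbit of units. -/
theorem hasSum_integral_unitCube {E : Type*} [NormedAddCommGroup E] [NormedSpace ℝ E]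
    {f : (ι → ℝ) → E} (hf : Integrable f) :
    HasSum (fun a : ι → ℤ => ∫ x in unitCube ι, f (x + fun i => (a i : ℝ))) (∫ x, f x) := by
  have := hasSum_integral_iUnion (μ := volume) (f := f) measurableSet_cubeAt
    (pairwise_disjoint_cubeAt (ι := ι)) hf.integrableOn
  simpa only [iUnion_cubeAt, setIntegral_univ, setIntegral_cubeAt] using this

theorem integrable_of_summable_cube {E : Type*} [NormedAddCommGroup E]
    {f : (ι → ℝ) → E} (hf : AEStronglyMeasurable f) {u : (ι → ℤ) → ℝ} (hu : Summable u)
    (hfu : ∀ a, ∀ x ∈ unitCube ι, ‖f (x + fun i => (a i : ℝ))‖ ≤ u a) : Integrable f := by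
  have h1 : ∀ a, ∀ x ∈ cubeAt a, ‖f x‖ ≤ u a := by
    intro a x hx
    have := hfu a _ hx
    convert this using 3
    ext i; simp
  rw [← integrableOn_univ, ← iUnion_cubeAt]
  have hvol : ∀ a : ι → ℤ, volume (cubeAt a) = 1 := by
    intro a
    have := (measurePreserving_sub_right (volume : Measure (ι → ℝ))
      (fun i => (a i : ℝ))).measure_preimage (measurableSet_unitCube (ι := ι)).nullMeasurableSet
    rw [volume_unitCube] at this
    exact this
  have hu0 : ∀ a, 0 ≤ u a := fun a => by
    refine (norm_nonneg _).trans (hfu a (fun _ => 1) ?_)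
    intro i; simp
  refine ⟨hf.restrict, ?_⟩
  rw [hasFiniteIntegral_iff_enorm, lintegral_iUnion measurableSet_cubeAt pairwise_disjoint_cubeAt]
  have h2 : ∀ a, ∫⁻ x in cubeAt a, ‖f x‖ₑ ≤ ENNReal.ofReal (u a) := by
    intro a
    calc ∫⁻ x in cubeAt a, ‖f x‖ₑ ≤ ∫⁻ x in cubeAt a, ENNReal.ofReal (u a) := by
          refine setLIntegral_mono' (measurableSet_cubeAt a) fun x hx => ?_
          rw [← ofReal_norm]
          exact ENNReal.ofReal_le_ofReal (h1 a x hx)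
      _ = _ := by simp [hvol]
  refine (ENNReal.tsum_le_tsum h2).trans_lt ?_
  rw [← ENNReal.ofReal_tsum_of_nonneg hu0 hu]
  exact ENNReal.ofReal_lt_top

end Cube

/-! ### Poisson summation. -/

section Poisson

variable {ι : Type*} [Fintype ι]

/-- **Poisson summation** for a continuous function on `ℝ^ι`. -/
theorem tsum_eq_tsum_integral_fourier {f : (ι → ℝ) → ℂ} (hf : Continuous f)
    (hbound : ∀ R : ℝ, ∃ u : (ι → ℤ) → ℝ, Summable u ∧
      ∀ x : ι → ℝ, ‖x‖ ≤ R → ∀ a : ι → ℤ, ‖f (x + fun i => (a i : ℝ))‖ ≤ u a)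
    (hsum : Summable fun b : ι → ℤ =>
      ∫ x, Complex.exp (-(2 * Real.pi * Complex.I * ∑ i, (b i : ℂ) * (x i : ℂ))) * f x) :
    ∑' a : ι → ℤ, f (fun i => (a i : ℝ)) = ∑' b : ι → ℤ,
      ∫ x, Complex.exp (-(2 * Real.pi * Complex.I * ∑ i, (b i : ℂ) * (x i : ℂ))) * f x := by
  set F : (ι → ℝ) → ℂ := fun x => ∑' a : ι → ℤ, f (x + fun i => (a i : ℝ)) with hF
  have hFc : Continuous F := by
    rw [continuous_iff_continuousAt]
    intro x
    obtain ⟨u, hu, hfu⟩ := hbound (‖x‖ + 1)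
    have : ContinuousOn F (Metric.ball 0 (‖x‖ + 1)) := by
      refine continuousOn_tsum (fun a => (hf.comp (by fun_prop)).continuousOn) hu ?_
      intro a y hy
      exact hfu y (by simpa using (Metric.mem_ball.mp hy).le) a
    exact this.continuousAt (Metric.isOpen_ball.mem_nhds (by simp))
  have hper : ∀ (x : ι → ℝ) (c : ι → ℤ), F (x + fun i => (c i : ℝ)) = F x := by
    intro x c
    simp only [hF]
    rw [← (Equiv.addLeft c).tsum_eq (fun a : ι → ℤ => f (x + fun i => (a i : ℝ)))]
    refine tsum_congr fun a => ?_
    congr 1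
    ext i
    simp [add_assoc]
  set q : (ι → ℝ) → UnitAddTorus ι := fun x i => (x i : UnitAddCircle) with hq
  have hqq : IsOpenQuotientMap q := by
    have := IsOpenQuotientMap.piMap (A := fun _ : ι => ℝ) (B := fun _ : ι => UnitAddCircle)
      (f := fun _ : ι => ((↑) : ℝ → UnitAddCircle))
      (fun _ => QuotientAddGroup.isOpenQuotientMap_mk)
    exact this
  have hFq : ∀ x y, q x = q y → F x = F y := by
    intro x y hxy
    have h1 : ∀ i, ∃ c : ℤ, y i + c = x i := by
      intro i
      have h2 := congrFun hxy.symm i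
      simp only [hq] at h2
      rw [QuotientAddGroup.eq] at h2
      obtain ⟨c, hc⟩ := AddSubgroup.mem_zmultiples_iff.mp h2
      refine ⟨c, ?_⟩
      simp only [zsmul_eq_mul, mul_one] at hc
      rw [hc]; ring
    choose c hc using h1
    rw [← hper y c]
    congr 1
    ext i
    simp [hc]
  have hGq : ∀ x, F (Function.surjInv hqq.surjective (q x)) = F x := fun x =>
    hFq _ _ (Function.surjInv_eq hqq.surjective (q x))
  -- F is constant on the fibres of q, so composition with any section of q gives the descended
  -- function; its continuity comes from q being a quotient map.
  let G : C(UnitAddTorus ι, ℂ) :=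
    ⟨fun z => F (Function.surjInv hqq.surjective z), by
      rw [hqq.isQuotientMap.continuous_iff]
      exact hFc.congr fun x => (hGq x).symm⟩
  have he : ∀ (b : ι → ℤ) (x : ι → ℝ), UnitAddTorus.mFourier (-b) (q x) =
      Complex.exp (-(2 * Real.pi * Complex.I * ∑ i, (b i : ℂ) * (x i : ℂ))) := by
    intro b x
    simp only [UnitAddTorus.mFourier, hq, ContinuousMap.coe_mk, fourier_coe_apply]
    rw [← Complex.exp_sum, Finset.mul_sum, ← Finset.sum_neg_distrib]
    congr 1
    refine Finset.sum_congr rfl fun i _ => ?_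
    push_cast [Pi.neg_apply]
    ring
  have hcoef : ∀ b, UnitAddTorus.mFourierCoeff G b =
      ∫ x, Complex.exp (-(2 * Real.pi * Complex.I * ∑ i, (b i : ℂ) * (x i : ℂ))) * f x := by
    intro b
    rw [UnitAddTorus.mFourierCoeff_eq_integral G b 0]
    obtain ⟨u, hu, hfu⟩ := hbound 1
    set e : (ι → ℝ) → ℂ := fun x =>
      Complex.exp (-(2 * Real.pi * Complex.I * ∑ i, (b i : ℂ) * (x i : ℂ))) with hee
    have hec : Continuous e := by fun_prop
    have hen : ∀ x, ‖e x‖ = 1 := by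
      intro x
      have : -(2 * (Real.pi : ℂ) * Complex.I * ∑ i, (b i : ℂ) * (x i : ℂ)) =
          ((-(2 * Real.pi * ∑ i, (b i : ℝ) * x i) : ℝ) : ℂ) * Complex.I := by
        push_cast; ring
      simp only [hee]
      rw [this, Complex.norm_exp_ofReal_mul_I]
    have hep : ∀ (x : ι → ℝ) (a : ι → ℤ), e (x + fun i => (a i : ℝ)) = e x := by
      intro x a
      simp only [hee]
      rw [Complex.exp_eq_exp_iff_exists_int]
      refine ⟨-∑ i, b i * a i, ?_⟩
      push_cast [Pi.add_apply]
      simp only [mul_add, Finset.sum_add_distrib]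
      ring
    have hint : Integrable fun x => e x * f x := by
      refine integrable_of_summable_cube (hec.mul hf).aestronglyMeasurable hu ?_
      intro a x hx
      rw [norm_mul, hen, one_mul]
      exact hfu x (norm_le_one_of_mem_unitCube hx) a
    -- The integral over the whole space is cut into translates of the cell; as e is periodic,
    -- exchanging sum and integral turns it into the cell integral of e times the periodisation F.
    rw [← (hasSum_integral_unitCube hint).tsum_eq]
    have hset : {x : ι → ℝ | ∀ i, x i ∈ Set.Ioc ((0 : ι → ℝ) i) ((0 : ι → ℝ) i + 1)} =
        unitCube ι := by simp [unitCube]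
    rw [hset]
    have h3 := hasSum_integral_of_dominated_convergence (μ := volume.restrict (unitCube ι))
      (F := fun (a : ι → ℤ) x => e (x + fun i => (a i : ℝ)) * f (x + fun i => (a i : ℝ)))
      (f := fun x => e x * F x) (fun a _ => u a) ?_ ?_ ?_ ?_ ?_
    · rw [h3.tsum_eq]
      refine integral_congr_ae (Eventually.of_forall fun x => ?_)
      simp only [smul_eq_mul]
      have h4 := he b x
      have h5 : G (fun i => (x i : UnitAddCircle)) = F x := hGq x
      rw [h5]
      congr 1
    · intro a
      exact ((hec.mul hf).comp (by fun_prop)).aestronglyMeasurable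
    · intro a
      refine (ae_restrict_iff' measurableSet_unitCube).mpr (Eventually.of_forall fun x hx => ?_)
      rw [norm_mul, hen, one_mul]
      exact hfu x (norm_le_one_of_mem_unitCube hx) a
    · exact Eventually.of_forall fun x => hu
    · exact integrable_const _
    · refine (ae_restrict_iff' measurableSet_unitCube).mpr (Eventually.of_forall fun x hx => ?_)
      simp only [hep]
      refine HasSum.mul_left _ (Summable.hasSum ?_)
      exact Summable.of_norm_bounded hu fun a => hfu x (norm_le_one_of_mem_unitCube hx) a
  have hfun : UnitAddTorus.mFourierCoeff G = fun b : ι → ℤ =>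
      ∫ x, Complex.exp (-(2 * Real.pi * Complex.I * ∑ i, (b i : ℂ) * (x i : ℂ))) * f x :=
    funext hcoef
  -- A continuous function on the torus with summable Fourier coefficients is the sum of its Fourier
  -- series at every point; Poisson's formula is the value at 0.
  have hs := UnitAddTorus.hasSum_mFourier_series_apply_of_summable (f := G)
    (by rw [hfun]; exact hsum) (q 0)
  have h0 : ∀ b, UnitAddTorus.mFourier b (q 0) = 1 := by
    intro b
    have := he (-b) 0
    rw [neg_neg] at this
    rw [this]
    simp
  have hG0 : G (q 0) = ∑' a : ι → ℤ, f (fun i => (a i : ℝ)) := by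
    refine (hGq 0).trans ?_
    simp [hF]
  rw [← hG0, ← hs.tsum_eq]
  refine tsum_congr fun b => ?_
  rw [h0, hcoef, smul_eq_mul, mul_one]

end Poisson
end LatticeZeta

/-! ### Lattice theta functions, dual lattices and theta inversion. -/

namespace LatticeZeta
open MeasureTheory Matrix

section LinearChange

variable {ι : Type*} [Fintype ι] [DecidableEq ι]

theorem measurableEmbedding_mulVec {A : Matrix ι ι ℝ} (hA : A.det ≠ 0) :
    MeasurableEmbedding fun x : ι → ℝ => A *ᵥ x := by
  have hu : IsUnit A.det := isUnit_iff_ne_zero.mpr hA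
  exact (LinearEquiv.toContinuousLinearEquiv
    (Matrix.toLinearEquiv' A ((Matrix.isUnit_iff_isUnit_det A).mpr hu).invertible)
      ).toHomeomorph.measurableEmbedding

theorem integral_comp_mulVec {A : Matrix ι ι ℝ} (hA : A.det ≠ 0)
    {E : Type*} [NormedAddCommGroup E] [NormedSpace ℝ E] (h : (ι → ℝ) → E) :
    ∫ x, h (A *ᵥ x) = |A.det|⁻¹ • ∫ x, h x := by
  rw [← (measurableEmbedding_mulVec hA).integral_map (μ := volume) (g := h)]
  have := Real.map_matrix_volume_pi_eq_smul_volume_pi hA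
  have h2 : (fun x : ι → ℝ => A *ᵥ x) = Matrix.toLin' A := by ext; simp
  rw [h2, this, integral_smul_measure, ENNReal.toReal_ofReal (abs_nonneg _), abs_inv]

theorem integrable_comp_mulVec {A : Matrix ι ι ℝ} (hA : A.det ≠ 0)
    {E : Type*} [NormedAddCommGroup E] {h : (ι → ℝ) → E} (hh : Integrable h) :
    Integrable fun x => h (A *ᵥ x) := by
  have := (measurableEmbedding_mulVec hA).integrable_map_iff (μ := volume) (g := h)
  have h2 : (fun x : ι → ℝ => A *ᵥ x) = Matrix.toLin' A := by ext; simp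
  refine this.mp ?_
  rw [h2, Real.map_matrix_volume_pi_eq_smul_volume_pi hA]
  exact hh.smul_measure ENNReal.ofReal_ne_top

end LinearChange

section Summability

variable {E : Type*} [NormedAddCommGroup E] [NormedSpace ℝ E] [FiniteDimensional ℝ E]

/-- From e^(-x) ≤ N!/x^N with x = c‖l‖² the sum is dominated by that of ‖l‖^(-2N), which converges
once 2N exceeds the rank; an extra summand 1 takes care of l = 0. -/
theorem summable_exp_neg_norm_sq (L : Submodule ℤ E) [DiscreteTopology L] {c : ℝ} (hc : 0 < c) :
    Summable fun l : L => Real.exp (-c * ‖(l : E)‖ ^ 2) := by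
  classical
  set N := Module.finrank ℤ L + 1 with hN
  have h1 := ((ZLattice.summable_norm_pow_inv L (2 * N) (by omega)).mul_left
    ((N.factorial : ℝ) / c ^ N)).add (hasSum_ite_eq (0 : L) (1 : ℝ)).summable
  refine Summable.of_nonneg_of_le (fun _ => (Real.exp_pos _).le) (fun l => ?_) h1
  by_cases hl : l = 0
  · simp [hl, hN]
  · have hpos : 0 < ‖(l : E)‖ := by simpa using hl
    rw [if_neg hl, add_zero, neg_mul, Real.exp_neg]
    have h2 := Real.pow_div_factorial_le_exp (c * ‖(l : E)‖ ^ 2) (by positivity) N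
    have h3 : (N.factorial : ℝ) / c ^ N * ‖l‖⁻¹ ^ (2 * N) =
        ((c * ‖(l : E)‖ ^ 2) ^ N / N.factorial)⁻¹ := by
      have : ‖l‖ = ‖(l : E)‖ := rfl
      rw [this, mul_pow, ← pow_mul, inv_div, inv_pow]
      field_simp
    rw [h3]
    exact inv_anti₀ (by positivity) h2

end Summability

variable {r : ℕ}

/-- The lattice theta function of a positive diagonal quadratic form. -/
noncomputable def theta (L : Submodule ℤ (Fin (r + 1) → ℝ)) (y : Fin (r + 1) → ℝ) : ℝ :=
  ∑' l : L, Real.exp (-Real.pi * ∑ k, y k * (l : Fin (r + 1) → ℝ) k ^ 2)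

theorem mul_norm_sq_le_sum {ι : Type*} [Fintype ι] {c : ℝ} (hc : 0 < c) {y : ι → ℝ}
    (hy : ∀ k, c ≤ y k) (v : ι → ℝ) : c * ‖v‖ ^ 2 ≤ ∑ k, y k * v k ^ 2 := by
  have hS : 0 ≤ ∑ k, y k * v k ^ 2 :=
    Finset.sum_nonneg fun k _ => mul_nonneg (hc.le.trans (hy k)) (sq_nonneg _)
  have h1 : ‖v‖ ≤ Real.sqrt ((∑ k, y k * v k ^ 2) / c) := by
    rw [pi_norm_le_iff_of_nonneg (Real.sqrt_nonneg _)]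
    intro k
    rw [Real.norm_eq_abs]
    refine Real.abs_le_sqrt ?_
    rw [le_div_iff₀ hc]
    calc v k ^ 2 * c ≤ y k * v k ^ 2 := by
          rw [mul_comm]; exact mul_le_mul_of_nonneg_right (hy k) (sq_nonneg _)
      _ ≤ _ := Finset.single_le_sum (f := fun k => y k * v k ^ 2)
          (fun k _ => mul_nonneg (hc.le.trans (hy k)) (sq_nonneg _)) (Finset.mem_univ k)
  calc c * ‖v‖ ^ 2 ≤ c * (Real.sqrt ((∑ k, y k * v k ^ 2) / c)) ^ 2 := by gcongr
    _ = _ := by rw [Real.sq_sqrt (by positivity)]; field_simp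

theorem exists_pos_le {ι : Type*} [Finite ι] {y : ι → ℝ} (hy : ∀ k, 0 < y k) :
    ∃ c : ℝ, 0 < c ∧ ∀ k, c ≤ y k := by
  have h1 : ∀ᶠ c : ℝ in 𝓝[>] 0, ∀ k, c ≤ y k := by
    rw [eventually_all]
    intro k
    filter_upwards [nhdsWithin_le_nhds (eventually_lt_nhds (hy k))] with c hc using hc.le
  obtain ⟨c, hc, hc'⟩ := (h1.and self_mem_nhdsWithin).exists
  exact ⟨c, hc', hc⟩

theorem summable_theta (L : Submodule ℤ (Fin (r + 1) → ℝ)) [DiscreteTopology L]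
    {y : Fin (r + 1) → ℝ} (hy : ∀ k, 0 < y k) :
    Summable fun l : L => Real.exp (-Real.pi * ∑ k, y k * (l : Fin (r + 1) → ℝ) k ^ 2) := by
  obtain ⟨c, hc, hcy⟩ := exists_pos_le hy
  refine Summable.of_nonneg_of_le (fun _ => (Real.exp_pos _).le) (fun l => ?_)
    (summable_exp_neg_norm_sq L (c := Real.pi * c) (by positivity))
  refine Real.exp_le_exp.mpr ?_
  have := mul_le_mul_of_nonneg_left (mul_norm_sq_le_sum hc hcy (l : Fin (r + 1) → ℝ))
    Real.pi_pos.le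
  linarith

section Dual

theorem nondegenerate_dotProductBilin (n : ℕ) :
    LinearMap.BilinForm.Nondegenerate
      (dotProductBilin ℝ ℝ : (Fin n → ℝ) →ₗ[ℝ] (Fin n → ℝ) →ₗ[ℝ] ℝ) := by
  constructor
  · intro v hv
    exact dotProduct_self_eq_zero.mp (hv v)
  · intro v hv
    exact dotProduct_self_eq_zero.mp (hv v)

/-- The basis dual to `b` for the standard scalar product. -/
noncomputable def dualBasis (b : Module.Basis (Fin (r + 1)) ℝ (Fin (r + 1) → ℝ)) :
    Module.Basis (Fin (r + 1)) ℝ (Fin (r + 1) → ℝ) :=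
  LinearMap.BilinForm.dualBasis _ (nondegenerate_dotProductBilin (r + 1)) b

theorem dualLattice_span (b : Module.Basis (Fin (r + 1)) ℝ (Fin (r + 1) → ℝ)) :
    dualLattice (Submodule.span ℤ (Set.range b)) = Submodule.span ℤ (Set.range (dualBasis b)) :=
  LinearMap.BilinForm.dualSubmodule_span_of_basis _ _ _

/-- Duality in matrix form. It yields the reciprocal determinants, hence the reciprocal covolumes,
and it rewrites a character in integral coordinates as pairing with a vector of the dual lattice. -/
theorem dualBasis_mul (b : Module.Basis (Fin (r + 1)) ℝ (Fin (r + 1) → ℝ)) :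
    Matrix.of (dualBasis b) * (Matrix.of b).transpose = 1 := by
  ext i j
  have := LinearMap.BilinForm.apply_dualBasis_left (nondegenerate_dotProductBilin (r + 1)) b i j
  rw [Matrix.one_apply]
  simp_rw [eq_comm (a := i)]
  rw [← this]
  rfl

theorem det_of_basis_ne_zero (b : Module.Basis (Fin (r + 1)) ℝ (Fin (r + 1) → ℝ)) :
    (Matrix.of b).det ≠ 0 := by
  intro h
  have := congrArg Matrix.det (dualBasis_mul b)
  simp [h] at this

theorem abs_det_dualBasis (b : Module.Basis (Fin (r + 1)) ℝ (Fin (r + 1) → ℝ)) :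
    |(Matrix.of (dualBasis b)).det| = |(Matrix.of b).det|⁻¹ := by
  have := congrArg Matrix.det (dualBasis_mul b)
  rw [Matrix.det_mul, Matrix.det_transpose, Matrix.det_one] at this
  rw [← abs_inv, eq_inv_of_mul_eq_one_left this]

theorem covolume_span (b : Module.Basis (Fin (r + 1)) ℝ (Fin (r + 1) → ℝ)) :
    ZLattice.covolume (Submodule.span ℤ (Set.range b)) = |(Matrix.of b).det| := by
  rw [ZLattice.covolume_eq_det _ (b.restrictScalars ℤ)]
  congr 3
  ext i j
  simp

theorem exists_basis_span (L : Submodule ℤ (Fin (r + 1) → ℝ)) [DiscreteTopology L]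
    [IsZLattice ℝ L] : ∃ b : Module.Basis (Fin (r + 1)) ℝ (Fin (r + 1) → ℝ),
      L = Submodule.span ℤ (Set.range b) := by
  have := ZLattice.module_free ℝ L
  have := ZLattice.module_finite ℝ L
  have h : Module.finrank ℤ L = r + 1 := by
    rw [ZLattice.rank ℝ L]; simp
  exact ⟨((Module.finBasisOfFinrankEq ℤ L h).ofZLatticeBasis ℝ L),
    ((Module.finBasisOfFinrankEq ℤ L h).ofZLatticeBasis_span ℝ L).symm⟩

variable (L : Submodule ℤ (Fin (r + 1) → ℝ)) [DiscreteTopology L] [IsZLattice ℝ L]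

instance discreteTopology_dualLattice : DiscreteTopology (dualLattice L) := by
  obtain ⟨b, rfl⟩ := exists_basis_span L
  rw [dualLattice_span]
  infer_instance

instance isZLattice_dualLattice : IsZLattice ℝ (dualLattice L) where
  span_top := by
    obtain ⟨b, hb⟩ := exists_basis_span L
    rw [hb, dualLattice_span]
    exact IsZLattice.span_top

theorem covolume_dualLattice :
    ZLattice.covolume (dualLattice L) = (ZLattice.covolume L)⁻¹ := by
  obtain ⟨b, rfl⟩ := exists_basis_span L
  rw [covolume_span, ← abs_det_dualBasis, ← covolume_span]
  congr 1
  exact dualLattice_span b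

end Dual

section FunctionalEquation

/-- The parametrisation of the lattice spanned by a basis by integral coordinates. -/
noncomputable def latticeEquiv (b : Module.Basis (Fin (r + 1)) ℝ (Fin (r + 1) → ℝ)) :
    (Fin (r + 1) → ℤ) ≃ Submodule.span ℤ (Set.range b) :=
  (b.restrictScalars ℤ).equivFun.symm.toEquiv

theorem coe_latticeEquiv (b : Module.Basis (Fin (r + 1)) ℝ (Fin (r + 1) → ℝ))
    (a : Fin (r + 1) → ℤ) : (latticeEquiv b a : Fin (r + 1) → ℝ) =
      (Matrix.of b).transpose *ᵥ fun i => (a i : ℝ) := by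
  ext k
  simp [latticeEquiv, Module.Basis.equivFun_symm_apply, Matrix.mulVec, dotProduct, mul_comm]

theorem theta_span (b : Module.Basis (Fin (r + 1)) ℝ (Fin (r + 1) → ℝ)) (y : Fin (r + 1) → ℝ) :
    theta (Submodule.span ℤ (Set.range b)) y = ∑' a : Fin (r + 1) → ℤ, Real.exp (-Real.pi *
      ∑ k, y k * ((Matrix.of b).transpose *ᵥ fun i => (a i : ℝ)) k ^ 2) := by
  rw [theta, ← (latticeEquiv b).tsum_eq]
  simp_rw [coe_latticeEquiv]

/-- The majorant must be uniform for x in a ball. If p and q are the images of x and a, then ‖q‖² ≤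
2‖p + q‖² + 2‖p‖², so half of the decay rate survives and the translation by x costs a constant
factor. -/
theorem exists_gaussian_bound (b : Module.Basis (Fin (r + 1)) ℝ (Fin (r + 1) → ℝ))
    {y : Fin (r + 1) → ℝ} (hy : ∀ k, 0 < y k) (R : ℝ) :
    ∃ u : (Fin (r + 1) → ℤ) → ℝ, Summable u ∧ ∀ x : Fin (r + 1) → ℝ, ‖x‖ ≤ R → ∀ a,
      Real.exp (-Real.pi * ∑ k, y k *
        ((Matrix.of b).transpose *ᵥ (x + fun i => (a i : ℝ))) k ^ 2) ≤ u a := by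
  obtain ⟨c, hc, hcy⟩ := exists_pos_le hy
  set T : (Fin (r + 1) → ℝ) →L[ℝ] (Fin (r + 1) → ℝ) :=
    LinearMap.toContinuousLinearMap (Matrix.toLin' (Matrix.of b).transpose) with hT
  have hs := (latticeEquiv b).summable_iff.mpr (summable_exp_neg_norm_sq
    (Submodule.span ℤ (Set.range b)) (c := Real.pi * c / 2) (by positivity))
  refine ⟨_, hs.mul_left (Real.exp (Real.pi * c * (‖T‖ * R) ^ 2)), fun x hx a => ?_⟩
  simp only [Function.comp_apply, coe_latticeEquiv]
  rw [← Real.exp_add]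
  refine Real.exp_le_exp.mpr ?_
  have h1 := mul_norm_sq_le_sum hc hcy
    ((Matrix.of b).transpose *ᵥ (x + fun i => (a i : ℝ)))
  rw [Matrix.mulVec_add] at h1 ⊢
  have h2 : ‖(Matrix.of b).transpose *ᵥ x‖ ≤ ‖T‖ * R :=
    (T.le_opNorm x).trans (by gcongr)
  set p := (Matrix.of b).transpose *ᵥ x
  set q := (Matrix.of b).transpose *ᵥ fun i => (a i : ℝ)
  have h3 : ‖q‖ ≤ ‖p + q‖ + ‖p‖ := by
    have := norm_sub_le (p + q) p
    simpa using this
  have h4 : ‖q‖ ^ 2 ≤ 2 * ‖p + q‖ ^ 2 + 2 * (‖T‖ * R) ^ 2 := by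
    have h5 : ‖q‖ ^ 2 ≤ (‖p + q‖ + ‖T‖ * R) ^ 2 := by
      have := norm_nonneg q
      gcongr
      linarith
    nlinarith [sq_nonneg (‖p + q‖ - ‖T‖ * R)]
  have h6 := mul_le_mul_of_nonneg_left h1 Real.pi_pos.le
  have h7 := mul_le_mul_of_nonneg_left h4 (mul_pos Real.pi_pos hc).le
  linarith

/-- The substitution v = Bᵀx makes the quadratic form diagonal and turns the character into pairing
with w, the dual lattice vector with coordinates a. What remains is a product of one-dimensional
Gaussian transforms, each contributing y_k^(-1/2). -/
theorem integral_fourier_gaussian (b : Module.Basis (Fin (r + 1)) ℝ (Fin (r + 1) → ℝ))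
    {y : Fin (r + 1) → ℝ} (hy : ∀ k, 0 < y k) (a : Fin (r + 1) → ℤ) :
    ∫ x : Fin (r + 1) → ℝ, Complex.exp (-(2 * Real.pi * Complex.I * ∑ i, (a i : ℂ) * (x i : ℂ))) *
      ((Real.exp (-Real.pi * ∑ k, y k * ((Matrix.of b).transpose *ᵥ x) k ^ 2) : ℝ) : ℂ) =
    ((|(Matrix.of b).det|⁻¹ * (∏ k, (y k) ^ (-(1 / 2) : ℝ)) * Real.exp (-Real.pi *
      ∑ k, (y k)⁻¹ * ((Matrix.of (dualBasis b)).transpose *ᵥ fun i => (a i : ℝ)) k ^ 2) : ℝ) : ℂ)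
    := by
  have hdet : ((Matrix.of b).transpose).det ≠ 0 := by
    rw [Matrix.det_transpose]; exact det_of_basis_ne_zero b
  set w : Fin (r + 1) → ℝ := (Matrix.of (dualBasis b)).transpose *ᵥ fun i => (a i : ℝ) with hw
  have hpair : ∀ x : Fin (r + 1) → ℝ, ∑ k, w k * ((Matrix.of b).transpose *ᵥ x) k =
      ∑ i, (a i : ℝ) * x i := by
    intro x
    change w ⬝ᵥ ((Matrix.of b).transpose *ᵥ x) = (fun i => (a i : ℝ)) ⬝ᵥ x
    rw [hw, Matrix.mulVec_transpose, ← Matrix.dotProduct_mulVec, Matrix.mulVec_mulVec,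
      dualBasis_mul, Matrix.one_mulVec]
  have key := integral_comp_mulVec hdet (fun v : Fin (r + 1) → ℝ =>
    Complex.exp (-∑ k, ((Real.pi * y k : ℝ) : ℂ) * (v k : ℂ) ^ 2 +
      ∑ k, (-(2 * Real.pi * Complex.I * w k) : ℂ) * v k))
  have hl : ∀ x : Fin (r + 1) → ℝ,
      Complex.exp (-(2 * Real.pi * Complex.I * ∑ i, (a i : ℂ) * (x i : ℂ))) *
      ((Real.exp (-Real.pi * ∑ k, y k * ((Matrix.of b).transpose *ᵥ x) k ^ 2) : ℝ) : ℂ) =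
      Complex.exp (-∑ k, ((Real.pi * y k : ℝ) : ℂ) * (((Matrix.of b).transpose *ᵥ x) k : ℂ) ^ 2 +
      ∑ k, (-(2 * Real.pi * Complex.I * w k) : ℂ) * ((Matrix.of b).transpose *ᵥ x) k) := by
    intro x
    have hp : ∑ k, (w k : ℂ) * (((Matrix.of b).transpose *ᵥ x) k : ℂ) =
      ∑ i, (a i : ℂ) * (x i : ℂ) := by exact_mod_cast hpair x
    rw [← hp, Complex.ofReal_exp, ← Complex.exp_add]
    congr 1
    push_cast
    simp only [Finset.mul_sum, ← Finset.sum_neg_distrib, ← Finset.sum_add_distrib]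
    refine Finset.sum_congr rfl fun k _ => ?_
    ring
  rw [integral_congr_ae (Eventually.of_forall hl), key, GaussianFourier.integral_cexp_neg_sum_mul_add
    (by intro k; rw [Complex.ofReal_re]; have := hy k; positivity), Matrix.det_transpose]
  rw [Complex.real_smul]
  push_cast
  rw [Finset.prod_mul_distrib]
  refine Eq.trans ?_ (mul_assoc _ _ _).symm
  congr 1
  congr 1
  · refine Finset.prod_congr rfl fun k _ => ?_
    have hk := hy k
    rw [Complex.ofReal_cpow hk.le]
    have : (Real.pi : ℂ) / (Real.pi * y k) = (((y k)⁻¹ : ℝ) : ℂ) := by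
      have : (Real.pi : ℂ) ≠ 0 := by exact_mod_cast Real.pi_ne_zero
      have : (y k : ℂ) ≠ 0 := by exact_mod_cast hk.ne'
      push_cast
      field_simp
    rw [this]
    have h2 : (1 / 2 : ℂ) = ((1 / 2 : ℝ) : ℂ) := by push_cast; rfl
    rw [h2, ← Complex.ofReal_cpow (inv_pos.mpr hk).le, ← Complex.ofReal_cpow hk.le,
      Real.inv_rpow hk.le, ← Real.rpow_neg hk.le]
  · rw [← Complex.exp_sum]
    congr 1
    rw [Finset.mul_sum]
    refine Finset.sum_congr rfl fun k _ => ?_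
    have h1 : (Real.pi : ℂ) ≠ 0 := by exact_mod_cast Real.pi_ne_zero
    have h2 : (y k : ℂ) ≠ 0 := by exact_mod_cast (hy k).ne'
    field_simp
    ring_nf
    simp [Complex.I_sq]

theorem theta_functional_equation (L : Submodule ℤ (Fin (r + 1) → ℝ)) [DiscreteTopology L]
    [IsZLattice ℝ L] {y : Fin (r + 1) → ℝ} (hy : ∀ k, 0 < y k) :
    theta L y = (ZLattice.covolume L)⁻¹ * (∏ k, (y k) ^ (-(1 / 2) : ℝ)) *
      theta (dualLattice L) (fun k => (y k)⁻¹) := by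
  obtain ⟨b, rfl⟩ := exists_basis_span L
  have hP := tsum_eq_tsum_integral_fourier
    (f := fun x => ((Real.exp (-Real.pi * ∑ k, y k * ((Matrix.of b).transpose *ᵥ x) k ^ 2) : ℝ) : ℂ))
    ?_ ?_ ?_
  · simp only [integral_fourier_gaussian b hy] at hP
    rw [dualLattice_span, theta_span, theta_span, covolume_span]
    rw [← Complex.ofReal_tsum, ← Complex.ofReal_tsum] at hP
    rw [Complex.ofReal_inj.mp hP, tsum_mul_left]
  · fun_prop
  · intro R
    obtain ⟨u, hu, hb⟩ := exists_gaussian_bound b hy R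
    refine ⟨u, hu, fun x hx a => ?_⟩
    rw [Complex.norm_of_nonneg (Real.exp_pos _).le]
    exact hb x hx a
  · simp only [integral_fourier_gaussian b hy]
    refine Complex.ofRealCLM.summable (Summable.mul_left _ ?_)
    have := (latticeEquiv (dualBasis b)).summable_iff.mpr
      (summable_theta (Submodule.span ℤ (Set.range (dualBasis b))) (y := fun k => (y k)⁻¹)
        (fun k => inv_pos.mpr (hy k)))
    simpa only [Function.comp_def, coe_latticeEquiv] using this

end FunctionalEquation
end LatticeZeta

/-! ### The group of units, its logarithms and its action on lattices. -/

namespace LatticeZeta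
open MeasureTheory Matrix

variable {r : ℕ}

/-- The coordinatewise logarithm of a positive vector. -/
noncomputable def logVec (η : PosVec r) : Fin (r + 1) → ℝ := fun k => Real.log (η k)

theorem logVec_mul (η θ : PosVec r) : logVec (η * θ) = logVec η + logVec θ := by
  ext k
  simp [logVec, Real.log_mul (η k).2.ne' (θ k).2.ne']

/-- The coordinatewise logarithm as an additive homomorphism. -/
noncomputable def logHom : Additive (PosVec r) →+ (Fin (r + 1) → ℝ) where
  toFun η := logVec η.toMul
  map_zero' := by ext k; simp [logVec]
  map_add' η θ := logVec_mul _ _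

theorem logHom_injective : Function.Injective (logHom (r := r)) := by
  intro η θ h
  have h1 : ∀ k, Real.log (η.toMul k) = Real.log (θ.toMul k) := fun k => congrFun h k
  refine Additive.toMul.injective (funext fun k => Subtype.ext ?_)
  exact Real.log_injOn_pos (η.toMul k).2 (θ.toMul k).2 (h1 k)

/-- The one-parameter groups attached to the generators: `k ↦ ∏ⱼ (ε j k) ^ (x j)`. -/
noncomputable def unitVec (ε : Fin r → PosVec r) (x : Fin r → ℝ) (k : Fin (r + 1)) : ℝ :=
  Real.exp (∑ j, x j * Real.log (ε j k))

theorem unitVec_pos (ε : Fin r → PosVec r) (x : Fin r → ℝ) (k : Fin (r + 1)) :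
    0 < unitVec ε x k := Real.exp_pos _

theorem unitVec_add (ε : Fin r → PosVec r) (x y : Fin r → ℝ) (k : Fin (r + 1)) :
    unitVec ε (x + y) k = unitVec ε x k * unitVec ε y k := by
  simp [unitVec, add_mul, Finset.sum_add_distrib, Real.exp_add]

theorem unitVec_neg (ε : Fin r → PosVec r) (x : Fin r → ℝ) (k : Fin (r + 1)) :
    unitVec ε (-x) k = (unitVec ε x k)⁻¹ := by
  simp [unitVec, Finset.sum_neg_distrib, Real.exp_neg]

theorem continuous_unitVec (ε : Fin r → PosVec r) (k : Fin (r + 1)) :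
    Continuous fun x => unitVec ε x k := by
  unfold unitVec; fun_prop

/-- The element `∏ⱼ (ε j) ^ (a j)` of the group generated by the `ε j`. -/
noncomputable def unitPow (ε : Fin r → PosVec r) (a : Fin r → ℤ) : PosVec r := ∏ j, ε j ^ a j

theorem logVec_unitPow (ε : Fin r → PosVec r) (a : Fin r → ℤ) :
    logVec (unitPow ε a) = fun k => ∑ j, (a j : ℝ) * Real.log (ε j k) := by
  have h1 : logVec (unitPow ε a) = logHom (Additive.ofMul (unitPow ε a)) := rfl
  rw [h1, unitPow, ofMul_prod, map_sum]
  ext k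
  simp only [ofMul_zpow, map_zsmul, Finset.sum_apply, zsmul_eq_mul]
  rfl

theorem unitPow_apply (ε : Fin r → PosVec r) (a : Fin r → ℤ) (k : Fin (r + 1)) :
    (unitPow ε a k : ℝ) = unitVec ε (fun j => (a j : ℝ)) k := by
  have := congrFun (logVec_unitPow ε a) k
  rw [unitVec, ← this, logVec, Real.exp_log (unitPow ε a k).2]

theorem unitPow_mem {M : Subgroup (PosVec r)} {ε : Fin r → PosVec r}
    (hε : Subgroup.closure (Set.range ε) = M) (a : Fin r → ℤ) : unitPow ε a ∈ M := by
  subst hε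
  exact Subgroup.prod_mem _ fun j _ =>
    Subgroup.zpow_mem _ (Subgroup.subset_closure (Set.mem_range_self j)) _

theorem exists_eq_unitPow {M : Subgroup (PosVec r)} {ε : Fin r → PosVec r}
    (hε : Subgroup.closure (Set.range ε) = M) {η : PosVec r} (hη : η ∈ M) :
    ∃ a : Fin r → ℤ, η = unitPow ε a := by
  subst hε
  induction hη using Subgroup.closure_induction with
  | mem x hx =>
    obtain ⟨j, rfl⟩ := hx
    refine ⟨Pi.single j 1, ?_⟩
    rw [unitPow, Finset.prod_eq_single j] <;> simp +contextual
  | one => exact ⟨0, by simp [unitPow]⟩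
  | mul x y _ _ hx hy =>
    obtain ⟨a, rfl⟩ := hx
    obtain ⟨b, rfl⟩ := hy
    exact ⟨a + b, by simp [unitPow, _root_.zpow_add, Finset.prod_mul_distrib]⟩
  | inv x _ hx =>
    obtain ⟨a, rfl⟩ := hx
    exact ⟨-a, by simp [unitPow]⟩

/-- The image W of M under the logarithm is discrete, since exp maps it continuously and injectively
into M, and it is free of rank r. A discrete subgroup spans a real space of dimension equal to its
rank, and this space is spanned by the r vectors in question. -/
theorem linearIndependent_logVec {M : Subgroup (PosVec r)} (hMdisc : DiscreteTopology M)
    (hMrank : Nonempty (M ≃* Multiplicative (Fin r → ℤ)))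
    {ε : Fin r → PosVec r} (hε : Subgroup.closure (Set.range ε) = M) :
    LinearIndependent ℝ fun j => logVec (ε j) := by
  set W : Submodule ℤ (Fin (r + 1) → ℝ) :=
    AddSubgroup.toIntSubmodule (AddSubgroup.map logHom (Subgroup.toAddSubgroup M)) with hW
  have hmem : ∀ w : W, (fun k => (⟨Real.exp ((w : Fin (r + 1) → ℝ) k), Real.exp_pos _⟩ :
      {x : ℝ // 0 < x})) ∈ M := by
    rintro ⟨w, η, hη, rfl⟩
    have hη' : η.toMul ∈ M := hη
    convert hη' using 1
    ext k
    exact Real.exp_log (η.toMul k).2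
  have hdisc : DiscreteTopology W := by
    refine DiscreteTopology.of_continuous_injective (β := M)
      (f := fun w : W => (⟨_, hmem w⟩ : M)) ?_ ?_
    · refine Continuous.subtype_mk (continuous_pi fun k => Continuous.subtype_mk ?_ _) _
      exact Real.continuous_exp.comp ((continuous_apply k).comp continuous_subtype_val)
    · intro w w' h
      ext k
      have h1 := congrArg (fun z : M => ((z : PosVec r) k : ℝ)) h
      exact Real.exp_injective h1
  have hfr : Module.finrank ℤ W = r := by
    obtain ⟨e⟩ := hMrank
    have e1 : W ≃+ Additive M :=
      ((AddSubgroup.equivMapOfInjective (Subgroup.toAddSubgroup M) logHom logHom_injective).symm)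
    have e2 : Additive M ≃+ (Fin r → ℤ) := MulEquiv.toAdditiveLeft e
    rw [((e1.trans e2).toIntLinearEquiv).finrank_eq]
    simp
  have hspan : Submodule.span ℝ (W : Set (Fin (r + 1) → ℝ)) =
      Submodule.span ℝ (Set.range fun j => logVec (ε j)) := by
    apply le_antisymm
    · rw [Submodule.span_le]
      rintro w ⟨η, hη, rfl⟩
      obtain ⟨a, ha⟩ := exists_eq_unitPow hε (show η.toMul ∈ M from hη)
      have h1 : logHom η = ∑ j, (a j : ℝ) • logVec (ε j) := by
        change logVec η.toMul = _
        rw [ha, logVec_unitPow]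
        ext k
        simp [logVec]
      rw [h1]
      exact Submodule.sum_mem _ fun j _ =>
        Submodule.smul_mem _ _ (Submodule.subset_span (Set.mem_range_self j))
    · refine Submodule.span_mono ?_
      rintro _ ⟨j, rfl⟩
      refine ⟨Additive.ofMul (ε j), ?_, rfl⟩
      exact (hε ▸ Subgroup.subset_closure (Set.mem_range_self j) : ε j ∈ M)
  have hfr2 := Real.finrank_eq_int_finrank_of_discrete (s := (W : Set (Fin (r + 1) → ℝ)))
    (by rw [Submodule.span_eq]; exact hdisc)
  rw [Set.finrank, Set.finrank, Submodule.span_eq, hfr] at hfr2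
  rw [linearIndependent_iff_card_eq_finrank_span, Set.finrank, ← hspan, hfr2,
    Fintype.card_fin]

/-- The generators have norm one and their logarithms are linearly independent. -/
structure IsUnitSystem (ε : Fin r → PosVec r) : Prop where
  det_ne : (logMatrix ε).det ≠ 0
  sum_log : ∀ j, ∑ k, Real.log (ε j k) = 0

/-- Let c be in the kernel of the matrix. Adding all rows kills the logarithms, because the norms
are 1, and leaves n·c_0 = 0; the rest of c is then a linear relation among independent vectors. -/
theorem isUnitSystem {M : Subgroup (PosVec r)} (hMdisc : DiscreteTopology M)
    (hMrank : Nonempty (M ≃* Multiplicative (Fin r → ℤ)))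
    (hMnorm : ∀ η ∈ M, ∏ k, (η k : ℝ) = 1)
    {ε : Fin r → PosVec r} (hε : Subgroup.closure (Set.range ε) = M) : IsUnitSystem ε := by
  have hsum : ∀ j, ∑ k, Real.log (ε j k) = 0 := by
    intro j
    rw [← Real.log_prod (fun k _ => (ε j k).2.ne'),
      hMnorm _ (hε ▸ Subgroup.subset_closure (Set.mem_range_self j)), Real.log_one]
  refine ⟨fun hdet => ?_, hsum⟩
  obtain ⟨c, hc0, hc⟩ := Matrix.exists_mulVec_eq_zero_iff.mpr hdet
  have hrow : ∀ k, c 0 + ∑ j : Fin r, Real.log (ε j k) * c j.succ = 0 := by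
    intro k
    have := congrFun hc k
    simpa [Matrix.mulVec, dotProduct, logMatrix, Fin.sum_univ_succ] using this
  have h0 : c 0 = 0 := by
    have h1 : ∑ k : Fin (r + 1), (c 0 + ∑ j : Fin r, Real.log (ε j k) * c j.succ) = 0 :=
      Finset.sum_eq_zero fun k _ => hrow k
    rw [Finset.sum_add_distrib, Finset.sum_comm] at h1
    simp_rw [← Finset.sum_mul, hsum] at h1
    simp only [Finset.sum_const, Finset.card_univ, Fintype.card_fin, nsmul_eq_mul, zero_mul,
      mul_zero, add_zero, mul_eq_zero] at h1
    exact h1.resolve_left (by positivity)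
  have hli := Fintype.linearIndependent_iff.mp (linearIndependent_logVec hMdisc hMrank hε)
    (fun j => c j.succ) (by
      ext k
      have := hrow k
      rw [h0, zero_add] at this
      simpa [logVec, mul_comm] using this)
  refine hc0 (funext fun k => ?_)
  refine Fin.cases h0 (fun j => hli j) k

namespace IsUnitSystem

variable {ε : Fin r → PosVec r} (hU : IsUnitSystem ε)
include hU

theorem inv_mul : (logMatrix ε)⁻¹ * logMatrix ε = 1 :=
  Matrix.nonsing_inv_mul _ (isUnit_iff_ne_zero.mpr hU.det_ne)

theorem mul_inv : logMatrix ε * (logMatrix ε)⁻¹ = 1 :=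
  Matrix.mul_nonsing_inv _ (isUnit_iff_ne_zero.mpr hU.det_ne)

theorem sum_invEntry (i : Fin r) : ∑ k, invEntry ε i k = 0 := by
  have := congrFun (congrFun hU.inv_mul i.succ) 0
  rw [Matrix.mul_apply, Matrix.one_apply_ne (Fin.succ_ne_zero i)] at this
  simpa [logMatrix, invEntry] using this

theorem sum_invEntry_mul_log (i j : Fin r) :
    ∑ k, invEntry ε i k * Real.log (ε j k) = if i = j then 1 else 0 := by
  have := congrFun (congrFun hU.inv_mul i.succ) j.succ
  rw [Matrix.mul_apply, Matrix.one_apply] at this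
  simpa [logMatrix, invEntry] using this

theorem prod_unitVec (x : Fin r → ℝ) : ∏ k, unitVec ε x k = 1 := by
  simp only [unitVec]
  rw [← Real.exp_sum, Finset.sum_comm]
  simp_rw [← Finset.mul_sum, hU.sum_log]
  simp

theorem exists_log_eq {w : Fin (r + 1) → ℝ} (hw : ∑ k, w k = 0) :
    ∃ x : Fin r → ℝ, ∀ k, ∑ j, x j * Real.log (ε j k) = w k := by
  set c := (logMatrix ε)⁻¹ *ᵥ w with hc
  have h1 : logMatrix ε *ᵥ c = w := by
    rw [hc, Matrix.mulVec_mulVec, hU.mul_inv, Matrix.one_mulVec]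
  have hrow : ∀ k, c 0 + ∑ j : Fin r, c j.succ * Real.log (ε j k) = w k := by
    intro k
    have := congrFun h1 k
    simpa [Matrix.mulVec, dotProduct, logMatrix, Fin.sum_univ_succ, mul_comm] using this
  have h0 : c 0 = 0 := by
    have h2 : ∑ k : Fin (r + 1), (c 0 + ∑ j : Fin r, c j.succ * Real.log (ε j k)) = 0 := by
      exact (Finset.sum_congr rfl fun k _ => hrow k).trans hw
    rw [Finset.sum_add_distrib, Finset.sum_comm] at h2
    simp_rw [← Finset.mul_sum, hU.sum_log] at h2
    simp only [Finset.sum_const, Finset.card_univ, Fintype.card_fin, nsmul_eq_mul, mul_zero,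
      add_zero, mul_eq_zero] at h2
    exact h2.resolve_left (by positivity)
  exact ⟨fun j => c j.succ, fun k => by simpa [h0] using hrow k⟩

/-- The vector with entry r at k₀ and -1 elsewhere has sum zero, so it is a real combination of the
logarithms of the generators. Multiplying by T + K and rounding the coefficients down leaves every
entry off k₀ at most -T. -/
theorem exists_contracting (k₀ : Fin (r + 1)) (T : ℝ) :
    ∃ a : Fin r → ℤ, ∀ k, k ≠ k₀ → unitVec ε (fun j => (a j : ℝ)) k ≤ Real.exp (-T) := by
  set w : Fin (r + 1) → ℝ := fun k => if k = k₀ then (r : ℝ) else -1 with hw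
  have hw0 : ∑ k, w k = 0 := by
    have h1 : ∀ k, w k = (if k = k₀ then ((r : ℝ) + 1) else 0) + (-1) := by
      intro k; simp only [hw]; split_ifs <;> ring
    simp_rw [h1, Finset.sum_add_distrib, Finset.sum_ite_eq' Finset.univ k₀]
    simp
  obtain ⟨x, hx⟩ := hU.exists_log_eq hw0
  -- K bounds the rounding error in each coordinate, whatever the fractional parts are.
  set K : ℝ := ∑ k, ∑ j, |Real.log (ε j k)| with hK
  refine ⟨fun j => ⌊(T + K) * x j⌋, fun k hk => Real.exp_le_exp.mpr ?_⟩
  have h2 : ∑ j, (⌊(T + K) * x j⌋ : ℝ) * Real.log (ε j k) =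
      (T + K) * w k - ∑ j, Int.fract ((T + K) * x j) * Real.log (ε j k) := by
    rw [← hx k, Finset.mul_sum, ← Finset.sum_sub_distrib]
    refine Finset.sum_congr rfl fun j _ => ?_
    rw [Int.fract]; ring
  have h3 : |∑ j, Int.fract ((T + K) * x j) * Real.log (ε j k)| ≤ K := by
    refine (Finset.abs_sum_le_sum_abs _ _).trans ?_
    refine le_trans (Finset.sum_le_sum fun j _ => ?_) (Finset.single_le_sum
      (f := fun k => ∑ j, |Real.log (ε j k)|)
      (fun k _ => Finset.sum_nonneg fun j _ => abs_nonneg _) (Finset.mem_univ k))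
    rw [abs_mul, abs_of_nonneg (Int.fract_nonneg _)]
    exact mul_le_of_le_one_left (abs_nonneg _) (Int.fract_lt_one _).le
  have h4 : w k = -1 := by simp [hw, hk]
  rw [h2, h4]
  linarith [(abs_le.mp h3).1]

end IsUnitSystem

theorem exists_forall_norm_lt_eq_zero (L : Submodule ℤ (Fin (r + 1) → ℝ)) [DiscreteTopology L] :
    ∃ δ : ℝ, 0 < δ ∧ ∀ l ∈ L, ‖l‖ < δ → l = 0 := by
  obtain ⟨δ, hδ, h⟩ := Metric.isOpen_iff.mp (isOpen_discrete ({0} : Set L)) 0 rfl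
  refine ⟨δ, hδ, fun l hl hlt => ?_⟩
  have : (⟨l, hl⟩ : L) ∈ ({0} : Set L) := h (by rw [mem_ball_zero_iff]; exact hlt)
  simpa using this

/-- A unit contracting every coordinate other than k₀ would shrink a vector with vanishing k₀-th
coordinate below the minimal length of L. Only discreteness and stability under M enter, so the
argument serves the dual lattice equally. -/
theorem eq_zero_of_coord_eq_zero {L : Submodule ℤ (Fin (r + 1) → ℝ)} [DiscreteTopology L]
    {M : Subgroup (PosVec r)} {ε : Fin r → PosVec r}
    (hε : Subgroup.closure (Set.range ε) = M) (hU : IsUnitSystem ε)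
    (hML : ∀ η ∈ M, ∀ l ∈ L, scale η l ∈ L) {l : Fin (r + 1) → ℝ} (hl : l ∈ L)
    {k₀ : Fin (r + 1)} (hk₀ : l k₀ = 0) : l = 0 := by
  obtain ⟨δ, hδ, hd⟩ := exists_forall_norm_lt_eq_zero L
  obtain ⟨T, hT⟩ : ∃ T : ℝ, Real.exp (-T) * ‖l‖ < δ := by
    have h1 : Tendsto (fun T : ℝ => Real.exp (-T) * ‖l‖) atTop (𝓝 (0 * ‖l‖)) :=
      (Real.tendsto_exp_neg_atTop_nhds_zero).mul_const _
    rw [zero_mul] at h1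
    exact (h1.eventually (gt_mem_nhds hδ)).exists
  obtain ⟨a, ha⟩ := hU.exists_contracting k₀ T
  have h2 := hd _ (hML _ (unitPow_mem hε a) _ hl) (by
    refine lt_of_le_of_lt ?_ hT
    rw [pi_norm_le_iff_of_nonneg (by positivity)]
    intro k
    by_cases hk : k = k₀
    · subst hk; simp only [scale, hk₀, mul_zero, norm_zero]; positivity
    · rw [scale, norm_mul, Real.norm_of_nonneg (unitPow ε a k).2.le, unitPow_apply]
      gcongr
      · exact ha k hk
      · exact norm_le_pi_norm l k)
  ext k
  have h3 := congrFun h2 k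
  simp only [scale, Pi.zero_apply, mul_eq_zero] at h3
  exact h3.resolve_left (unitPow ε a k).2.ne'

/-- Coordinatewise multiplication is self-adjoint for the standard scalar product. -/
theorem scale_mem_dualLattice {L : Submodule ℤ (Fin (r + 1) → ℝ)} {M : Subgroup (PosVec r)}
    (hML : ∀ η ∈ M, ∀ l ∈ L, scale η l ∈ L) :
    ∀ η ∈ M, ∀ l ∈ dualLattice L, scale η l ∈ dualLattice L := by
  intro η hη l hl
  rw [mem_dualLattice] at hl ⊢
  intro w hw
  obtain ⟨a, ha⟩ := hl _ (hML η hη w hw)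
  refine ⟨a, ha.trans (Finset.sum_congr rfl fun k _ => ?_)⟩
  simp only [scale]; ring

/-- The norm does not change, and the rows e_j are dual to the logarithms of the generators, so the
exponent of λ_{-m} changes by an integral multiple of 2πi. -/
theorem zetaTerm_scale {M : Subgroup (PosVec r)} {ε : Fin r → PosVec r}
    (hε : Subgroup.closure (Set.range ε) = M) (hU : IsUnitSystem ε)
    {η : PosVec r} (hη : η ∈ M) {l : Fin (r + 1) → ℝ} (hl : ∀ k, l k ≠ 0) (m : Fin r → ℤ) (s : ℂ) :
    zetaTerm ε m s (scale η l) = zetaTerm ε m s l := by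
  obtain ⟨a, rfl⟩ := exists_eq_unitPow hε hη
  have hprod : ∏ k, (unitPow ε a k : ℝ) = 1 := by
    simp_rw [unitPow_apply]; exact hU.prod_unitVec _
  have hN : vecNorm (scale (unitPow ε a) l) = vecNorm l := by
    simp [vecNorm, scale, Finset.prod_mul_distrib, hprod]
  rw [zetaTerm, zetaTerm, hN]
  congr 1
  rw [grossen, grossen, Complex.exp_eq_exp_iff_exists_int]
  -- The sign is that of the character λ_{-m}; a is the exponent vector of the unit.
  refine ⟨-∑ j, m j * a j, ?_⟩
  have hlog : ∀ k, Real.log |scale (unitPow ε a) l k| =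
      Real.log |l k| + ∑ i, (a i : ℝ) * Real.log (ε i k) := by
    intro k
    rw [scale, abs_mul, Real.log_mul (by simpa using (unitPow ε a k).2.ne') (by simpa using hl k),
      abs_of_pos (unitPow ε a k).2, add_comm]
    congr 1
    exact congrFun (logVec_unitPow ε a) k
  have h1 : ∑ k, ∑ j, (m j : ℝ) * invEntry ε j k * ∑ i, (a i : ℝ) * Real.log (ε i k) =
      ∑ j, (m j : ℝ) * a j := by
    rw [Finset.sum_comm]
    refine Finset.sum_congr rfl fun j _ => ?_
    have h2 : ∀ k, (m j : ℝ) * invEntry ε j k * ∑ i, (a i : ℝ) * Real.log (ε i k) =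
        (m j : ℝ) * ∑ i, (a i : ℝ) * (invEntry ε j k * Real.log (ε i k)) := by
      intro k
      rw [mul_assoc, Finset.mul_sum]
      congr 1
      exact Finset.sum_congr rfl fun i _ => by ring
    simp_rw [h2]
    rw [← Finset.mul_sum, Finset.sum_comm]
    simp_rw [← Finset.mul_sum, hU.sum_invEntry_mul_log]
    simp
  have h1' : ∑ k, ∑ j, (m j : ℂ) * (invEntry ε j k : ℂ) *
      ((∑ i, (a i : ℝ) * Real.log (ε i k) : ℝ) : ℂ) = ∑ j, (m j : ℂ) * a j := by
    exact_mod_cast h1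
  push_cast
  rw [← h1', ← Finset.sum_neg_distrib, Finset.sum_mul, ← Finset.sum_add_distrib]
  refine Finset.sum_congr rfl fun k _ => ?_
  rw [← Finset.sum_neg_distrib, Finset.sum_mul, ← Finset.sum_add_distrib]
  refine Finset.sum_congr rfl fun j _ => ?_
  rw [hlog]
  push_cast [Pi.neg_apply]
  ring

end LatticeZeta

/-! ### Characters, theta averages over a period cell, and the functional equation pair. -/

namespace LatticeZeta
open MeasureTheory Matrix

variable {r : ℕ}

/-- The character `x ↦ exp (2πi ∑ⱼ mⱼ xⱼ)`. -/
noncomputable def expChar (m : Fin r → ℤ) (x : Fin r → ℝ) : ℂ :=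
  Complex.exp (2 * Real.pi * Complex.I * ∑ j, (m j : ℂ) * (x j : ℂ))

theorem norm_expChar (m : Fin r → ℤ) (x : Fin r → ℝ) : ‖expChar m x‖ = 1 := by
  have : 2 * (Real.pi : ℂ) * Complex.I * ∑ j, (m j : ℂ) * (x j : ℂ) =
      ((2 * Real.pi * ∑ j, (m j : ℝ) * x j : ℝ) : ℂ) * Complex.I := by
    push_cast; ring
  rw [expChar, this, Complex.norm_exp_ofReal_mul_I]

theorem continuous_expChar (m : Fin r → ℤ) : Continuous (expChar m) := by
  unfold expChar; fun_prop

theorem expChar_add (m : Fin r → ℤ) (x y : Fin r → ℝ) :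
    expChar m (x + y) = expChar m x * expChar m y := by
  rw [expChar, expChar, expChar, ← Complex.exp_add]
  congr 1
  push_cast [Pi.add_apply]
  simp only [mul_add, Finset.sum_add_distrib]

theorem expChar_intCast (m a : Fin r → ℤ) : expChar m (fun j => (a j : ℝ)) = 1 := by
  rw [expChar, Complex.exp_eq_one_iff]
  refine ⟨∑ j, m j * a j, ?_⟩
  push_cast
  ring

theorem expChar_neg (m : Fin r → ℤ) (x : Fin r → ℝ) : expChar m (-x) = expChar (-m) x := by
  simp [expChar]

theorem expChar_zero (x : Fin r → ℝ) : expChar 0 x = 1 := by simp [expChar]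

theorem integral_expChar (m : Fin r → ℤ) :
    ∫ x in unitCube (Fin r), expChar m x = if m = 0 then 1 else 0 := by
  split_ifs with h
  · subst h
    simp [expChar_zero, Measure.real, volume_unitCube]
  · obtain ⟨j, hj⟩ := Function.ne_iff.mp h
    have h1 : ∀ x : Fin r → ℝ, expChar m x =
        ∏ j, Complex.exp (2 * Real.pi * Complex.I * (m j : ℂ) * (x j : ℂ)) := by
      intro x
      rw [expChar, ← Complex.exp_sum, Finset.mul_sum]
      congr 1
      exact Finset.sum_congr rfl fun j _ => by ring
    simp_rw [h1]
    rw [unitCube_eq_pi, volume_pi, Measure.restrict_pi_pi, integral_fintype_prod_eq_prod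
      (f := fun j (x : ℝ) => Complex.exp (2 * Real.pi * Complex.I * (m j : ℂ) * (x : ℂ)))]
    refine Finset.prod_eq_zero (Finset.mem_univ j) ?_
    rw [← intervalIntegral.integral_of_le zero_le_one, integral_exp_mul_complex]
    · have h2 : Complex.exp (2 * Real.pi * Complex.I * (m j : ℂ) * ((1 : ℝ) : ℂ)) = 1 := by
        rw [Complex.exp_eq_one_iff]
        exact ⟨m j, by push_cast; ring⟩
      rw [h2]; simp
    · have : (m j : ℂ) ≠ 0 := by exact_mod_cast hj
      have : (Real.pi : ℂ) ≠ 0 := by exact_mod_cast Real.pi_ne_zero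
      simp [*]

/-- The reflection x ↦ 1 - x preserves the closed cube, which agrees with the half-open one up to a
null set; periodicity under the all-ones vector then replaces 1 - x by -x. -/
theorem setIntegral_unitCube_neg {E : Type*} [NormedAddCommGroup E] [NormedSpace ℝ E]
    {ι : Type*} [Fintype ι] {h : (ι → ℝ) → E}
    (hper : ∀ x, h (x + fun _ => (1 : ℝ)) = h x) :
    ∫ x in unitCube ι, h (-x) = ∫ x in unitCube ι, h x := by
  have hae : (unitCube ι : Set (ι → ℝ)) =ᵐ[volume] Set.Icc 0 1 := by
    have := Measure.univ_pi_Ioc_ae_eq_Icc (μ := fun _ : ι => (volume : Measure ℝ))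
      (f := fun _ => 0) (g := fun _ => 1)
    rw [unitCube_eq_pi]
    exact this
  rw [setIntegral_congr_set hae, setIntegral_congr_set hae]
  have hmp : MeasurePreserving (fun x : ι → ℝ => (fun _ => (1 : ℝ)) - x) volume volume :=
    Measure.measurePreserving_sub_left _ _
  rw [← hmp.setIntegral_preimage_emb (measurableEmbedding_subLeft _) h]
  have hs : (fun x : ι → ℝ => (fun _ => (1 : ℝ)) - x) ⁻¹' Set.Icc 0 1 = Set.Icc 0 1 := by
    ext x
    simp only [Set.mem_preimage, Set.mem_Icc, Pi.le_def, Pi.sub_apply, Pi.zero_apply, Pi.one_apply]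
    constructor <;> rintro ⟨h1, h2⟩ <;> constructor <;> intro i <;> linarith [h1 i, h2 i]
  rw [hs]
  congr 1
  ext x
  rw [← hper (-x)]
  congr 1
  ext i
  simp [sub_eq_neg_add]

section Theta

variable (L : Submodule ℤ (Fin (r + 1) → ℝ)) [DiscreteTopology L]

omit [DiscreteTopology L] in
theorem theta_nonneg (y : Fin (r + 1) → ℝ) : 0 ≤ theta L y :=
  tsum_nonneg fun _ => (Real.exp_pos _).le

theorem theta_antitone {y z : Fin (r + 1) → ℝ} (hy : ∀ k, 0 < y k) (hyz : ∀ k, y k ≤ z k) :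
    theta L z ≤ theta L y := by
  refine (summable_theta L fun k => (hy k).trans_le (hyz k)).tsum_le_tsum (fun l => ?_)
    (summable_theta L hy)
  refine Real.exp_le_exp.mpr ?_
  rw [neg_mul, neg_mul, neg_le_neg_iff]
  have := Real.pi_pos
  gcongr with k
  exact hyz k

theorem continuousAt_theta {y : Fin (r + 1) → ℝ} (hy : ∀ k, 0 < y k) :
    ContinuousAt (theta L) y := by
  obtain ⟨c, hc, hcy⟩ := exists_pos_le hy
  have hopen : IsOpen (Set.univ.pi fun _ : Fin (r + 1) => Set.Ioi (c / 2)) :=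
    isOpen_set_pi Set.finite_univ fun _ _ => isOpen_Ioi
  refine ContinuousOn.continuousAt (s := Set.univ.pi fun _ : Fin (r + 1) => Set.Ioi (c / 2)) ?_
    (hopen.mem_nhds fun k _ => by simp only [Set.mem_Ioi]; linarith [hcy k])
  refine continuousOn_tsum (u := fun l : L => Real.exp (-(Real.pi * (c / 2)) *
    ‖(l : Fin (r + 1) → ℝ)‖ ^ 2)) (fun l => by fun_prop)
    (summable_exp_neg_norm_sq L (by positivity)) ?_
  intro l z hz
  rw [Real.norm_of_nonneg (Real.exp_pos _).le]
  refine Real.exp_le_exp.mpr ?_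
  have := mul_le_mul_of_nonneg_left (mul_norm_sq_le_sum (half_pos hc)
    (fun k => (le_of_lt (hz k trivial) : c / 2 ≤ z k)) (l : Fin (r + 1) → ℝ)) Real.pi_pos.le
  linarith

/-- A nonzero l has ‖l‖ ≥ δ. Of the Gaussian exponent, proportional to t‖l‖², the share t - 1 gives
the factor exp(-a(t-1)) uniformly in l, and the remaining share 1 keeps the sum convergent. -/
theorem exists_theta_sub_one_le {c : ℝ} (hc : 0 < c) :
    ∃ C a : ℝ, 0 < a ∧ ∀ t : ℝ, 1 ≤ t → ∀ y : Fin (r + 1) → ℝ, (∀ k, t * c ≤ y k) →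
      |theta L y - 1| ≤ C * Real.exp (-a * t) := by
  obtain ⟨δ, hδ, hd⟩ := exists_forall_norm_lt_eq_zero L
  set a := Real.pi * c * δ ^ 2 with ha
  set S := ∑' l : L, Real.exp (-(Real.pi * c) * ‖(l : Fin (r + 1) → ℝ)‖ ^ 2) with hS
  have hsS := summable_exp_neg_norm_sq L (c := Real.pi * c) (by positivity)
  refine ⟨Real.exp a * S, a, by positivity, fun t ht y hy => ?_⟩
  have hy0 : ∀ k, 0 < y k := fun k => lt_of_lt_of_le (by positivity) (hy k)
  have hsum := summable_theta L hy0
  have h1 : theta L y - 1 = ∑' l : L, if l = 0 then 0 else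
      Real.exp (-Real.pi * ∑ k, y k * (l : Fin (r + 1) → ℝ) k ^ 2) := by
    rw [theta, hsum.tsum_eq_add_tsum_ite 0]
    simp
  rw [h1, abs_of_nonneg (tsum_nonneg fun l => by split_ifs <;> positivity)]
  have h2 : ∀ l : L, (if l = 0 then 0 else
      Real.exp (-Real.pi * ∑ k, y k * (l : Fin (r + 1) → ℝ) k ^ 2)) ≤
      Real.exp a * Real.exp (-a * t) *
        Real.exp (-(Real.pi * c) * ‖(l : Fin (r + 1) → ℝ)‖ ^ 2) := by
    intro l
    split_ifs with hl
    · positivity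
    · rw [← Real.exp_add, ← Real.exp_add]
      refine Real.exp_le_exp.mpr ?_
      have h3 : δ ≤ ‖(l : Fin (r + 1) → ℝ)‖ := by
        by_contra h
        exact hl (Subtype.ext (hd _ l.2 (not_le.mp h)))
      have h4 := mul_le_mul_of_nonneg_left (mul_norm_sq_le_sum (c := t * c) (by positivity) hy
        (l : Fin (r + 1) → ℝ)) Real.pi_pos.le
      have h5 : δ ^ 2 ≤ ‖(l : Fin (r + 1) → ℝ)‖ ^ 2 := by gcongr
      have h6 : 0 ≤ Real.pi * c * (t - 1) := by
        have := sub_nonneg.mpr ht; positivity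
      have h7 := mul_le_mul_of_nonneg_left h5 h6
      simp only [ha]
      nlinarith
  have hs2 := hsS.mul_left (Real.exp a * Real.exp (-a * t))
  calc _ ≤ ∑' l : L, Real.exp a * Real.exp (-a * t) *
        Real.exp (-(Real.pi * c) * ‖(l : Fin (r + 1) → ℝ)‖ ^ 2) :=
        (Summable.of_nonneg_of_le (fun l => by split_ifs <;> positivity) h2 hs2).tsum_le_tsum h2 hs2
    _ = _ := by rw [tsum_mul_left]; ring

end Theta

/-- The data of a lattice stable under the group generated by a system of units. -/
structure IsZetaDatum (L : Submodule ℤ (Fin (r + 1) → ℝ)) (M : Subgroup (PosVec r))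
    (ε : Fin r → PosVec r) : Prop where
  closure_eq : Subgroup.closure (Set.range ε) = M
  isUnitSystem : IsUnitSystem ε
  scale_mem : ∀ η ∈ M, ∀ l ∈ L, scale η l ∈ L

section Average

variable {L : Submodule ℤ (Fin (r + 1) → ℝ)} {M : Subgroup (PosVec r)} {ε : Fin r → PosVec r}

/-- The point `(t E(x)_k ^ 2)_k` of the positive orthant. -/
noncomputable def orthantPt (ε : Fin r → PosVec r) (t : ℝ) (x : Fin r → ℝ) :
    Fin (r + 1) → ℝ := fun k => t * unitVec ε x k ^ 2

theorem orthantPt_pos {t : ℝ} (ht : 0 < t) (x : Fin r → ℝ) (k : Fin (r + 1)) :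
    0 < orthantPt ε t x k := mul_pos ht (pow_pos (unitVec_pos _ _ _) 2)

theorem continuous_orthantPt : Continuous fun p : ℝ × (Fin r → ℝ) => orthantPt ε p.1 p.2 := by
  refine continuous_pi fun k => ?_
  exact continuous_fst.mul (((continuous_unitVec ε k).comp continuous_snd).pow 2)

/-- Units with exponents in the compact period cell stay away from 0, which makes the estimates of θ
uniform over the cell. -/
theorem exists_le_orthantPt (ε : Fin r → PosVec r) :
    ∃ c : ℝ, 0 < c ∧ ∀ x ∈ unitCube (Fin r), ∀ t : ℝ, 0 ≤ t → ∀ k, t * c ≤ orthantPt ε t x k := by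
  set K : ℝ := ∑ k, ∑ j, |Real.log (ε j k)| with hK
  refine ⟨Real.exp (-K) ^ 2, by positivity, fun x hx t ht k => ?_⟩
  have h3 : |∑ j, x j * Real.log (ε j k)| ≤ K := by
    refine (Finset.abs_sum_le_sum_abs _ _).trans ?_
    refine le_trans (Finset.sum_le_sum fun j _ => ?_) (Finset.single_le_sum
      (f := fun k => ∑ j, |Real.log (ε j k)|)
      (fun k _ => Finset.sum_nonneg fun j _ => abs_nonneg _) (Finset.mem_univ k))
    rw [abs_mul, abs_of_nonneg (hx j).1.le]
    exact mul_le_of_le_one_left (abs_nonneg _) (hx j).2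
  rw [orthantPt, unitVec]
  have := (abs_le.mp h3).1
  gcongr

/-- Multiplication by an element of the group as a permutation of the lattice. -/
noncomputable def scaleEquiv (h : IsZetaDatum L M ε) (a : Fin r → ℤ) : L ≃ L where
  toFun l := ⟨scale (unitPow ε a) l, h.scale_mem _ (unitPow_mem h.closure_eq a) _ l.2⟩
  invFun l := ⟨scale (unitPow ε a)⁻¹ l,
    h.scale_mem _ (M.inv_mem (unitPow_mem h.closure_eq a)) _ l.2⟩
  left_inv l := by
    ext k
    have : (unitPow ε a k : ℝ) ≠ 0 := (unitPow ε a k).2.ne'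
    simp [scale, this]
  right_inv l := by
    ext k
    have : (unitPow ε a k : ℝ) ≠ 0 := (unitPow ε a k).2.ne'
    simp [scale, this]

theorem sum_orthantPt_add (t : ℝ) (x : Fin r → ℝ) (a : Fin r → ℤ) (l : Fin (r + 1) → ℝ) :
    ∑ k, orthantPt ε t (x + fun j => (a j : ℝ)) k * l k ^ 2 =
      ∑ k, orthantPt ε t x k * scale (unitPow ε a) l k ^ 2 := by
  refine Finset.sum_congr rfl fun k _ => ?_
  rw [orthantPt, orthantPt, unitVec_add, scale, unitPow_apply]
  ring

/-- The translation can be moved from the quadratic form to the lattice, where it is multiplication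
by a unit and permutes L. -/
theorem theta_orthantPt_add (h : IsZetaDatum L M ε) (t : ℝ) (x : Fin r → ℝ) (a : Fin r → ℤ) :
    theta L (orthantPt ε t (x + fun j => (a j : ℝ))) = theta L (orthantPt ε t x) := by
  refine Eq.trans (tsum_congr fun l => ?_) ((scaleEquiv h a).tsum_eq fun l : L =>
    Real.exp (-Real.pi * ∑ k, orthantPt ε t x k * (l : Fin (r + 1) → ℝ) k ^ 2))
  rw [sum_orthantPt_add]
  rfl

/-- The average of the theta function over a period cell, against a character. -/
noncomputable def thetaAvg (L : Submodule ℤ (Fin (r + 1) → ℝ)) (ε : Fin r → PosVec r)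
    (m : Fin r → ℤ) (t : ℝ) : ℂ :=
  ∫ x in unitCube (Fin r), (theta L (orthantPt ε t x) : ℂ) * expChar m x

variable [DiscreteTopology L]

theorem continuous_theta_orthantPt {t : ℝ} (ht : 0 < t) :
    Continuous fun x => theta L (orthantPt ε t x) := by
  rw [continuous_iff_continuousAt]
  intro x
  have h2 : Continuous fun x : Fin r → ℝ => orthantPt ε t x :=
    continuous_orthantPt.comp (Continuous.prodMk_right t)
  exact (continuousAt_theta L (orthantPt_pos ht x)).comp h2.continuousAt

theorem continuousOn_thetaAvg (m : Fin r → ℤ) : ContinuousOn (thetaAvg L ε m) (Set.Ioi 0) := by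
  intro t₀ (ht₀ : 0 < t₀)
  refine ContinuousAt.continuousWithinAt ?_
  obtain ⟨c, hc, hcx⟩ := exists_le_orthantPt ε
  have hpos : ∀ᶠ t : ℝ in 𝓝 t₀, t₀ / 2 < t := lt_mem_nhds (half_lt_self ht₀)
  refine continuousAt_of_dominated (bound := fun _ => theta L fun _ => t₀ / 2 * c) ?_ ?_ ?_ ?_
  · filter_upwards [hpos] with t ht
    refine Continuous.aestronglyMeasurable ?_
    exact (Complex.continuous_ofReal.comp (continuous_theta_orthantPt
      ((half_pos ht₀).trans ht))).mul (continuous_expChar m)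
  · filter_upwards [hpos] with t ht
    refine (ae_restrict_iff' measurableSet_unitCube).mpr (Eventually.of_forall fun x hx => ?_)
    rw [norm_mul, norm_expChar, mul_one, Complex.norm_of_nonneg (theta_nonneg L _)]
    refine theta_antitone L (fun _ => by positivity) fun k => ?_
    refine le_trans ?_ (hcx x hx t ((half_pos ht₀).trans ht).le k)
    gcongr
  · exact integrable_const _
  · refine Eventually.of_forall fun x => ContinuousAt.mul ?_ continuousAt_const
    refine Complex.continuous_ofReal.continuousAt.comp ?_
    have h2 : Continuous fun t : ℝ => orthantPt ε t x :=
      continuous_orthantPt.comp (Continuous.prodMk_left x)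
    exact ContinuousAt.comp (f := fun t : ℝ => orthantPt ε t x)
      (continuousAt_theta L (orthantPt_pos ht₀ x)) h2.continuousAt

theorem integrableOn_theta_mul_expChar (m : Fin r → ℤ) {t : ℝ} (ht : 0 < t) :
    IntegrableOn (fun x => (theta L (orthantPt ε t x) : ℂ) * expChar m x) (unitCube (Fin r)) := by
  obtain ⟨c, hc, hcx⟩ := exists_le_orthantPt ε
  refine Integrable.mono' (integrable_const (theta L fun _ => t * c)) ?_ ?_
  · exact ((Complex.continuous_ofReal.comp (continuous_theta_orthantPt ht)).mul
      (continuous_expChar m)).aestronglyMeasurable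
  · refine (ae_restrict_iff' measurableSet_unitCube).mpr (Eventually.of_forall fun x hx => ?_)
    rw [norm_mul, norm_expChar, mul_one, Complex.norm_of_nonneg (theta_nonneg L _)]
    exact theta_antitone L (fun _ => by positivity) fun k => hcx x hx t ht.le k

/-- The term l = 0 of θ contributes the mean of the character over the cell; this is the constant
term of the functional equation pair. -/
theorem thetaAvg_sub (m : Fin r → ℤ) {t : ℝ} (ht : 0 < t) :
    thetaAvg L ε m t - (if m = 0 then 1 else 0) =
      ∫ x in unitCube (Fin r), ((theta L (orthantPt ε t x) - 1 : ℝ) : ℂ) * expChar m x := by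
  have hint : IntegrableOn (expChar m) (unitCube (Fin r)) :=
    Integrable.mono' (integrable_const (1 : ℝ)) (continuous_expChar m).aestronglyMeasurable
      (Eventually.of_forall fun x => (norm_expChar m x).le)
  rw [← integral_expChar, thetaAvg, ← integral_sub (integrableOn_theta_mul_expChar m ht) hint]
  congr 1
  ext x
  push_cast
  ring

theorem thetaAvg_isBigO (m : Fin r → ℤ) (p : ℝ) :
    (fun t => thetaAvg L ε m t - (if m = 0 then 1 else 0)) =O[atTop] fun t : ℝ => t ^ p := by
  obtain ⟨c, hc, hcx⟩ := exists_le_orthantPt ε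
  obtain ⟨C, a, ha, hb⟩ := exists_theta_sub_one_le L hc
  have h1 : (fun t => thetaAvg L ε m t - (if m = 0 then 1 else 0)) =O[atTop]
      fun t : ℝ => Real.exp (-a * t) := by
    refine Asymptotics.IsBigO.of_bound C ?_
    filter_upwards [eventually_ge_atTop 1] with t ht
    rw [thetaAvg_sub m (by linarith), Real.norm_of_nonneg (Real.exp_pos _).le]
    have := norm_setIntegral_le_of_norm_le_const (μ := volume) (s := unitCube (Fin r))
      (f := fun x => ((theta L (orthantPt ε t x) - 1 : ℝ) : ℂ) * expChar m x)
      (C := C * Real.exp (-a * t)) (by simp [volume_unitCube]) (fun x hx => by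
        rw [norm_mul, norm_expChar, mul_one, Complex.norm_real, Real.norm_eq_abs]
        exact hb t ht _ fun k => hcx x hx t (by linarith) k)
    simpa [Measure.real, volume_unitCube] using this
  exact h1.trans (isLittleO_exp_neg_mul_rpow_atTop ha p).isBigO

variable [IsZLattice ℝ L]

omit [DiscreteTopology L] [IsZLattice ℝ L] in
theorem IsZetaDatum.dual (h : IsZetaDatum L M ε) : IsZetaDatum (dualLattice L) M ε :=
  ⟨h.closure_eq, h.isUnitSystem, scale_mem_dualLattice h.scale_mem⟩

/-- Theta inversion along the orbit: since ∏_k E(x)_k = 1, the product of the y_k^(-1/2) reduces to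
t^(n/2), and inverting the coordinates replaces x by -x. -/
theorem theta_orthantPt_inv (h : IsZetaDatum L M ε) {t : ℝ} (ht : 0 < t) (x : Fin r → ℝ) :
    theta L (orthantPt ε (1 / t) x) = (ZLattice.covolume L)⁻¹ *
      t ^ (((r + 1 : ℕ) : ℝ) / 2) * theta (dualLattice L) (orthantPt ε t (-x)) := by
  rw [theta_functional_equation L (orthantPt_pos (by positivity) x)]
  congr 2
  · have h1 : ∀ k, orthantPt ε (1 / t) x k ^ (-(1 / 2) : ℝ) =
        t ^ ((1 / 2) : ℝ) * (unitVec ε x k)⁻¹ := by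
      intro k
      have hu := unitVec_pos ε x k
      rw [orthantPt, Real.mul_rpow (by positivity) (by positivity), one_div t,
        Real.inv_rpow ht.le, Real.rpow_neg ht.le, inv_inv, Real.rpow_neg (by positivity),
        ← Real.sqrt_eq_rpow (_ ^ 2), Real.sqrt_sq hu.le]
    simp_rw [h1]
    rw [Finset.prod_mul_distrib, Finset.prod_inv_distrib, h.isUnitSystem.prod_unitVec,
      Finset.prod_const, Finset.card_univ, Fintype.card_fin, inv_one, mul_one, ← Real.rpow_natCast,
      ← Real.rpow_mul ht.le]
    congr 1
    ring
  · ext k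
    rw [orthantPt, orthantPt, unitVec_neg]
    simp [mul_comm]

/-- Reflecting x to -x in the cell undoes the sign produced by theta inversion and exchanges the
characters of m and -m. -/
theorem thetaAvg_functional_equation (h : IsZetaDatum L M ε) (m : Fin r → ℤ) {t : ℝ}
    (ht : 0 < t) : thetaAvg L ε m (1 / t) = (((ZLattice.covolume L)⁻¹ : ℝ) *
      ((t ^ (((r + 1 : ℕ) : ℝ) / 2) : ℝ) : ℂ)) * thetaAvg (dualLattice L) ε (-m) t := by
  have h1 := setIntegral_unitCube_neg (ι := Fin r) (h := fun x =>
    (theta (dualLattice L) (orthantPt ε t x) : ℂ) * expChar (-m) x) (by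
      intro x
      have h2 := theta_orthantPt_add h.dual t x (fun _ => 1)
      have h3 := expChar_intCast (-m) (fun _ => 1)
      simp only [Int.cast_one] at h2 h3
      rw [h2, expChar_add, h3, mul_one])
  rw [thetaAvg, thetaAvg, ← h1, ← integral_const_mul]
  congr 1
  ext x
  rw [theta_orthantPt_inv h ht, expChar_neg, neg_neg]
  push_cast
  ring

/-- The theta averages of a lattice and its dual form a functional equation pair. -/
noncomputable def thetaPair (h : IsZetaDatum L M ε) (m : Fin r → ℤ) : WeakFEPair ℂ where
  f := thetaAvg L ε m
  g := thetaAvg (dualLattice L) ε (-m)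
  k := ((r + 1 : ℕ) : ℝ) / 2
  ε := (((ZLattice.covolume L)⁻¹ : ℝ) : ℂ)
  f₀ := if m = 0 then 1 else 0
  g₀ := if m = 0 then 1 else 0
  hf_int := (continuousOn_thetaAvg m).locallyIntegrableOn measurableSet_Ioi
  hg_int := (continuousOn_thetaAvg (-m)).locallyIntegrableOn measurableSet_Ioi
  hk := by positivity
  hε := by
    have := ZLattice.covolume_ne_zero L
    simpa using this
  h_feq t ht := by
    rw [smul_eq_mul]
    exact thetaAvg_functional_equation h m ht
  hf_top := thetaAvg_isBigO m
  hg_top p := by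
    have := thetaAvg_isBigO (L := dualLattice L) (ε := ε) (-m) p
    simpa only [neg_eq_zero] using this

end Average
end LatticeZeta

/-! ### The Mellin transform of one orbit as a product of Gamma integrals. -/

namespace LatticeZeta
open MeasureTheory Matrix

section LogCoordinates

variable {E : Type*} [NormedAddCommGroup E] [NormedSpace ℂ E]

theorem exp_smul_cpow (f : ℝ → E) (z : ℂ) (v : ℝ) :
    |Real.exp v| • (((Real.exp v : ℝ) : ℂ) ^ (z - 1) • f (Real.exp v)) =
      Complex.exp (v * z) • f (Real.exp v) := by
  rw [abs_of_pos (Real.exp_pos v), ← Complex.coe_smul, smul_smul]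
  congr 1
  rw [Complex.cpow_def_of_ne_zero (by exact_mod_cast (Real.exp_pos v).ne'), ← Complex.ofReal_log
    (Real.exp_pos v).le, Real.log_exp, Complex.ofReal_exp, ← Complex.exp_add]
  congr 1
  ring

/-- With t = e^v the later passage from (t, x) to coordinates on the orthant becomes a linear map.
-/
theorem mellin_eq_integral_exp (f : ℝ → E) (z : ℂ) :
    mellin f z = ∫ v : ℝ, Complex.exp (v * z) • f (Real.exp v) := by
  have := integral_image_eq_integral_abs_deriv_smul MeasurableSet.univ
    (fun x _ => (Real.hasDerivAt_exp x).hasDerivWithinAt)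
    (fun x _ y _ hxy => Real.exp_injective hxy) (fun t : ℝ => (t : ℂ) ^ (z - 1) • f t)
  rw [Set.image_univ, Real.range_exp] at this
  rw [mellin, this, setIntegral_univ]
  simp_rw [exp_smul_cpow]

theorem mellinConvergent_iff_integrable_exp (f : ℝ → E) (z : ℂ) :
    MellinConvergent f z ↔ Integrable fun v : ℝ => Complex.exp (v * z) • f (Real.exp v) := by
  have := integrableOn_image_iff_integrableOn_abs_deriv_smul MeasurableSet.univ
    (fun x _ => (Real.hasDerivAt_exp x).hasDerivWithinAt)
    (fun x _ y _ hxy => Real.exp_injective hxy) (fun t : ℝ => (t : ℂ) ^ (z - 1) • f t)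
  rw [Set.image_univ, Real.range_exp] at this
  rw [MellinConvergent, this, integrableOn_univ]
  simp_rw [exp_smul_cpow]

end LogCoordinates

section Gamma

theorem integrable_exp_mul_exp_neg_exp {z : ℂ} (hz : 0 < z.re) {c : ℝ} (hc : 0 < c) :
    Integrable fun v : ℝ => Complex.exp (v * z) * ((Real.exp (-(c * Real.exp v)) : ℝ) : ℂ) := by
  have h1 : MellinConvergent (fun t : ℝ => ((Real.exp (-t) : ℝ) : ℂ)) z := by
    have := Complex.GammaIntegral_convergent hz
    refine this.congr_fun (fun t _ => ?_) measurableSet_Ioi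
    simp [mul_comm]
  exact (mellinConvergent_iff_integrable_exp _ _).mp ((MellinConvergent.comp_mul_left hc).mpr h1)

theorem integral_exp_mul_exp_neg_exp {z : ℂ} (hz : 0 < z.re) {c : ℝ} (hc : 0 < c) :
    ∫ v : ℝ, Complex.exp (v * z) * ((Real.exp (-(c * Real.exp v)) : ℝ) : ℂ) =
      (c : ℂ) ^ (-z) * Complex.Gamma z := by
  have h1 := mellin_eq_integral_exp (fun t : ℝ => ((Real.exp (-(c * t)) : ℝ) : ℂ)) z
  simp only [smul_eq_mul] at h1
  rw [← h1, mellin]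
  have h2 := Complex.integral_cpow_mul_exp_neg_mul_Ioi hz hc
  have h3 : ((1 : ℂ) / c) ^ z = (c : ℂ) ^ (-z) := by
    rw [one_div, Complex.inv_cpow _ _ (by
      rw [Complex.arg_ofReal_of_nonneg hc.le]; exact Real.pi_pos.ne), Complex.cpow_neg]
  rw [← h3, ← h2]
  refine setIntegral_congr_fun measurableSet_Ioi fun t _ => ?_
  simp

end Gamma

variable {r : ℕ}

section ConsCoordinates

variable {E : Type*} [NormedAddCommGroup E]

theorem integrable_cons_iff {h : (Fin (r + 1) → ℝ) → E} :
    Integrable (fun p : ℝ × (Fin r → ℝ) => h (Fin.cons p.1 p.2)) ↔ Integrable h := by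
  have hem := (volume_preserving_piFinSuccAbove (fun _ : Fin (r + 1) => ℝ) 0).symm
  have := hem.integrable_comp_emb (MeasurableEquiv.measurableEmbedding _) (g := h)
  rw [← this]
  simp only [Function.comp_def, MeasurableEquiv.piFinSuccAbove_symm_apply, Fin.insertNthEquiv,
    Equiv.coe_fn_mk, Fin.insertNth_zero']

theorem integral_cons [NormedSpace ℝ E] (h : (Fin (r + 1) → ℝ) → E) :
    ∫ p : ℝ × (Fin r → ℝ), h (Fin.cons p.1 p.2) = ∫ w, h w := by
  have hem := (volume_preserving_piFinSuccAbove (fun _ : Fin (r + 1) => ℝ) 0).symm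
  have := hem.integral_comp (MeasurableEquiv.measurableEmbedding _) h
  rw [← this]
  simp only [MeasurableEquiv.piFinSuccAbove_symm_apply, Fin.insertNthEquiv,
    Equiv.coe_fn_mk, Fin.insertNth_zero']

end ConsCoordinates

variable {ε : Fin r → PosVec r}

/-- The Gaussian attached to a vector, along the orbit of the units. -/
noncomputable def gaussTerm (ε : Fin r → PosVec r) (l : Fin (r + 1) → ℝ) (t : ℝ)
    (x : Fin r → ℝ) : ℝ := Real.exp (-Real.pi * ∑ k, orthantPt ε t x k * l k ^ 2)

/-- The integral of the Gaussian of a vector against a character of the unit directions. -/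
noncomputable def orbitIntegral (ε : Fin r → PosVec r) (m : Fin r → ℤ) (l : Fin (r + 1) → ℝ)
    (t : ℝ) : ℂ := ∫ x : Fin r → ℝ, (gaussTerm ε l t x : ℂ) * expChar m x

theorem sum_shift (hU : IsUnitSystem ε) (m : Fin r → ℤ) (s : ℂ) :
    ∑ k, shift ε m s k = ((r + 1 : ℕ) : ℂ) * s := by
  simp only [shift, Finset.sum_add_distrib, Finset.sum_const, Finset.card_univ, Fintype.card_fin,
    nsmul_eq_mul]
  rw [Finset.sum_comm]
  simp_rw [← Finset.mul_sum]
  have h : ∀ j, ∑ k, (invEntry ε j k : ℂ) = 0 := fun j => by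
    exact_mod_cast hU.sum_invEntry j
  simp [h]

/-- The part of s_k common to all k dies because units have norm 1, and the imaginary shifts pick
out the coordinates x_j by duality. This is why a character of x turns into shifts of the Gamma
arguments. -/
theorem sum_log_mul_shift (hU : IsUnitSystem ε) (m : Fin r → ℤ) (s : ℂ) (x : Fin r → ℝ) :
    ∑ k, ((∑ j, x j * Real.log (ε j k) : ℝ) : ℂ) * shift ε m s k =
      2 * Real.pi * Complex.I * ∑ j, (m j : ℂ) * (x j : ℂ) := by
  have h1 : ∑ k, ((∑ j, x j * Real.log (ε j k) : ℝ) : ℂ) = 0 := by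
    rw [← Complex.ofReal_sum, Finset.sum_comm]
    simp_rw [← Finset.mul_sum, hU.sum_log]
    simp
  have h2 : ∀ i, ∑ k, ((∑ j, x j * Real.log (ε j k) : ℝ) : ℂ) * (invEntry ε i k : ℂ) = x i := by
    intro i
    have : ∑ k, (∑ j, x j * Real.log (ε j k)) * invEntry ε i k = x i := by
      simp_rw [Finset.sum_mul]
      rw [Finset.sum_comm]
      have h3 : ∀ j, ∑ k, x j * Real.log (ε j k) * invEntry ε i k =
          x j * ∑ k, invEntry ε i k * Real.log (ε j k) := by
        intro j
        rw [Finset.mul_sum]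
        exact Finset.sum_congr rfl fun k _ => by ring
      simp_rw [h3, hU.sum_invEntry_mul_log]
      simp
    exact_mod_cast this
  simp only [shift, mul_add, Finset.sum_add_distrib]
  rw [← Finset.sum_mul, h1, zero_mul, zero_add]
  simp_rw [Finset.mul_sum]
  rw [Finset.sum_comm]
  refine Finset.sum_congr rfl fun i _ => ?_
  have h3 : ∀ k, ((∑ j, x j * Real.log (ε j k) : ℝ) : ℂ) *
      (2 * (Real.pi : ℂ) * Complex.I * (m i : ℂ) * (invEntry ε i k : ℂ)) =
      2 * (Real.pi : ℂ) * Complex.I * (m i : ℂ) *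
        (((∑ j, x j * Real.log (ε j k) : ℝ) : ℂ) * (invEntry ε i k : ℂ)) := fun k => by ring
  simp_rw [h3]
  rw [← Finset.mul_sum, h2]
  ring

/-- The matrix of the logarithmic coordinates `(log t, x) ↦ log (t E(x) ^ 2)`. -/
noncomputable def orthantMatrix (ε : Fin r → PosVec r) :
    Matrix (Fin (r + 1)) (Fin (r + 1)) ℝ :=
  logMatrix ε * Matrix.diagonal (Fin.cons 1 fun _ => 2)

/-- The factor 2^(n-1) in the residues originates here: E(x) enters the orthant squared. -/
theorem det_orthantMatrix : (orthantMatrix ε).det = (logMatrix ε).det * 2 ^ r := by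
  rw [orthantMatrix, Matrix.det_mul, Matrix.det_diagonal, Fin.prod_univ_succ]
  simp

theorem orthantMatrix_mulVec (v : ℝ) (x : Fin r → ℝ) (k : Fin (r + 1)) :
    (orthantMatrix ε *ᵥ Fin.cons v x) k = v + 2 * ∑ j, x j * Real.log (ε j k) := by
  rw [orthantMatrix, ← Matrix.mulVec_mulVec, Matrix.mulVec, dotProduct, Fin.sum_univ_succ]
  simp only [Matrix.mulVec_diagonal, logMatrix, Matrix.of_apply, Fin.cons_zero, Fin.cons_succ,
    one_mul, Finset.mul_sum]
  congr 1
  exact Finset.sum_congr rfl fun j _ => by ring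

theorem orthantPt_exp (v : ℝ) (x : Fin r → ℝ) (k : Fin (r + 1)) :
    orthantPt ε (Real.exp v) x k = Real.exp ((orthantMatrix ε *ᵥ Fin.cons v x) k) := by
  rw [orthantMatrix_mulVec, orthantPt, unitVec, ← Real.exp_nat_mul, ← Real.exp_add]
  norm_num

/-- The product of the one-dimensional Gamma integrands in logarithmic coordinates. -/
noncomputable def gammaIntegrand (ε : Fin r → PosVec r) (m : Fin r → ℤ) (s : ℂ)
    (l : Fin (r + 1) → ℝ) (u : Fin (r + 1) → ℝ) : ℂ :=
  ∏ k, (Complex.exp (u k * (shift ε m s k / 2)) *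
    ((Real.exp (-(Real.pi * l k ^ 2 * Real.exp (u k))) : ℝ) : ℂ))

theorem gammaIntegrand_mulVec (hU : IsUnitSystem ε) (m : Fin r → ℤ) (s : ℂ)
    (l : Fin (r + 1) → ℝ) (v : ℝ) (x : Fin r → ℝ) :
    gammaIntegrand ε m s l (orthantMatrix ε *ᵥ Fin.cons v x) =
      Complex.exp (v * (((r + 1 : ℕ) : ℂ) * s / 2)) *
        ((gaussTerm ε l (Real.exp v) x : ℂ) * expChar m x) := by
  rw [gammaIntegrand, Finset.prod_mul_distrib, ← Complex.exp_sum]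
  have h1 : ∏ k, ((Real.exp (-(Real.pi * l k ^ 2 *
      Real.exp ((orthantMatrix ε *ᵥ Fin.cons v x) k))) : ℝ) : ℂ) =
      (gaussTerm ε l (Real.exp v) x : ℂ) := by
    rw [← Complex.ofReal_prod, ← Real.exp_sum, gaussTerm, Finset.mul_sum]
    simp_rw [orthantPt_exp]
    congr 2
    exact Finset.sum_congr rfl fun k _ => by ring
  have h2 : ∑ k, (((orthantMatrix ε *ᵥ Fin.cons v x) k : ℝ) : ℂ) * (shift ε m s k / 2) =
      v * (((r + 1 : ℕ) : ℂ) * s / 2) + 2 * Real.pi * Complex.I * ∑ j, (m j : ℂ) * (x j : ℂ) := by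
    rw [← sum_log_mul_shift hU m s x, ← sum_shift hU m s, Finset.sum_div, Finset.mul_sum,
      ← Finset.sum_add_distrib]
    refine Finset.sum_congr rfl fun k _ => ?_
    rw [orthantMatrix_mulVec]
    push_cast
    ring
  rw [h1, h2, Complex.exp_add, expChar]
  ring

theorem shift_re (m : Fin r → ℤ) (s : ℂ) (k : Fin (r + 1)) : (shift ε m s k).re = s.re := by
  have h : shift ε m s k =
      s + ((∑ j, 2 * Real.pi * (m j : ℝ) * invEntry ε j k : ℝ) : ℂ) * Complex.I := by
    rw [shift]
    push_cast
    rw [Finset.sum_mul]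
    congr 1
    exact Finset.sum_congr rfl fun j _ => by ring
  rw [h]
  simp

theorem integrable_gammaIntegrand (m : Fin r → ℤ) {s : ℂ} (hs : 0 < s.re)
    {l : Fin (r + 1) → ℝ} (hl : ∀ k, l k ≠ 0) : Integrable (gammaIntegrand ε m s l) := by
  refine Integrable.fintype_prod (f := fun k (v : ℝ) => Complex.exp (v * (shift ε m s k / 2)) *
    ((Real.exp (-(Real.pi * l k ^ 2 * Real.exp v)) : ℝ) : ℂ)) fun k => ?_
  refine integrable_exp_mul_exp_neg_exp ?_ ?_
  · simpa [shift_re] using hs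
  · have := hl k; have := Real.pi_pos; positivity

theorem neg_shift_log_sum (m : Fin r → ℤ) (s : ℂ) {l : Fin (r + 1) → ℝ} (hl : ∀ k, l k ≠ 0) :
    Complex.exp (-∑ k, (Real.log |l k| : ℂ) * shift ε m s k) = zetaTerm ε m s l := by
  have hN : (0 : ℝ) < |vecNorm l| := abs_pos.mpr (Finset.prod_ne_zero_iff.mpr fun k _ => hl k)
  have hlogN : Real.log |vecNorm l| = ∑ k, Real.log |l k| := by
    rw [vecNorm, Finset.abs_prod, Real.log_prod fun k _ => by simpa using hl k]
  rw [zetaTerm, div_eq_mul_inv, ← Complex.cpow_neg, Complex.cpow_def_of_ne_zero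
    (by exact_mod_cast hN.ne'), ← Complex.ofReal_log hN.le, hlogN, grossen, ← Complex.exp_add]
  congr 1
  push_cast
  rw [Finset.sum_mul, ← Finset.sum_neg_distrib, ← Finset.sum_add_distrib]
  refine Finset.sum_congr rfl fun k _ => ?_
  rw [shift, mul_add, Finset.mul_sum, neg_add, ← Finset.sum_neg_distrib, add_comm, mul_neg]
  congr 1
  refine Finset.sum_congr rfl fun j _ => ?_
  push_cast [Pi.neg_apply]
  ring

theorem integral_gammaIntegrand (hU : IsUnitSystem ε) (m : Fin r → ℤ) {s : ℂ} (hs : 0 < s.re)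
    {l : Fin (r + 1) → ℝ} (hl : ∀ k, l k ≠ 0) : ∫ u, gammaIntegrand ε m s l u =
      (Real.pi : ℂ) ^ (-(((r + 1 : ℕ) : ℂ) * s / 2)) * (∏ k, Complex.Gamma (shift ε m s k / 2)) *
        zetaTerm ε m s l := by
  have h0 := integral_fintype_prod_volume_eq_prod (E := fun _ : Fin (r + 1) => ℝ)
    (fun k (v : ℝ) => Complex.exp (v * (shift ε m s k / 2)) *
    ((Real.exp (-(Real.pi * l k ^ 2 * Real.exp v)) : ℝ) : ℂ))
  have h1 : ∀ k, ∫ v : ℝ, Complex.exp (v * (shift ε m s k / 2)) *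
      ((Real.exp (-(Real.pi * l k ^ 2 * Real.exp v)) : ℝ) : ℂ) =
      Complex.exp (-((Real.log Real.pi : ℂ) * (shift ε m s k / 2))) *
      Complex.exp (-((Real.log |l k| : ℂ) * shift ε m s k)) *
        Complex.Gamma (shift ε m s k / 2) := by
    intro k
    have hk : 0 < |l k| := abs_pos.mpr (hl k)
    have hc : 0 < Real.pi * l k ^ 2 := by have := hl k; have := Real.pi_pos; positivity
    rw [integral_exp_mul_exp_neg_exp (by simpa [shift_re] using hs) hc]
    congr 1
    rw [Complex.cpow_def_of_ne_zero (by exact_mod_cast hc.ne'), ← Complex.ofReal_log hc.le,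
      ← sq_abs, Real.log_mul Real.pi_ne_zero (by positivity), Real.log_pow, ← Complex.exp_add]
    congr 1
    push_cast
    ring
  have h2 : (∫ u, gammaIntegrand ε m s l u) = _ := h0
  rw [h2]
  simp_rw [h1]
  rw [Finset.prod_mul_distrib, Finset.prod_mul_distrib, ← Complex.exp_sum, ← Complex.exp_sum,
    Finset.sum_neg_distrib, Finset.sum_neg_distrib, neg_shift_log_sum m s hl, ← Finset.mul_sum,
    ← Finset.sum_div, sum_shift hU, Complex.cpow_def_of_ne_zero (by exact_mod_cast Real.pi_ne_zero),
    ← Complex.ofReal_log Real.pi_pos.le]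
  rw [mul_neg]
  ring

theorem integrable_gammaIntegrand_cons (hU : IsUnitSystem ε) (m : Fin r → ℤ) {s : ℂ}
    (hs : 0 < s.re) {l : Fin (r + 1) → ℝ} (hl : ∀ k, l k ≠ 0) :
    Integrable fun p : ℝ × (Fin r → ℝ) => Complex.exp (p.1 * (((r + 1 : ℕ) : ℂ) * s / 2)) *
        ((gaussTerm ε l (Real.exp p.1) p.2 : ℂ) * expChar m p.2) := by
  have hdet : (orthantMatrix ε).det ≠ 0 := by
    rw [det_orthantMatrix]; exact mul_ne_zero hU.det_ne (by positivity)
  have := integrable_cons_iff.mpr (integrable_comp_mulVec hdet (integrable_gammaIntegrand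
    (ε := ε) m hs hl))
  simpa only [gammaIntegrand_mulVec hU] using this

theorem mellinConvergent_orbitIntegral (hU : IsUnitSystem ε) (m : Fin r → ℤ) {s : ℂ}
    (hs : 0 < s.re) {l : Fin (r + 1) → ℝ} (hl : ∀ k, l k ≠ 0) :
    MellinConvergent (orbitIntegral ε m l) (((r + 1 : ℕ) : ℂ) * s / 2) := by
  rw [mellinConvergent_iff_integrable_exp]
  have := (integrable_gammaIntegrand_cons hU m hs hl).integral_prod_left
  simpa only [integral_const_mul, orbitIntegral, smul_eq_mul] using this

/-- Fubini merges the integrals over t and x, the linear substitution by `orthantMatrix` contributes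
its determinant, and the coordinates of the resulting integral separate. -/
theorem mellin_orbitIntegral (hU : IsUnitSystem ε) (m : Fin r → ℤ) {s : ℂ}
    (hs : 0 < s.re) {l : Fin (r + 1) → ℝ} (hl : ∀ k, l k ≠ 0) :
    ((2 ^ r * |(logMatrix ε).det| : ℝ) : ℂ) *
      mellin (orbitIntegral ε m l) (((r + 1 : ℕ) : ℂ) * s / 2) =
      (Real.pi : ℂ) ^ (-(((r + 1 : ℕ) : ℂ) * s / 2)) * (∏ k, Complex.Gamma (shift ε m s k / 2)) *
        zetaTerm ε m s l := by
  have hdet : (orthantMatrix ε).det ≠ 0 := by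
    rw [det_orthantMatrix]; exact mul_ne_zero hU.det_ne (by positivity)
  have h1 := integral_prod _ (integrable_gammaIntegrand_cons hU m hs hl)
  have h2 := integral_comp_mulVec hdet (gammaIntegrand ε m s l)
  rw [← integral_cons] at h2
  simp only [gammaIntegrand_mulVec hU] at h2
  rw [Measure.volume_eq_prod] at h2
  simp only [integral_const_mul] at h1
  rw [mellin_eq_integral_exp]
  simp only [smul_eq_mul, orbitIntegral]
  rw [← h1, h2, integral_gammaIntegrand hU m hs hl, det_orthantMatrix, abs_mul, abs_of_pos
    (by positivity : (0 : ℝ) < 2 ^ r), mul_comm (2 ^ r : ℝ), Complex.real_smul, ← mul_assoc,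
    ← Complex.ofReal_mul, mul_inv_cancel₀ (by
      have := abs_ne_zero.mpr hU.det_ne; positivity), Complex.ofReal_one, one_mul]

end LatticeZeta

/-! ### Unfolding over orbits, and absolute convergence of the series. -/

namespace LatticeZeta
open MeasureTheory Matrix

variable {r : ℕ} {L : Submodule ℤ (Fin (r + 1) → ℝ)} {M : Subgroup (PosVec r)}
  {ε : Fin r → PosVec r}

theorem IsUnitSystem.unitPow_injective (hU : IsUnitSystem ε) :
    Function.Injective (unitPow ε) := by
  intro a b hab
  have h1 : ∀ k, ∑ j, (a j : ℝ) * Real.log (ε j k) = ∑ j, (b j : ℝ) * Real.log (ε j k) := by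
    intro k
    have := congrArg (fun η => logVec η k) hab
    simpa only [logVec_unitPow] using this
  have h2 : ∀ (c : Fin r → ℤ) i,
      ∑ k, invEntry ε i k * ∑ j, (c j : ℝ) * Real.log (ε j k) = c i := by
    intro c i
    simp_rw [Finset.mul_sum]
    rw [Finset.sum_comm]
    have h3 : ∀ j, ∑ k, invEntry ε i k * ((c j : ℝ) * Real.log (ε j k)) =
        c j * ∑ k, invEntry ε i k * Real.log (ε j k) := by
      intro j
      rw [Finset.mul_sum]
      exact Finset.sum_congr rfl fun k _ => by ring
    simp_rw [h3, hU.sum_invEntry_mul_log]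
    simp
  ext i
  have h4 := h2 a i
  simp_rw [h1] at h4
  rw [h2 b i] at h4
  exact_mod_cast h4.symm

section Orbits

variable [DiscreteTopology L]

theorem IsZetaDatum.coord_ne_zero (h : IsZetaDatum L M ε) {l : Fin (r + 1) → ℝ} (hl : l ∈ L)
    (hl0 : l ≠ 0) (k : Fin (r + 1)) : l k ≠ 0 := fun hk =>
  hl0 (eq_zero_of_coord_eq_zero h.closure_eq h.isUnitSystem h.scale_mem hl hk)

omit [DiscreteTopology L] in
theorem scale_ne_zero (η : PosVec r) {l : Fin (r + 1) → ℝ} (hl : l ≠ 0) : scale η l ≠ 0 := by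
  intro h
  refine hl (funext fun k => ?_)
  have h3 := congrFun h k
  simp only [scale, Pi.zero_apply, mul_eq_zero] at h3
  exact h3.resolve_left (η k).2.ne'

/-- The nonzero elements of `L`, parametrised by an orbit and a power of the generators. -/
noncomputable def orbitMap (h : IsZetaDatum L M ε) (p : Orbits L M × (Fin r → ℤ)) :
    {l : Fin (r + 1) → ℝ // l ∈ L ∧ l ≠ 0} :=
  ⟨scale (unitPow ε p.2) (Quotient.out p.1).1,
    h.scale_mem _ (unitPow_mem h.closure_eq _) _ (Quotient.out p.1).2.1,
    scale_ne_zero _ (Quotient.out p.1).2.2⟩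

/-- The action of M is free because no coordinate of a nonzero lattice vector vanishes, and a unit
determines its exponents. -/
theorem orbitMap_bijective (h : IsZetaDatum L M ε) : Function.Bijective (orbitMap h) := by
  constructor
  · rintro ⟨o, a⟩ ⟨o', a'⟩ heq
    have h1 : scale (unitPow ε a) (Quotient.out o).1 = scale (unitPow ε a') (Quotient.out o').1 :=
      congrArg Subtype.val heq
    have hmk : ∀ (o : Orbits L M) (a : Fin r → ℤ),
        (Quotient.mk (orbitSetoid L M) (orbitMap h (o, a))) = o := by
      intro o a
      conv_rhs => rw [← Quotient.out_eq o]
      exact (Quotient.sound (s := orbitSetoid L M)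
        ⟨unitPow ε a, unitPow_mem h.closure_eq a, rfl⟩).symm
    have ho : o = o' := by rw [← hmk o a, heq, hmk]
    subst ho
    have h2 : unitPow ε a = unitPow ε a' := by
      funext k
      refine Subtype.ext ?_
      have h3 := congrFun h1 k
      exact mul_right_cancel₀
        (h.coord_ne_zero (Quotient.out o).2.1 (Quotient.out o).2.2 k) h3
    rw [h.isUnitSystem.unitPow_injective h2]
  · intro l
    have h1 : (orbitSetoid L M).r (Quotient.out (Quotient.mk (orbitSetoid L M) l)) l :=
      Quotient.exact (Quotient.out_eq _)
    obtain ⟨η, hη, h2⟩ := h1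
    obtain ⟨a, rfl⟩ := exists_eq_unitPow h.closure_eq hη
    exact ⟨(Quotient.mk (orbitSetoid L M) l, a), Subtype.ext h2.symm⟩

/-- The bijection between nonzero elements of `L` and pairs of an orbit and an exponent vector. -/
noncomputable def orbitEquiv (h : IsZetaDatum L M ε) :
    Orbits L M × (Fin r → ℤ) ≃ {l : Fin (r + 1) → ℝ // l ∈ L ∧ l ≠ 0} :=
  Equiv.ofBijective _ (orbitMap_bijective h)

theorem coe_orbitEquiv (h : IsZetaDatum L M ε) (o : Orbits L M) (a : Fin r → ℤ) :
    (orbitEquiv h (o, a) : Fin (r + 1) → ℝ) = scale (unitPow ε a) (Quotient.out o).1 := rfl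

/-- Restriction of a nonzero vector of `L` to an element of `L`. -/
def toLattice (l : {l : Fin (r + 1) → ℝ // l ∈ L ∧ l ≠ 0}) : L := ⟨l.1, l.2.1⟩

omit [DiscreteTopology L] in
theorem toLattice_injective : Function.Injective (toLattice (L := L)) := by
  intro l l' h
  exact Subtype.ext (congrArg (fun z : L => (z : Fin (r + 1) → ℝ)) h)

theorem gaussTerm_nonneg (l : Fin (r + 1) → ℝ) (t : ℝ) (x : Fin r → ℝ) :
    0 ≤ gaussTerm ε l t x := (Real.exp_pos _).le

variable (L) in
theorem countable_nonzero : Countable {l : Fin (r + 1) → ℝ // l ∈ L ∧ l ≠ 0} :=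
  have : Countable L := countable_of_Lindelof_of_discrete
  toLattice_injective.countable

theorem gaussTerm_scale (t : ℝ) (x : Fin r → ℝ) (a : Fin r → ℤ) (l : Fin (r + 1) → ℝ) :
    gaussTerm ε (scale (unitPow ε a) l) t x = gaussTerm ε l t (x + fun j => (a j : ℝ)) := by
  rw [gaussTerm, gaussTerm, sum_orthantPt_add]

theorem continuous_gaussTerm (l : Fin (r + 1) → ℝ) (t : ℝ) : Continuous (gaussTerm ε l t) := by
  have h2 : Continuous fun x : Fin r → ℝ => orthantPt ε t x :=
    continuous_orthantPt.comp (Continuous.prodMk_right t)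
  have h3 : ∀ k, Continuous fun x : Fin r → ℝ => orthantPt ε t x k := fun k =>
    (continuous_apply k).comp h2
  unfold gaussTerm
  fun_prop

theorem hasSum_gaussTerm {t : ℝ} (ht : 0 < t) (x : Fin r → ℝ) :
    HasSum (fun l : {l : Fin (r + 1) → ℝ // l ∈ L ∧ l ≠ 0} => gaussTerm ε l.1 t x)
      (theta L (orthantPt ε t x) - 1) := by
  have hsum := (summable_theta L (orthantPt_pos (ε := ε) ht x)).hasSum
  have h0 : HasSum (fun l : L => if l = 0 then (1 : ℝ) else 0) 1 := hasSum_ite_eq 0 1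
  have h1 := hsum.sub h0
  refine (toLattice_injective.hasSum_iff ?_).mpr h1 |>.congr_fun ?_
  · intro l hl
    have : l = 0 := by
      by_contra h
      exact hl ⟨⟨l.1, l.2, fun h' => h (Subtype.ext h')⟩, rfl⟩
    subst this
    simp
  · intro l
    simp [gaussTerm, toLattice, l.2.2]

theorem exists_gaussTerm_bound {t : ℝ} (ht : 0 < t) :
    ∃ u : {l : Fin (r + 1) → ℝ // l ∈ L ∧ l ≠ 0} → ℝ, Summable u ∧
      ∀ l, ∀ x ∈ unitCube (Fin r), gaussTerm ε l.1 t x ≤ u l := by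
  obtain ⟨c, hc, hcx⟩ := exists_le_orthantPt ε
  have h := (summable_theta L (y := fun _ => t * c) fun _ => by positivity).comp_injective
    (toLattice_injective (L := L))
  refine ⟨_, h, fun l x hx => Real.exp_le_exp.mpr ?_⟩
  rw [neg_mul, neg_mul, neg_le_neg_iff]
  have := Real.pi_pos
  refine mul_le_mul_of_nonneg_left (Finset.sum_le_sum fun k _ => ?_) this.le
  exact mul_le_mul_of_nonneg_right (hcx x hx t ht.le k) (sq_nonneg _)

theorem integrable_gaussTerm (h : IsZetaDatum L M ε) (m : Fin r → ℤ) {t : ℝ} (ht : 0 < t)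
    (o : Orbits L M) :
    Integrable fun x => (gaussTerm ε (Quotient.out o).1 t x : ℂ) * expChar m x := by
  obtain ⟨u, hu, hb⟩ := exists_gaussTerm_bound (L := L) (ε := ε) ht
  refine integrable_of_summable_cube (u := fun a => u (orbitEquiv h (o, a))) ?_
    (((orbitEquiv h).summable_iff.mpr hu).comp_injective (Prod.mk_right_injective o)) ?_
  · exact ((Complex.continuous_ofReal.comp (continuous_gaussTerm _ t)).mul
      (continuous_expChar m)).aestronglyMeasurable
  · intro a x hx
    rw [norm_mul, norm_expChar, mul_one, Complex.norm_of_nonneg (gaussTerm_nonneg _ _ _),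
      ← gaussTerm_scale, ← coe_orbitEquiv h]
    exact hb _ x hx

/-- Unfolding: the sum over nonzero l is regrouped as orbits times exponents a. Replacing l by its
multiple by the unit with exponents a translates x by a, so the sum over a extends the cell integral
to all x. -/
theorem hasSum_orbitIntegral (h : IsZetaDatum L M ε) (m : Fin r → ℤ) {t : ℝ} (ht : 0 < t) :
    HasSum (fun o : Orbits L M => orbitIntegral ε m (Quotient.out o).1 t)
      (thetaAvg L ε m t - (if m = 0 then 1 else 0)) := by
  have hcount := countable_nonzero L
  obtain ⟨u, hu, hb⟩ := exists_gaussTerm_bound (L := L) (ε := ε) ht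
  rw [thetaAvg_sub m ht]
  have h1 : HasSum (fun l : {l : Fin (r + 1) → ℝ // l ∈ L ∧ l ≠ 0} =>
      ∫ x in unitCube (Fin r), (gaussTerm ε l.1 t x : ℂ) * expChar m x)
      (∫ x in unitCube (Fin r), ((theta L (orthantPt ε t x) - 1 : ℝ) : ℂ) * expChar m x) := by
    refine hasSum_integral_of_dominated_convergence (fun l _ => u l) ?_ ?_ ?_ ?_ ?_
    · intro l
      exact ((Complex.continuous_ofReal.comp (continuous_gaussTerm _ t)).mul
        (continuous_expChar m)).aestronglyMeasurable
    · intro l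
      refine (ae_restrict_iff' measurableSet_unitCube).mpr (Eventually.of_forall fun x hx => ?_)
      rw [norm_mul, norm_expChar, mul_one, Complex.norm_of_nonneg (gaussTerm_nonneg _ _ _)]
      exact hb l x hx
    · exact Eventually.of_forall fun x => hu
    · exact integrable_const _
    · exact Eventually.of_forall fun x =>
        (Complex.hasSum_ofReal.mpr (hasSum_gaussTerm ht x)).mul_right _
  have h2 := (orbitEquiv h).hasSum_iff.mpr h1
  refine h2.prod_fiberwise fun o => ?_
  refine (hasSum_integral_unitCube (integrable_gaussTerm h m ht o)).congr_fun fun a => ?_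
  simp only [Function.comp_apply, coe_orbitEquiv]
  congr 1
  ext x
  rw [gaussTerm_scale, expChar_add, expChar_intCast, mul_one]

end Orbits

section Mellin

variable [DiscreteTopology L]

theorem norm_zetaTerm (m : Fin r → ℤ) (s : ℂ) {l : Fin (r + 1) → ℝ} (hl : ∀ k, l k ≠ 0) :
    ‖zetaTerm ε m s l‖ = |vecNorm l| ^ (-s.re) := by
  have hN : (0 : ℝ) < |vecNorm l| := abs_pos.mpr (Finset.prod_ne_zero_iff.mpr fun k _ => hl k)
  rw [zetaTerm, norm_div, Complex.norm_cpow_eq_rpow_re_of_pos hN, Real.rpow_neg hN.le]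
  have h1 : ‖grossen ε (-m) fun k => |l k|‖ = 1 := by
    rw [grossen, Complex.norm_exp, Real.exp_eq_one_iff, Complex.re_sum]
    refine Finset.sum_eq_zero fun k _ => ?_
    rw [Complex.re_sum]
    refine Finset.sum_eq_zero fun j _ => ?_
    have : 2 * (Real.pi : ℂ) * Complex.I * (((-m) j : ℤ) : ℂ) * (invEntry ε j k : ℂ) *
        (Real.log |l k| : ℂ) = ((2 * Real.pi * (((-m) j : ℤ) : ℝ) * invEntry ε j k *
          Real.log |l k| : ℝ) : ℂ) * Complex.I := by
      push_cast; ring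
    rw [this]
    simp
  rw [h1, one_div]

theorem norm_orbitTerm (h : IsZetaDatum L M ε) (m : Fin r → ℤ) (o : Orbits L M) (s : ℂ) :
    ‖orbitTerm L M ε m o s‖ = |vecNorm (Quotient.out o).1| ^ (-s.re) :=
  norm_zetaTerm m s (h.coord_ne_zero (Quotient.out o).2.1 (Quotient.out o).2.2)

theorem orbitIntegral_zero (l : Fin (r + 1) → ℝ) (t : ℝ) :
    orbitIntegral ε 0 l t = ((∫ x, gaussTerm ε l t x : ℝ) : ℂ) := by
  rw [orbitIntegral, ← integral_complex_ofReal]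
  simp [expChar_zero]

theorem norm_orbitIntegral_le (m : Fin r → ℤ) (l : Fin (r + 1) → ℝ) (t : ℝ) :
    ‖orbitIntegral ε m l t‖ ≤ ‖orbitIntegral ε 0 l t‖ := by
  rw [orbitIntegral_zero, Complex.norm_of_nonneg (integral_nonneg fun x => gaussTerm_nonneg _ _ _)]
  refine (norm_integral_le_integral_norm _).trans (le_of_eq ?_)
  congr 1
  ext x
  rw [norm_mul, norm_expChar, mul_one, Complex.norm_of_nonneg (gaussTerm_nonneg _ _ _)]

theorem countable_orbits : Countable (Orbits L M) :=
  have := countable_nonzero L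
  Quotient.countable

theorem orbitIntegral_zero_nonneg (l : Fin (r + 1) → ℝ) (t : ℝ) :
    orbitIntegral ε 0 l t = (‖orbitIntegral ε 0 l t‖ : ℂ) := by
  rw [orbitIntegral_zero, Complex.norm_of_nonneg (integral_nonneg fun x => gaussTerm_nonneg _ _ _)]

/-- For m = 0 every orbit integral is a nonnegative real number, so the unfolded sum is already the
sum of the norms. This is the majorant for all other m. -/
theorem hasSum_norm_orbitIntegral_zero (h : IsZetaDatum L M ε) {t : ℝ} (ht : 0 < t) :
    HasSum (fun o : Orbits L M => ‖orbitIntegral ε 0 (Quotient.out o).1 t‖)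
      ‖thetaAvg L ε 0 t - 1‖ := by
  have h1 := hasSum_orbitIntegral h 0 ht
  rw [if_pos rfl] at h1
  have h2 := h1.congr_fun (g := fun o : Orbits L M =>
    ((‖orbitIntegral ε 0 (Quotient.out o).1 t‖ : ℝ) : ℂ))
    (fun o => (orbitIntegral_zero_nonneg _ _).symm)
  have h3 := Complex.reCLM.hasSum h2
  simp only [Complex.reCLM_apply, Complex.ofReal_re] at h3
  have h4 : thetaAvg L ε 0 t - 1 = ((thetaAvg L ε 0 t - 1).re : ℂ) := by
    have h5 : HasSum (fun o : Orbits L M =>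
      ((‖orbitIntegral ε 0 (Quotient.out o).1 t‖ : ℝ) : ℂ)) _ := Complex.hasSum_ofReal.mpr h3
    exact h2.unique h5
  have h6 : 0 ≤ (thetaAvg L ε 0 t - 1).re := h3.nonneg fun o => norm_nonneg _
  rw [h4, Complex.norm_of_nonneg h6]
  exact h3

variable [IsZLattice ℝ L]

/-- Convergence without counting lattice points: finite partial sums are dominated by the case m =
0, whose total is the convergent Mellin integral of the averaged theta function minus 1. -/
theorem summable_integral_orbitIntegral (h : IsZetaDatum L M ε) (m : Fin r → ℤ) {s : ℂ}
    (hs : 1 < s.re) : Summable fun o : Orbits L M => ∫ t : ℝ in Set.Ioi 0,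
      ‖(t : ℂ) ^ (((r + 1 : ℕ) : ℂ) * s / 2 - 1) • orbitIntegral ε m (Quotient.out o).1 t‖ := by
  set z : ℂ := ((r + 1 : ℕ) : ℂ) * s / 2 with hz
  have hn : (0 : ℝ) < ((r + 1 : ℕ) : ℝ) := by positivity
  have hzre : z.re = ((r + 1 : ℕ) : ℝ) * s.re / 2 := by
    have : z = ((((r + 1 : ℕ) : ℝ) / 2 : ℝ) : ℂ) * s := by rw [hz]; push_cast; ring
    rw [this, Complex.re_ofReal_mul]; ring
  have hconv : ∀ (m : Fin r → ℤ) (o : Orbits L M), IntegrableOn (fun t : ℝ => (t : ℂ) ^ (z - 1) •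
      orbitIntegral ε m (Quotient.out o).1 t) (Set.Ioi 0) := fun m o =>
    mellinConvergent_orbitIntegral h.isUnitSystem m (by linarith)
      (h.coord_ne_zero (Quotient.out o).2.1 (Quotient.out o).2.2)
  -- The pair has weight n/2, and Re(ns/2) > n/2 is the condition Re s > 1.
  have hP := (thetaPair h (0 : Fin r → ℤ)).hasMellin (s := z) (by
    change ((r + 1 : ℕ) : ℝ) / 2 < z.re
    rw [hzre]
    nlinarith)
  have hI : IntegrableOn (fun t : ℝ => (t : ℂ) ^ (z - 1) • (thetaAvg L ε 0 t - 1)) (Set.Ioi 0) := by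
    have := hP.1
    simpa [MellinConvergent, thetaPair] using this
  refine summable_of_sum_le (c := ∫ t : ℝ in Set.Ioi 0,
    ‖(t : ℂ) ^ (z - 1) • (thetaAvg L ε 0 t - 1)‖)
    (fun o => integral_nonneg fun t => norm_nonneg _) fun F => ?_
  rw [← integral_finsetSum _ fun o _ => (hconv m o).norm]
  refine setIntegral_mono_on (integrable_finsetSum _ fun o _ => (hconv m o).norm) hI.norm
    measurableSet_Ioi fun t (ht : 0 < t) => ?_
  simp only [norm_smul]
  rw [← Finset.mul_sum]
  refine mul_le_mul_of_nonneg_left ?_ (norm_nonneg _)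
  have h1 := hasSum_norm_orbitIntegral_zero h ht
  refine (Finset.sum_le_sum fun o _ => norm_orbitIntegral_le m _ t).trans ?_
  exact sum_le_hasSum F (fun o _ => norm_nonneg _) h1

theorem hasSum_mellin_orbitIntegral (h : IsZetaDatum L M ε) (m : Fin r → ℤ) {s : ℂ}
    (hs : 1 < s.re) : HasSum (fun o : Orbits L M =>
      mellin (orbitIntegral ε m (Quotient.out o).1) (((r + 1 : ℕ) : ℂ) * s / 2))
      ((thetaPair h m).Λ (((r + 1 : ℕ) : ℂ) * s / 2)) := by
  set z : ℂ := ((r + 1 : ℕ) : ℂ) * s / 2 with hz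
  have hn : (0 : ℝ) < ((r + 1 : ℕ) : ℝ) := by positivity
  have hzre : z.re = ((r + 1 : ℕ) : ℝ) * s.re / 2 := by
    have : z = ((((r + 1 : ℕ) : ℝ) / 2 : ℝ) : ℂ) * s := by rw [hz]; push_cast; ring
    rw [this, Complex.re_ofReal_mul]; ring
  have hP := (thetaPair h m).hasMellin (s := z) (by
    change ((r + 1 : ℕ) : ℝ) / 2 < z.re
    rw [hzre]
    nlinarith)
  have hcount : Countable (Orbits L M) := countable_orbits
  have h1 := hasSum_integral_of_summable_integral_norm (μ := volume.restrict (Set.Ioi 0))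
    (F := fun (o : Orbits L M) (t : ℝ) => (t : ℂ) ^ (z - 1) •
      orbitIntegral ε m (Quotient.out o).1 t) (fun o =>
    mellinConvergent_orbitIntegral h.isUnitSystem m (by linarith)
      (h.coord_ne_zero (Quotient.out o).2.1 (Quotient.out o).2.2))
    (summable_integral_orbitIntegral h m hs)
  rw [← hP.2]
  have h2 : ∫ t : ℝ in Set.Ioi 0, ∑' o : Orbits L M, (t : ℂ) ^ (z - 1) •
      orbitIntegral ε m (Quotient.out o).1 t =
      mellin (fun t => (thetaPair h m).f t - (thetaPair h m).f₀) z := by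
    rw [mellin]
    refine setIntegral_congr_fun measurableSet_Ioi fun t ht => ?_
    have h3 := (hasSum_orbitIntegral h m ht).mul_left ((t : ℂ) ^ (z - 1))
    simp only [smul_eq_mul]
    rw [h3.tsum_eq]
    rfl
  rw [← h2]
  exact h1

theorem prod_Gamma_ne_zero (m : Fin r → ℤ) {s : ℂ} (hs : 0 < s.re) :
    ∏ k, Complex.Gamma (shift ε m s k / 2) ≠ 0 :=
  Finset.prod_ne_zero_iff.mpr fun k _ =>
    Complex.Gamma_ne_zero_of_re_pos (by simpa [shift_re] using hs)

theorem hasSum_orbitTerm (h : IsZetaDatum L M ε) (m : Fin r → ℤ) {s : ℂ} (hs : 1 < s.re) :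
    HasSum (fun o : Orbits L M => (Real.pi : ℂ) ^ (-(((r + 1 : ℕ) : ℂ) * s / 2)) *
      (∏ k, Complex.Gamma (shift ε m s k / 2)) * orbitTerm L M ε m o s)
      (((2 ^ r * |(logMatrix ε).det| : ℝ) : ℂ) *
        (thetaPair h m).Λ (((r + 1 : ℕ) : ℂ) * s / 2)) := by
  refine ((hasSum_mellin_orbitIntegral h m hs).mul_left _).congr_fun fun o => ?_
  exact (mellin_orbitIntegral h.isUnitSystem m (by linarith)
    (h.coord_ne_zero (Quotient.out o).2.1 (Quotient.out o).2.2)).symm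

theorem pi_cpow_mul_prod_Gamma_ne_zero (m : Fin r → ℤ) {s : ℂ} (hs : 0 < s.re) :
    (Real.pi : ℂ) ^ (-(((r + 1 : ℕ) : ℂ) * s / 2)) *
      (∏ k, Complex.Gamma (shift ε m s k / 2)) ≠ 0 := by
  refine mul_ne_zero ?_ (prod_Gamma_ne_zero m hs)
  rw [Complex.cpow_ne_zero_iff]
  exact Or.inl (by exact_mod_cast Real.pi_ne_zero)

/-- The Gamma product is nonzero for Re s > 0 and can be divided out; summability in ℂ is absolute.
-/
theorem summable_norm_orbitTerm (h : IsZetaDatum L M ε) (m : Fin r → ℤ) {s : ℂ}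
    (hs : 1 < s.re) : Summable fun o : Orbits L M => ‖orbitTerm L M ε m o s‖ := by
  have h1 := (hasSum_orbitTerm h m hs).summable
  rw [summable_mul_left_iff (pi_cpow_mul_prod_Gamma_ne_zero m (by linarith))] at h1
  exact h1.norm

theorem completed_zetaSeries (h : IsZetaDatum L M ε) (m : Fin r → ℤ) {s : ℂ} (hs : 1 < s.re) :
    (Real.pi : ℂ) ^ (-(((r + 1 : ℕ) : ℂ) * s / 2)) *
      (∏ k, Complex.Gamma (shift ε m s k / 2)) * zetaSeries L M ε m s =
      ((2 ^ r * |(logMatrix ε).det| : ℝ) : ℂ) *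
        (thetaPair h m).Λ (((r + 1 : ℕ) : ℂ) * s / 2) := by
  rw [zetaSeries, ← tsum_mul_left]
  exact (hasSum_orbitTerm h m hs).tsum_eq

end Mellin

end LatticeZeta

/-! ### Phragmén–Lindelöf interpolation and bounds for quotients of Gamma functions. -/

namespace LatticeZeta

section Interpolation

theorem one_add_abs_le (t T : ℝ) : 1 + |t| ≤ (1 + |T|) * (1 + |t - T|) := by
  have h1 : |t| ≤ |T| + |t - T| := by
    have := abs_add_le T (t - T); simpa using this
  nlinarith [abs_nonneg T, abs_nonneg (t - T), mul_nonneg (abs_nonneg T) (abs_nonneg (t - T))]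

/-- Use log(1 + |u|) ≤ |u| and complete the square in p|u| - u². -/
theorem one_add_abs_rpow_mul_exp_le {p : ℝ} (hp : 0 ≤ p) (u : ℝ) :
    (1 + |u|) ^ p * Real.exp (-u ^ 2) ≤ Real.exp (p ^ 2 / 4) := by
  have h0 : 0 < 1 + |u| := by positivity
  rw [Real.rpow_def_of_pos h0, ← Real.exp_add]
  refine Real.exp_le_exp.mpr ?_
  have h1 : Real.log (1 + |u|) ≤ |u| := by
    have := Real.log_le_sub_one_of_pos h0; linarith
  have h2 := mul_le_mul_of_nonneg_right h1 hp
  nlinarith [sq_nonneg (|u| - p / 2), sq_abs u]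

theorem gaussian_weight_le {p A : ℝ} (hp : 0 ≤ p) (hA : 0 ≤ A) (c t T : ℝ) :
    Real.exp c * Real.exp (-(t - T) ^ 2) * (1 + |T|) ^ (-p) * (A * (1 + |t|) ^ p) ≤
      A * Real.exp (c + p ^ 2 / 4) := by
  have hX0 : 0 < 1 + |T| := by positivity
  have h1 : (1 + |t|) ^ p ≤ (1 + |T|) ^ p * (1 + |t - T|) ^ p := by
    rw [← Real.mul_rpow hX0.le (by positivity)]
    exact Real.rpow_le_rpow (by positivity) (one_add_abs_le t T) hp
  have h2 := one_add_abs_rpow_mul_exp_le hp (t - T)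
  have hXp : 0 < (1 + |T|) ^ p := Real.rpow_pos_of_pos hX0 p
  calc _ ≤ Real.exp c * Real.exp (-(t - T) ^ 2) * (1 + |T|) ^ (-p) *
        (A * ((1 + |T|) ^ p * (1 + |t - T|) ^ p)) := by gcongr
    _ = A * (Real.exp c * ((1 + |t - T|) ^ p * Real.exp (-(t - T) ^ 2))) := by
        rw [Real.rpow_neg hX0.le]
        field_simp
    _ ≤ A * (Real.exp c * Real.exp (p ^ 2 / 4)) := by gcongr
    _ = _ := by rw [Real.exp_add]

/-- For a point s₀ of height T, multiply f by exp((s - iT)²) and by (1 + |T|)^(-ell(s)), with ell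
the affine function equal to p and q on the edges. The second factor normalises the size at height
T, and the Gaussian absorbs the growth away from it. The product is thus bounded on the edges
independently of T, hence inside, and is evaluated at s₀. -/
theorem exists_norm_le_of_vertical_strip {f : ℂ → ℂ} {a b p q A B D : ℝ} (hab : a < b)
    (hf : DiffContOnCl ℂ f (Complex.re ⁻¹' Set.Ioo a b)) (hp : 0 ≤ p) (hq : 0 ≤ q)
    (hgrowth : ∀ s : ℂ, a ≤ s.re → s.re ≤ b → 1 ≤ |s.im| → ‖f s‖ ≤ B * Real.exp (D * |s.im|))
    (ha : ∀ s : ℂ, s.re = a → ‖f s‖ ≤ A * (1 + |s.im|) ^ p)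
    (hb : ∀ s : ℂ, s.re = b → ‖f s‖ ≤ A * (1 + |s.im|) ^ q) :
    ∃ C : ℝ, 0 ≤ C ∧ ∀ s : ℂ, a ≤ s.re → s.re ≤ b →
      ‖f s‖ ≤ C * (1 + |s.im|) ^ ((p * (b - s.re) + q * (s.re - a)) / (b - a)) := by
  have hA : 0 ≤ A := by
    have := (norm_nonneg _).trans (ha (a : ℂ) (Complex.ofReal_re a))
    simpa using this
  set C := A * (Real.exp (a ^ 2 + p ^ 2 / 4) + Real.exp (b ^ 2 + q ^ 2 / 4)) with hC
  refine ⟨C, by positivity, fun s₀ h₀a h₀b => ?_⟩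
  set T := s₀.im with hT
  set X := 1 + |T| with hX
  have hX1 : 1 ≤ X := by simp [hX]
  have hX0 : 0 < X := by linarith
  have hba : 0 < b - a := sub_pos.mpr hab
  set ell : ℂ → ℂ := fun s => (p * (b - s) + q * (s - a)) / ((b - a : ℝ) : ℂ) with hell
  have hellre : ∀ s : ℂ, (ell s).re = (p * (b - s.re) + q * (s.re - a)) / (b - a) := by
    intro s
    rw [hell, Complex.div_ofReal_re]
    simp
  set g : ℂ → ℂ := fun s => Complex.exp ((s - T * Complex.I) ^ 2 - ell s * Real.log X) with hg
  have hgn : ∀ s : ℂ, ‖g s‖ = Real.exp (s.re ^ 2) * Real.exp (-(s.im - T) ^ 2) *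
      X ^ (-((p * (b - s.re) + q * (s.re - a)) / (b - a))) := by
    intro s
    rw [hg, Complex.norm_exp, Complex.sub_re, Complex.re_mul_ofReal, hellre,
      Real.rpow_def_of_pos hX0, ← Real.exp_add, ← Real.exp_add]
    congr 1
    simp [pow_two]
    ring
  have hgd : Differentiable ℂ g := by
    simp only [hg, hell]
    fun_prop
  have hgf : DiffContOnCl ℂ (fun s => g s * f s) (Complex.re ⁻¹' Set.Ioo a b) :=
    hgd.diffContOnCl.smul hf
  have key := PhragmenLindelof.vertical_strip (C := C) hgf ?_ ?_ ?_ h₀a h₀b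
  · rw [norm_mul, hgn, ← hT, sub_self] at key
    set E := (p * (b - s₀.re) + q * (s₀.re - a)) / (b - a)
    have hXE : 0 < X ^ E := Real.rpow_pos_of_pos hX0 E
    rw [Real.rpow_neg hX0.le] at key
    have h1 : 1 ≤ Real.exp (s₀.re ^ 2) := Real.one_le_exp (sq_nonneg _)
    have h2 : (X ^ E)⁻¹ * ‖f s₀‖ ≤ C := by
      refine le_trans ?_ key
      have h3 : 0 ≤ (X ^ E)⁻¹ * ‖f s₀‖ := by positivity
      have h4 : Real.exp (-(0 : ℝ) ^ 2) = 1 := by simp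
      rw [h4]
      nlinarith
    rwa [inv_mul_le_iff₀ hXE, mul_comm] at h2
  -- With both constants 0 the growth condition of the principle asks for a bounded function; the
  -- Gaussian beats exp(D|Im s|).
  · refine ⟨0, by positivity, 0, ?_⟩
    refine Asymptotics.IsBigO.of_bound
      (|B| * (Real.exp (a ^ 2 + b ^ 2) * Real.exp (|D| * |T| + D ^ 2 / 4))) ?_
    rw [eventually_inf_principal]
    have hev : ∀ᶠ s : ℂ in comap (_root_.abs ∘ Complex.im) atTop, 1 ≤ |s.im| :=
      tendsto_comap.eventually (eventually_ge_atTop 1)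
    filter_upwards [hev] with s hs hsab
    have hsa : a < s.re := hsab.1
    have hsb : s.re < b := hsab.2
    rw [norm_mul, hgn]
    simp only [zero_mul, Real.exp_zero, norm_one, mul_one]
    have h1 := hgrowth s hsa.le hsb.le hs
    have hE : 0 ≤ (p * (b - s.re) + q * (s.re - a)) / (b - a) := by
      have := sub_nonneg.mpr hsa.le
      have := sub_nonneg.mpr hsb.le
      positivity
    have h2 : X ^ (-((p * (b - s.re) + q * (s.re - a)) / (b - a))) ≤ 1 :=
      Real.rpow_le_one_of_one_le_of_nonpos hX1 (by linarith)
    have h3 : s.re ^ 2 ≤ a ^ 2 + b ^ 2 := by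
      rcases le_total 0 s.re with h | h <;> nlinarith [sq_nonneg a, sq_nonneg b]
    have h4 : B * Real.exp (D * |s.im|) ≤ |B| * Real.exp (D * |s.im|) :=
      mul_le_mul_of_nonneg_right (le_abs_self B) (Real.exp_pos _).le
    have h5 : -(s.im - T) ^ 2 + D * |s.im| ≤
        |D| * |T| + D ^ 2 / 4 := by
      have h6 : |s.im| ≤ |T| + |s.im - T| := by
        have := abs_add_le T (s.im - T); simpa using this
      have h7 : D * |s.im| ≤ |D| * (|T| + |s.im - T|) :=
        (mul_le_mul_of_nonneg_right (le_abs_self D) (abs_nonneg _)).trans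
          (mul_le_mul_of_nonneg_left h6 (abs_nonneg D))
      have h8 : |D| * |s.im - T| ≤ (s.im - T) ^ 2 + D ^ 2 / 4 := by
        nlinarith [sq_nonneg (|s.im - T| - |D| / 2), sq_abs (s.im - T), sq_abs D]
      linarith
    calc Real.exp (s.re ^ 2) * Real.exp (-(s.im - T) ^ 2) *
          X ^ (-((p * (b - s.re) + q * (s.re - a)) / (b - a))) * ‖f s‖
        ≤ Real.exp (a ^ 2 + b ^ 2) * Real.exp (-(s.im - T) ^ 2) * 1 *
          (|B| * Real.exp (D * |s.im|)) := by
          gcongr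
          exact h1.trans h4
      _ = |B| * (Real.exp (a ^ 2 + b ^ 2) * Real.exp (-(s.im - T) ^ 2 + D * |s.im|)) := by
          rw [Real.exp_add (-(s.im - T) ^ 2)]; ring
      _ ≤ _ := by gcongr
  · intro s hs
    have h1 : (p * (b - s.re) + q * (s.re - a)) / (b - a) = p := by
      rw [hs]; field_simp; ring
    rw [norm_mul, hgn, h1, hs]
    refine (mul_le_mul_of_nonneg_left (ha s hs) (by positivity)).trans ?_
    refine (gaussian_weight_le hp hA _ _ _).trans ?_
    rw [hC]
    exact mul_le_mul_of_nonneg_left (le_add_of_nonneg_right (Real.exp_pos _).le) hA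
  · intro s hs
    have h1 : (p * (b - s.re) + q * (s.re - a)) / (b - a) = q := by
      rw [hs]; field_simp; ring
    rw [norm_mul, hgn, h1, hs]
    refine (mul_le_mul_of_nonneg_left (hb s hs) (by positivity)).trans ?_
    refine (gaussian_weight_le hq hA _ _ _).trans ?_
    rw [hC]
    exact mul_le_mul_of_nonneg_left (le_add_of_nonneg_left (Real.exp_pos _).le) hA

end Interpolation

section GammaBounds

theorem norm_Gamma_le {s : ℂ} (hs : 0 < s.re) : ‖Complex.Gamma s‖ ≤ Real.Gamma s.re := by
  rw [Complex.Gamma_eq_integral hs, Real.Gamma_eq_integral hs, Complex.GammaIntegral]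
  refine (MeasureTheory.norm_integral_le_integral_norm _).trans (le_of_eq ?_)
  refine MeasureTheory.setIntegral_congr_fun measurableSet_Ioi fun t ht => ?_
  simp only [norm_mul]
  rw [Complex.norm_cpow_eq_rpow_re_of_pos ht, Complex.norm_of_nonneg (Real.exp_pos _).le]
  simp

theorem exists_norm_Gamma_le {a b : ℝ} (ha : 0 < a) :
    ∃ C : ℝ, 0 ≤ C ∧ ∀ s : ℂ, a ≤ s.re → s.re ≤ b → ‖Complex.Gamma s‖ ≤ C := by
  have hc : ContinuousOn Real.Gamma (Set.Icc a b) := fun x hx =>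
    (Real.differentiableAt_Gamma fun m => by
      have := hx.1
      have : (0 : ℝ) ≤ m := Nat.cast_nonneg m
      linarith).continuousAt.continuousWithinAt
  obtain ⟨C, hC⟩ := isCompact_Icc.exists_bound_of_continuousOn hc
  refine ⟨|C|, abs_nonneg C, fun s h1 h2 => (norm_Gamma_le (by linarith)).trans ?_⟩
  exact (Real.le_norm_self _).trans ((hC s.re ⟨h1, h2⟩).trans (le_abs_self C))

theorem norm_sin_le_exp (z : ℂ) : ‖Complex.sin z‖ ≤ Real.exp |z.im| := by
  rw [Complex.sin, norm_div, norm_mul, Complex.norm_I, mul_one, Complex.norm_two]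
  have h1 : ‖Complex.exp (-z * Complex.I) - Complex.exp (z * Complex.I)‖ ≤
      Real.exp |z.im| + Real.exp |z.im| := by
    refine (norm_sub_le _ _).trans (add_le_add ?_ ?_) <;> rw [Complex.norm_exp] <;>
      refine Real.exp_le_exp.mpr ?_
    · simpa using le_abs_self z.im
    · simpa using neg_le_abs z.im
  linarith

/-- The reflection formula writes 1/Γ(s) as Γ(1-s) sin(πs)/π, with Re(1-s) bounded below by 1 - b >
0. The bound is crude, but it suffices as a growth condition for Phragmén–Lindelöf. -/
theorem exists_norm_inv_Gamma_le {a b : ℝ} (hb : b < 1) :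
    ∃ C : ℝ, 0 ≤ C ∧ ∀ s : ℂ, a ≤ s.re → s.re ≤ b →
      ‖(Complex.Gamma s)⁻¹‖ ≤ C * Real.exp (Real.pi * |s.im|) := by
  obtain ⟨C, hC0, hC⟩ := exists_norm_Gamma_le (a := 1 - b) (b := 1 - a) (by linarith)
  refine ⟨C / Real.pi, by have := Real.pi_pos; positivity, fun s h1 h2 => ?_⟩
  by_cases h0 : Complex.Gamma s = 0
  · rw [h0, inv_zero, norm_zero]; have := Real.pi_pos; positivity
  have hpi : (Real.pi : ℂ) ≠ 0 := by exact_mod_cast Real.pi_ne_zero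
  have hG1 : Complex.Gamma (1 - s) ≠ 0 :=
    Complex.Gamma_ne_zero_of_re_pos (by simp; linarith)
  have href := Complex.Gamma_mul_Gamma_one_sub s
  have hsin : Complex.sin (Real.pi * s) ≠ 0 := by
    intro h
    rw [h, div_zero] at href
    exact mul_ne_zero h0 hG1 href
  have hinv : (Complex.Gamma s)⁻¹ = Complex.Gamma (1 - s) * Complex.sin (Real.pi * s) / Real.pi := by
    rw [eq_div_iff hsin] at href
    rw [eq_div_iff hpi, inv_mul_eq_iff_eq_mul₀ h0, ← mul_assoc, href]
  rw [hinv, norm_div, norm_mul, Complex.norm_of_nonneg Real.pi_pos.le]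
  have h3 := norm_sin_le_exp (Real.pi * s)
  have h4 : ((Real.pi : ℂ) * s).im = Real.pi * s.im := Complex.im_ofReal_mul _ _
  rw [h4, abs_mul, abs_of_pos Real.pi_pos] at h3
  have h5 := hC (1 - s) (by simp; linarith) (by simp; linarith)
  rw [div_mul_eq_mul_div]
  gcongr

/-- The quotient `Γ((1 - s) / 2) / Γ(s / 2)`. -/
noncomputable def gammaRatio (s : ℂ) : ℂ :=
  Complex.Gamma ((1 - s) / 2) * (Complex.Gamma (s / 2))⁻¹

theorem norm_Gamma_half_conj {s : ℂ} (hs : s.re = 1 / 2) :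
    ‖Complex.Gamma ((1 - s) / 2)‖ = ‖Complex.Gamma (s / 2)‖ := by
  have h : (1 - s) / 2 = (starRingEnd ℂ) (s / 2) := by
    rw [map_div₀, map_ofNat]
    congr 1
    apply Complex.ext
    · simp [hs]; norm_num
    · simp
  rw [h, Complex.Gamma_conj, RCLike.norm_conj]

theorem norm_gammaRatio_half {s : ℂ} (hs : s.re = 1 / 2) : ‖gammaRatio s‖ = 1 := by
  have h0 : Complex.Gamma (s / 2) ≠ 0 := Complex.Gamma_ne_zero_of_re_pos (by simp [hs])
  rw [gammaRatio, norm_mul, norm_inv, norm_Gamma_half_conj hs,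
    mul_inv_cancel₀ (norm_ne_zero_iff.mpr h0)]

/-- Apply Γ(z + 1) = zΓ(z) to numerator and denominator. This carries the line Re s = -3/2 to Re s =
1/2, where the ratio has modulus 1. -/
theorem gammaRatio_eq {s : ℂ} (h0 : s ≠ 0) (h1 : s ≠ -1) :
    gammaRatio s = -(s * (s + 1) / 4) * gammaRatio (s + 2) := by
  have h2 : (-1 - s) / 2 ≠ 0 := by
    intro h
    apply h1
    have : -1 - s = 0 := by simpa using h
    linear_combination -this
  have h3 := Complex.Gamma_add_one _ h2
  have h4 := Complex.Gamma_add_one (s / 2) (by simpa using h0)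
  have e1 : (-1 - s) / 2 + 1 = (1 - s) / 2 := by ring
  have e2 : (1 - (s + 2)) / 2 = (-1 - s) / 2 := by ring
  have e3 : (s + 2) / 2 = s / 2 + 1 := by ring
  rw [e1] at h3
  rw [gammaRatio, gammaRatio, e2, e3, h3, h4, mul_inv]
  have h5 : s / 2 ≠ 0 := by simpa using h0
  field_simp
  ring

theorem differentiableAt_gammaRatio {s : ℂ} (hs : s.re < 1) : DifferentiableAt ℂ gammaRatio s := by
  refine DifferentiableAt.mul ?_ ?_
  · refine DifferentiableAt.comp (g := Complex.Gamma) s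
      (Complex.differentiableAt_Gamma _ fun m => ?_) (by fun_prop)
    intro h
    have h1 := congrArg Complex.re h
    simp at h1
    have : (0 : ℝ) ≤ m := Nat.cast_nonneg m
    linarith
  · exact DifferentiableAt.comp (g := fun s => (Complex.Gamma s)⁻¹) s
      (Complex.differentiable_one_div_Gamma _) (by fun_prop)

/-- Interpolation between exponent 0 on Re s = 1/2 and exponent 2 on Re s = -3/2; it replaces
Stirling's formula. -/
theorem exists_norm_gammaRatio_le :
    ∃ C : ℝ, 0 ≤ C ∧ ∀ s : ℂ, -(3 / 2) ≤ s.re → s.re ≤ 1 / 2 →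
      ‖gammaRatio s‖ ≤ C * (1 + |s.im|) ^ (1 / 2 - s.re) := by
  obtain ⟨C₁, hC₁0, hC₁⟩ := exists_norm_Gamma_le (a := 1 / 4) (b := 5 / 4) (by norm_num)
  obtain ⟨C₂, hC₂0, hC₂⟩ := exists_norm_inv_Gamma_le (a := -(3 / 4)) (b := 1 / 4) (by norm_num)
  have hd : DiffContOnCl ℂ gammaRatio (Complex.re ⁻¹' Set.Ioo (-(3 / 2)) (1 / 2)) := by
    refine DifferentiableOn.diffContOnCl fun s hs => ?_
    refine (differentiableAt_gammaRatio ?_).differentiableWithinAt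
    have h1 : s ∈ Complex.re ⁻¹' Set.Iic (1 / 2 : ℝ) :=
      closure_minimal (Set.preimage_mono fun x hx => hx.2.le)
        (isClosed_Iic.preimage Complex.continuous_re) hs
    have h2 : s.re ≤ 1 / 2 := h1
    linarith
  have key := exists_norm_le_of_vertical_strip (f := gammaRatio) (a := -(3 / 2))
    (b := 1 / 2) (p := 2) (q := 0) (A := 1) (B := C₁ * C₂) (D := Real.pi / 2) (by norm_num)
    hd (by norm_num) le_rfl ?_ ?_ ?_
  · obtain ⟨C, hC0, hC⟩ := key
    refine ⟨C, hC0, fun s h1 h2 => (hC s h1 h2).trans (le_of_eq ?_)⟩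
    congr 2
    ring
  · intro s h1 h2 _
    rw [gammaRatio, norm_mul]
    have e1 : ((1 - s) / 2).re = (1 - s.re) / 2 := by simp
    have e2 : (s / 2).re = s.re / 2 := by simp
    have e3 : |(s / 2).im| = |s.im| / 2 := by simp [abs_div]
    have h3 := hC₁ ((1 - s) / 2) (by rw [e1]; linarith) (by rw [e1]; linarith)
    have h4 := hC₂ (s / 2) (by rw [e2]; linarith) (by rw [e2]; linarith)
    rw [e3] at h4
    calc _ ≤ C₁ * (C₂ * Real.exp (Real.pi * (|s.im| / 2))) := by gcongr
      _ = _ := by rw [mul_assoc]; congr 3; ring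
  · intro s hs
    have h0 : s ≠ 0 := by rintro rfl; norm_num at hs
    have h1 : s ≠ -1 := by rintro rfl; norm_num at hs
    rw [gammaRatio_eq h0 h1, norm_mul, norm_gammaRatio_half (by simp [hs]; norm_num), mul_one,
      one_mul, norm_neg, norm_div, norm_mul, Real.rpow_two]
    have h2 : ‖s‖ ≤ 2 * (1 + |s.im|) := by
      refine (Complex.norm_le_abs_re_add_abs_im s).trans ?_
      rw [hs, abs_neg, abs_of_pos (by norm_num)]
      linarith [abs_nonneg s.im]
    have h3 : ‖s + 1‖ ≤ 1 + |s.im| := by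
      refine (Complex.norm_le_abs_re_add_abs_im _).trans ?_
      have : |(s + 1).re| ≤ 1 := by simp [hs]; norm_num [abs_le]
      simpa using this
    have h4 : ‖(4 : ℂ)‖ = 4 := by simp
    rw [h4]
    have h5 := mul_le_mul h2 h3 (norm_nonneg _) (by positivity)
    nlinarith [sq_nonneg (1 + |s.im|)]
  · intro s hs
    rw [norm_gammaRatio_half hs, Real.rpow_zero, mul_one]

end GammaBounds
end LatticeZeta

/-! ### Continuation of the zeta function and locally uniform convergence. -/

namespace LatticeZeta

open MeasureTheory Matrix

section Continuation

variable {r : ℕ} {L : Submodule ℤ (Fin (r + 1) → ℝ)} [DiscreteTopology L] [IsZLattice ℝ L]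
  {M : Subgroup (PosVec r)} {ε : Fin r → PosVec r}

/-- The constant `2 ^ (n - 1) |det logMatrix ε|` relating the completed zeta function to the
Mellin transform. -/
noncomputable def unfoldConst (ε : Fin r → PosVec r) : ℂ :=
  ((2 ^ r * |(logMatrix ε).det| : ℝ) : ℂ)

/-- The factor of the zeta function free of the Mellin transform and of the first Gamma factor. -/
noncomputable def zetaFactor (ε : Fin r → PosVec r) (m : Fin r → ℤ) (s : ℂ) : ℂ :=
  unfoldConst ε * (Real.pi : ℂ) ^ (((r + 1 : ℕ) : ℂ) * s / 2) *
    ∏ j : Fin r, (Complex.Gamma (shift ε m s j.succ / 2))⁻¹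

/-- The meromorphic continuation of the zeta series. -/
noncomputable def zetaCont (h : IsZetaDatum L M ε) (m : Fin r → ℤ) (s : ℂ) : ℂ :=
  zetaFactor ε m s *
    ((Complex.Gamma (shift ε m s 0 / 2))⁻¹ * ((thetaPair h m).Λ₀ (((r + 1 : ℕ) : ℂ) * s / 2) -
      (if m = 0 then ((ZLattice.covolume L)⁻¹ : ℝ) else 0 : ℝ) /
        (((r + 1 : ℕ) : ℂ) * (1 - s) / 2)) -
      (if m = 0 then (1 : ℂ) else 0) / ((r + 1 : ℕ) : ℂ) *
        (Complex.Gamma (shift ε m s 0 / 2 + 1))⁻¹)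

/-- The entire function `(s - 1) Z(s)`. -/
noncomputable def zetaNum (h : IsZetaDatum L M ε) (m : Fin r → ℤ) (s : ℂ) : ℂ :=
  zetaFactor ε m s *
    ((Complex.Gamma (shift ε m s 0 / 2))⁻¹ *
      ((s - 1) * (thetaPair h m).Λ₀ (((r + 1 : ℕ) : ℂ) * s / 2) +
      (if m = 0 then ((ZLattice.covolume L)⁻¹ : ℝ) else 0 : ℝ) * (2 / ((r + 1 : ℕ) : ℂ))) -
      (if m = 0 then (1 : ℂ) else 0) / ((r + 1 : ℕ) : ℂ) *
        ((s - 1) * (Complex.Gamma (shift ε m s 0 / 2 + 1))⁻¹))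

theorem natCast_succ_ne_zero (r : ℕ) : ((r + 1 : ℕ) : ℂ) ≠ 0 :=
  Nat.cast_ne_zero.2 r.succ_ne_zero

theorem zetaNum_eq (h : IsZetaDatum L M ε) (m : Fin r → ℤ) {s : ℂ} (hs : s ≠ 1) :
    zetaNum h m s = (s - 1) * zetaCont h m s := by
  have hn := natCast_succ_ne_zero r
  have h1 : (1 - s) ≠ 0 := sub_ne_zero.2 hs.symm
  rw [zetaNum, zetaCont]
  generalize ((r + 1 : ℕ) : ℂ) = n at *
  field_simp
  ring

theorem zetaCont_eq_div (h : IsZetaDatum L M ε) (m : Fin r → ℤ) {s : ℂ} (hs : s ≠ 1) :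
    zetaCont h m s = zetaNum h m s / (s - 1) := by
  rw [zetaNum_eq h m hs, mul_div_cancel_left₀ _ (sub_ne_zero.2 hs)]

theorem differentiable_shift (m : Fin r → ℤ) (k : Fin (r + 1)) :
    Differentiable ℂ fun s => shift ε m s k := by
  unfold shift
  fun_prop

theorem differentiable_inv_Gamma_shift (m : Fin r → ℤ) (k : Fin (r + 1)) (c : ℂ) :
    Differentiable ℂ fun s => (Complex.Gamma (shift ε m s k / 2 + c))⁻¹ :=
  Complex.differentiable_one_div_Gamma.comp
    (((differentiable_shift m k).div_const 2).add_const c)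

theorem differentiable_inv_Gamma_shift' (m : Fin r → ℤ) (k : Fin (r + 1)) :
    Differentiable ℂ fun s => (Complex.Gamma (shift ε m s k / 2))⁻¹ := by
  simpa using differentiable_inv_Gamma_shift (ε := ε) m k 0

theorem differentiable_pi_cpow (r : ℕ) :
    Differentiable ℂ fun s : ℂ => (Real.pi : ℂ) ^ (((r + 1 : ℕ) : ℂ) * s / 2) := by
  intro s
  have : (Real.pi : ℂ) ≠ 0 := Complex.ofReal_ne_zero.2 Real.pi_ne_zero
  exact DifferentiableAt.const_cpow (by fun_prop) (Or.inl this)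

theorem differentiable_zetaFactor (m : Fin r → ℤ) : Differentiable ℂ (zetaFactor ε m) := by
  refine ((differentiable_const _).mul (differentiable_pi_cpow r)).mul ?_
  exact Differentiable.fun_finsetProd fun j _ => differentiable_inv_Gamma_shift' m j.succ

theorem differentiable_thetaPair (h : IsZetaDatum L M ε) (m : Fin r → ℤ) :
    Differentiable ℂ fun s => (thetaPair h m).Λ₀ (((r + 1 : ℕ) : ℂ) * s / 2) :=
  (thetaPair h m).differentiable_Λ₀.comp (by fun_prop)

theorem differentiable_zetaNum (h : IsZetaDatum L M ε) (m : Fin r → ℤ) :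
    Differentiable ℂ (zetaNum h m) := by
  have h1 := differentiable_inv_Gamma_shift' (ε := ε) m 0
  have h2 := differentiable_inv_Gamma_shift (ε := ε) m 0 1
  have h3 := differentiable_thetaPair h m
  have h4 := differentiable_zetaFactor (ε := ε) m
  unfold zetaNum
  fun_prop

theorem zetaCont_of_ne_zero (h : IsZetaDatum L M ε) {m : Fin r → ℤ} (hm : m ≠ 0) (s : ℂ) :
    zetaCont h m s = zetaFactor ε m s * ((Complex.Gamma (shift ε m s 0 / 2))⁻¹ *
      (thetaPair h m).Λ₀ (((r + 1 : ℕ) : ℂ) * s / 2)) := by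
  simp [zetaCont, hm]

theorem analyticAt_zetaCont (h : IsZetaDatum L M ε) (m : Fin r → ℤ) {s : ℂ}
    (hs : m ≠ 0 ∨ s ≠ 1) : AnalyticAt ℂ (zetaCont h m) s := by
  by_cases hm : m = 0
  · have hs1 : s ≠ 1 := hs.resolve_left (not_not.2 hm)
    have h1 : AnalyticAt ℂ (fun z => zetaNum h m z / (z - 1)) s :=
      ((differentiable_zetaNum h m).analyticAt s).div (by fun_prop) (sub_ne_zero.2 hs1)
    refine h1.congr ?_
    filter_upwards [isOpen_ne.mem_nhds hs1] with z hz
    exact (zetaCont_eq_div h m hz).symm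
  · have h1 : Differentiable ℂ (zetaCont h m) := by
      have h1 := differentiable_inv_Gamma_shift' (ε := ε) m 0
      have h3 := differentiable_thetaPair h m
      have h4 := differentiable_zetaFactor (ε := ε) m
      rw [funext (zetaCont_of_ne_zero h hm)]
      fun_prop
    exact h1.analyticAt s

theorem meromorphic_zetaCont (h : IsZetaDatum L M ε) (m : Fin r → ℤ) :
    Meromorphic (zetaCont h m) := by
  intro s
  by_cases hs : m ≠ 0 ∨ s ≠ 1
  · exact (analyticAt_zetaCont h m hs).meromorphicAt
  · have h1 : MeromorphicAt (fun z => zetaNum h m z / (z - 1)) s :=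
      ((differentiable_zetaNum h m).analyticAt s).meromorphicAt.div
        (by fun_prop : AnalyticAt ℂ (fun z : ℂ => z - 1) s).meromorphicAt
    refine h1.congr ?_
    have : s = 1 := by tauto
    subst this
    filter_upwards [self_mem_nhdsWithin] with z hz
    exact (zetaCont_eq_div h m hz).symm

theorem inv_Gamma_eq_mul (z : ℂ) : (Complex.Gamma z)⁻¹ = z * (Complex.Gamma (z + 1))⁻¹ :=
  Complex.one_div_Gamma_eq_self_mul_one_div_Gamma_add_one z

theorem shift_zero_index (s : ℂ) (k : Fin (r + 1)) : shift ε 0 s k = s := by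
  simp [shift]

/-- This accounts for the shape of `zetaCont`. For m = 0 all s_k equal s, and 1/Γ(s/2) = (s/2)/Γ(s/2
+ 1) cancels the polar term 2/(ns) of Λ, leaving 1/(nΓ(s/2 + 1)), which is regular at 0. At s = 0
itself Λ carries the default value of a division by zero, hence the exclusion. -/
theorem zetaCont_eq (h : IsZetaDatum L M ε) (m : Fin r → ℤ) {s : ℂ} (hs : m ≠ 0 ∨ s ≠ 0) :
    zetaCont h m s = unfoldConst ε * (Real.pi : ℂ) ^ (((r + 1 : ℕ) : ℂ) * s / 2) *
      (∏ k, (Complex.Gamma (shift ε m s k / 2))⁻¹) *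
        (thetaPair h m).Λ (((r + 1 : ℕ) : ℂ) * s / 2) := by
  have hn := natCast_succ_ne_zero r
  rw [Fin.prod_univ_succ]
  by_cases hm : m = 0
  · have hs0 : s ≠ 0 := hs.resolve_left (not_not.2 hm)
    subst hm
    rw [zetaCont, WeakFEPair.Λ, zetaFactor]
    simp only [shift_zero_index, thetaPair, if_true, smul_eq_mul, mul_one]
    rw [inv_Gamma_eq_mul (s / 2)]
    have e : ((((r + 1 : ℕ) : ℝ) / 2 : ℝ) : ℂ) - ((r + 1 : ℕ) : ℂ) * s / 2 =
      ((r + 1 : ℕ) : ℂ) * (1 - s) / 2 := by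
      push_cast
      ring
    rw [e]
    generalize ((r + 1 : ℕ) : ℂ) = n at *
    field_simp
    ring
  · rw [zetaCont_of_ne_zero h hm, WeakFEPair.Λ, zetaFactor]
    have e1 : (thetaPair h m).f₀ = 0 := if_neg hm
    have e2 : (thetaPair h m).g₀ = 0 := if_neg hm
    rw [e1, e2]
    simp only [smul_zero, sub_zero]
    ring

theorem zetaCont_eq_zetaSeries (h : IsZetaDatum L M ε) (m : Fin r → ℤ) {s : ℂ}
    (hs : 1 < s.re) : zetaCont h m s = zetaSeries L M ε m s := by
  have hs0 : s ≠ 0 := by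
    rintro rfl
    norm_num at hs
  have h1 := completed_zetaSeries h m hs
  have h2 := prod_Gamma_ne_zero (ε := ε) m (s := s) (by linarith)
  have hpi : (Real.pi : ℂ) ≠ 0 := Complex.ofReal_ne_zero.2 Real.pi_ne_zero
  rw [zetaCont_eq h m (Or.inr hs0), Finset.prod_inv_distrib]
  rw [Complex.cpow_neg] at h1
  have h3 : (Real.pi : ℂ) ^ (((r + 1 : ℕ) : ℂ) * s / 2) ≠ 0 :=
    (Complex.cpow_ne_zero_iff_of_exponent_ne_zero
      (div_ne_zero (mul_ne_zero (natCast_succ_ne_zero r) hs0) two_ne_zero)).2 hpi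
  rw [show unfoldConst ε = ((2 ^ r * |(logMatrix ε).det| : ℝ) : ℂ) from rfl]
  field_simp
  field_simp at h1
  rw [h1]
  ring

theorem isZetaContinuation_zetaCont (h : IsZetaDatum L M ε) (m : Fin r → ℤ) :
    IsZetaContinuation L M ε m (zetaCont h m) where
  summable _ hs := summable_norm_orbitTerm h m hs
  eq_series _ hs := zetaCont_eq_zetaSeries h m hs
  meromorphic := meromorphic_zetaCont h m

theorem analyticOnNhd_zetaSeries (h : IsZetaDatum L M ε) (m : Fin r → ℤ) :
    AnalyticOnNhd ℂ (zetaSeries L M ε m) {s : ℂ | 1 < s.re} := by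
  intro s hs
  have hs' : 1 < s.re := hs
  have hs1 : s ≠ 1 := by
    rintro rfl
    norm_num at hs'
  refine (analyticAt_zetaCont h m (Or.inr hs1)).congr ?_
  filter_upwards [(isOpen_lt continuous_const Complex.continuous_re).mem_nhds hs'] with z hz
  exact zetaCont_eq_zetaSeries h m hz

omit [IsZLattice ℝ L] in
theorem orbit_vecNorm_pos (h : IsZetaDatum L M ε) (o : Orbits L M) :
    0 < |vecNorm (Quotient.out o).1| :=
  abs_pos.2 (Finset.prod_ne_zero_iff.2 fun k _ =>
    h.coord_ne_zero (Quotient.out o).2.1 (Quotient.out o).2.2 k)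

theorem summable_orbit_rpow (h : IsZetaDatum L M ε) {a : ℝ} (ha : 1 < a) :
    Summable fun o : Orbits L M => |vecNorm (Quotient.out o).1| ^ (-a) := by
  have := summable_norm_orbitTerm h 0 (s := (a : ℂ)) (by simpa using ha)
  simpa [norm_orbitTerm h] using this

/-- Norms of lattice vectors may lie on either side of 1, so uniformity in the exponent needs both
ends of its range. -/
theorem rpow_neg_le_add {x a b c : ℝ} (hx : 0 < x) (hab : a ≤ c) (hcb : c ≤ b) :
    x ^ (-c) ≤ x ^ (-a) + x ^ (-b) := by
  rcases le_total 1 x with h1 | h1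
  · exact (Real.rpow_le_rpow_of_exponent_le h1 (by linarith)).trans
      (le_add_of_nonneg_right (by positivity))
  · exact (Real.rpow_le_rpow_of_exponent_ge hx h1 (by linarith)).trans
      (le_add_of_nonneg_left (by positivity))

theorem hasSumLocallyUniformlyOn_orbitTerm (h : IsZetaDatum L M ε) (m : Fin r → ℤ) :
    HasSumLocallyUniformlyOn (orbitTerm L M ε m) (zetaSeries L M ε m) {s : ℂ | 1 < s.re} := by
  have hs : SummableLocallyUniformlyOn (orbitTerm L M ε m) {s : ℂ | 1 < s.re} := by
    refine SummableLocallyUniformlyOn_of_locally_bounded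
      (isOpen_lt continuous_const Complex.continuous_re) fun K hK hKc => ?_
    rcases K.eq_empty_or_nonempty with rfl | hne
    · exact ⟨0, summable_zero, by simp⟩
    obtain ⟨x, hx, hxm⟩ := hKc.exists_isMinOn hne Complex.continuous_re.continuousOn
    obtain ⟨y, hy, hym⟩ := hKc.exists_isMaxOn hne Complex.continuous_re.continuousOn
    refine ⟨_, (summable_orbit_rpow h (hK hx)).add (summable_orbit_rpow h (hK hy)), ?_⟩
    intro o s hs
    rw [norm_orbitTerm h]
    exact rpow_neg_le_add (orbit_vecNorm_pos h o) (hxm hs) (hym hs)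
  exact hs.hasSumLocallyUniformlyOn

end Continuation

end LatticeZeta

/-! ### Poles, residues and the functional equation of the completed function. -/

namespace LatticeZeta

open MeasureTheory

theorem meromorphicOrderAt_eq_neg_one_and_tendsto {f g : ℂ → ℂ} {x : ℂ}
    (hfg : ∀ᶠ z in 𝓝[≠] x, f z = g z / (z - x)) (hg : AnalyticAt ℂ g x) (hgx : g x ≠ 0) :
    meromorphicOrderAt f x = -1 ∧ Tendsto (fun z => (z - x) * f z) (𝓝[≠] x) (𝓝 (g x)) := by
  have hf : MeromorphicAt f x := by
    have h1 : MeromorphicAt (fun z => g z / (z - x)) x :=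
      hg.meromorphicAt.div (by fun_prop : AnalyticAt ℂ (fun z : ℂ => z - x) x).meromorphicAt
    refine h1.congr ?_
    filter_upwards [hfg] with z hz
    exact hz.symm
  constructor
  · refine (meromorphicOrderAt_eq_int_iff (n := -1) hf).2 ⟨g, hg, hgx, ?_⟩
    filter_upwards [hfg] with z hz
    rw [hz, zpow_neg_one, smul_eq_mul, div_eq_inv_mul]
  · refine (hg.continuousAt.tendsto.mono_left nhdsWithin_le_nhds).congr' ?_
    filter_upwards [hfg, self_mem_nhdsWithin] with z hz hzx
    rw [hz, mul_div_cancel₀ _ (sub_ne_zero.2 hzx)]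

section Completed

variable {r : ℕ} {L : Submodule ℤ (Fin (r + 1) → ℝ)} [DiscreteTopology L] [IsZLattice ℝ L]
  {M : Subgroup (PosVec r)} {ε : Fin r → PosVec r}

/-- The entire function 1/Γ(s_k/2) is not identically zero, as its value at 2 shows, so its zeros
are isolated. Its zeros are the points where Γ takes the default value 0. -/
theorem eventually_Gamma_shift_ne_zero (m : Fin r → ℤ) (s : ℂ) (k : Fin (r + 1)) :
    ∀ᶠ z in 𝓝[≠] s, Complex.Gamma (shift ε m z k / 2) ≠ 0 := by
  have hd : AnalyticOnNhd ℂ (fun z => (Complex.Gamma (shift ε m z k / 2))⁻¹) Set.univ :=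
    fun z _ => (differentiable_inv_Gamma_shift' m k).analyticAt z
  rcases (hd s (Set.mem_univ s)).eventually_eq_zero_or_eventually_ne_zero with h0 | h0
  · have h1 := hd.eqOn_zero_of_preconnected_of_eventuallyEq_zero isPreconnected_univ
      (Set.mem_univ s) h0 (Set.mem_univ (2 : ℂ))
    refine absurd (inv_eq_zero.1 h1) (Complex.Gamma_ne_zero_of_re_pos ?_)
    have := shift_re (ε := ε) m 2 k
    rw [Complex.div_ofNat_re, this]
    norm_num
  · filter_upwards [h0] with z hz
    exact fun h => hz (by rw [h, inv_zero])

theorem completed_zetaCont (h : IsZetaDatum L M ε) (m : Fin r → ℤ) {s : ℂ}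
    (hs : m ≠ 0 ∨ s ≠ 0) (hG : ∀ k, Complex.Gamma (shift ε m s k / 2) ≠ 0) :
    completed ε m (zetaCont h m) s =
      unfoldConst ε * (thetaPair h m).Λ (((r + 1 : ℕ) : ℂ) * s / 2) := by
  have hpi : (Real.pi : ℂ) ≠ 0 := Complex.ofReal_ne_zero.2 Real.pi_ne_zero
  have h2 : ∏ k, Complex.Gamma (shift ε m s k / 2) ≠ 0 := Finset.prod_ne_zero_iff.2 fun k _ => hG k
  have h3 : (Real.pi : ℂ) ^ (((r + 1 : ℕ) : ℂ) * s / 2) ≠ 0 := by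
    rw [Complex.cpow_def_of_ne_zero hpi]
    exact Complex.exp_ne_zero _
  rw [completed, zetaCont_eq h m hs, Finset.prod_inv_distrib, Complex.cpow_neg]
  field_simp

theorem eventually_completed_eq (h : IsZetaDatum L M ε) (m : Fin r → ℤ) (s : ℂ) :
    ∀ᶠ z in 𝓝[≠] s, completed ε m (zetaCont h m) z =
      unfoldConst ε * (thetaPair h m).Λ (((r + 1 : ℕ) : ℂ) * z / 2) := by
  have h0 : ∀ᶠ z in 𝓝[≠] s, z ≠ 0 := by
    rcases eq_or_ne s 0 with rfl | hs
    · exact self_mem_nhdsWithin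
    · exact nhdsWithin_le_nhds (isOpen_ne.mem_nhds hs)
  filter_upwards [eventually_all.2 (eventually_Gamma_shift_ne_zero m s), h0] with z hz hz0
  exact completed_zetaCont h m (Or.inr hz0) hz

theorem thetaPair_Λ (h : IsZetaDatum L M ε) (m : Fin r → ℤ) (s : ℂ) :
    (thetaPair h m).Λ (((r + 1 : ℕ) : ℂ) * s / 2) =
      (thetaPair h m).Λ₀ (((r + 1 : ℕ) : ℂ) * s / 2) -
      (if m = 0 then 1 else 0) * (2 / (((r + 1 : ℕ) : ℂ) * s)) -
      (if m = 0 then 1 else 0) * (((ZLattice.covolume L)⁻¹ : ℝ) * 2 /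
        (((r + 1 : ℕ) : ℂ) * (1 - s))) := by
  have e : ((((r + 1 : ℕ) : ℝ) / 2 : ℝ) : ℂ) - ((r + 1 : ℕ) : ℂ) * s / 2 =
      ((r + 1 : ℕ) : ℂ) * (1 - s) / 2 := by
    push_cast
    ring
  rw [WeakFEPair.Λ]
  simp only [thetaPair, smul_eq_mul, e, div_div_eq_mul_div]
  ring

theorem meromorphic_completed (h : IsZetaDatum L M ε) (m : Fin r → ℤ) :
    Meromorphic (completed ε m (zetaCont h m)) := by
  intro s
  have h1 : MeromorphicAt (fun z : ℂ => (Real.pi : ℂ) ^ (-(((r + 1 : ℕ) : ℂ) * z / 2))) s := by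
    have : (Real.pi : ℂ) ≠ 0 := Complex.ofReal_ne_zero.2 Real.pi_ne_zero
    have h2 : Differentiable ℂ fun z : ℂ => (Real.pi : ℂ) ^ (-(((r + 1 : ℕ) : ℂ) * z / 2)) :=
      fun z => DifferentiableAt.const_cpow (by fun_prop) (Or.inl this)
    exact (h2.analyticAt s).meromorphicAt
  have h2 : MeromorphicAt (fun z : ℂ => ∏ k, Complex.Gamma (shift ε m z k / 2)) s := by
    refine MeromorphicAt.fun_prod fun k _ => ?_
    have h3 := ((differentiable_inv_Gamma_shift' (ε := ε) m k).analyticAt s).meromorphicAt.inv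
    simpa [Pi.inv_def] using h3
  exact (h1.mul h2).mul (meromorphic_zetaCont h m s)

theorem meromorphicOrderAt_completed_nonneg (h : IsZetaDatum L M ε) (m : Fin r → ℤ) {s : ℂ}
    (hs : m ≠ 0 ∨ (s ≠ 0 ∧ s ≠ 1)) :
    0 ≤ meromorphicOrderAt (completed ε m (zetaCont h m)) s := by
  rw [meromorphicOrderAt_congr (eventually_completed_eq h m s)]
  have h3 : AnalyticAt ℂ (fun s => (thetaPair h m).Λ₀ (((r + 1 : ℕ) : ℂ) * s / 2)) s :=
    (differentiable_thetaPair h m).analyticAt s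
  refine AnalyticAt.meromorphicOrderAt_nonneg (analyticAt_const.mul ?_)
  simp_rw [thetaPair_Λ]
  by_cases hm : m = 0
  · obtain ⟨hs0, hs1⟩ := hs.resolve_left (not_not.2 hm)
    have hn := natCast_succ_ne_zero r
    refine (h3.sub (analyticAt_const.mul (analyticAt_const.div (by fun_prop) ?_))).sub
      (analyticAt_const.mul (analyticAt_const.div (by fun_prop) ?_))
    · exact mul_ne_zero hn hs0
    · exact mul_ne_zero hn (sub_ne_zero.2 hs1.symm)
  · simpa [hm] using h3

theorem completed_pole_one (h : IsZetaDatum L M ε) :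
    meromorphicOrderAt (completed ε 0 (zetaCont h 0)) 1 = -1 ∧
      Tendsto (fun s : ℂ => (s - 1) * completed ε 0 (zetaCont h 0) s) (𝓝[≠] 1)
        (𝓝 (((2 ^ (r + 1) * |(logMatrix ε).det| /
          (((r + 1 : ℕ) : ℝ) * ZLattice.covolume L) : ℝ)) : ℂ)) := by
  have hn := natCast_succ_ne_zero r
  have hv : ((ZLattice.covolume L : ℝ) : ℂ) ≠ 0 :=
    Complex.ofReal_ne_zero.2 (ZLattice.covolume_ne_zero L)
  have hdet : ((|(logMatrix ε).det| : ℝ) : ℂ) ≠ 0 :=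
    Complex.ofReal_ne_zero.2 (abs_ne_zero.2 h.isUnitSystem.det_ne)
  have h3 : AnalyticAt ℂ (fun s => (thetaPair h 0).Λ₀ (((r + 1 : ℕ) : ℂ) * s / 2)) 1 :=
    (differentiable_thetaPair h 0).analyticAt 1
  have key := meromorphicOrderAt_eq_neg_one_and_tendsto (x := 1)
    (f := completed ε 0 (zetaCont h 0)) (g := fun s => unfoldConst ε *
      ((s - 1) * ((thetaPair h 0).Λ₀ (((r + 1 : ℕ) : ℂ) * s / 2) -
        2 / (((r + 1 : ℕ) : ℂ) * s)) +
        ((ZLattice.covolume L)⁻¹ : ℝ) * 2 / ((r + 1 : ℕ) : ℂ))) ?_ ?_ ?_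
  · have e : unfoldConst ε * ((1 - 1) * ((thetaPair h 0).Λ₀ (((r + 1 : ℕ) : ℂ) * 1 / 2) -
        2 / (((r + 1 : ℕ) : ℂ) * 1)) + ((ZLattice.covolume L)⁻¹ : ℝ) * 2 / ((r + 1 : ℕ) : ℂ)) =
        (((2 ^ (r + 1) * |(logMatrix ε).det| /
          (((r + 1 : ℕ) : ℝ) * ZLattice.covolume L) : ℝ)) : ℂ) := by
      rw [unfoldConst]
      push_cast at hn ⊢
      field_simp
      ring
    rw [← e]
    exact key
  · filter_upwards [eventually_completed_eq h 0 1, self_mem_nhdsWithin] with z hz hz1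
    have h1 : 1 - z ≠ 0 := sub_ne_zero.2 (Ne.symm hz1)
    have h2 : z - 1 ≠ 0 := sub_ne_zero.2 hz1
    rw [hz, thetaPair_Λ, if_pos rfl, show 1 - z = -(z - 1) by ring]
    generalize ((r + 1 : ℕ) : ℂ) = n at *
    field_simp
    ring
  · refine analyticAt_const.mul ((AnalyticAt.mul (by fun_prop) (h3.sub
      (analyticAt_const.div (by fun_prop) ?_))).add analyticAt_const)
    simpa using hn
  · simp only [sub_self, zero_mul, zero_add, unfoldConst]
    push_cast at hn hdet ⊢
    simp [hn, hv, h.isUnitSystem.det_ne]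

theorem completed_pole_zero (h : IsZetaDatum L M ε) :
    meromorphicOrderAt (completed ε 0 (zetaCont h 0)) 0 = -1 ∧
      Tendsto (fun s : ℂ => s * completed ε 0 (zetaCont h 0) s) (𝓝[≠] 0)
        (𝓝 ((-(2 ^ (r + 1) * |(logMatrix ε).det| / ((r + 1 : ℕ) : ℝ)) : ℝ) : ℂ)) := by
  have hn := natCast_succ_ne_zero r
  have h3 : AnalyticAt ℂ (fun s => (thetaPair h 0).Λ₀ (((r + 1 : ℕ) : ℂ) * s / 2)) 0 :=
    (differentiable_thetaPair h 0).analyticAt 0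
  have key := meromorphicOrderAt_eq_neg_one_and_tendsto (x := 0)
    (f := completed ε 0 (zetaCont h 0)) (g := fun s => unfoldConst ε *
      (s * ((thetaPair h 0).Λ₀ (((r + 1 : ℕ) : ℂ) * s / 2) -
        (((ZLattice.covolume L)⁻¹ : ℝ) * 2 / (((r + 1 : ℕ) : ℂ) * (1 - s)))) -
        2 / ((r + 1 : ℕ) : ℂ))) ?_ ?_ ?_
  · have e : unfoldConst ε * (0 * ((thetaPair h 0).Λ₀ (((r + 1 : ℕ) : ℂ) * 0 / 2) -
        (((ZLattice.covolume L)⁻¹ : ℝ) * 2 / (((r + 1 : ℕ) : ℂ) * (1 - 0)))) -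
        2 / ((r + 1 : ℕ) : ℂ)) =
        ((-(2 ^ (r + 1) * |(logMatrix ε).det| / ((r + 1 : ℕ) : ℝ)) : ℝ) : ℂ) := by
      rw [unfoldConst]
      push_cast at hn ⊢
      field_simp
      ring
    rw [← e]
    simpa only [sub_zero] using key
  · filter_upwards [eventually_completed_eq h 0 0, self_mem_nhdsWithin] with z hz hz1
    have h2 : z ≠ 0 := hz1
    rw [hz, thetaPair_Λ, if_pos rfl, sub_zero]
    generalize ((r + 1 : ℕ) : ℂ) = n at *
    field_simp
    ring
  · refine analyticAt_const.mul ((AnalyticAt.mul (by fun_prop) (h3.sub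
      (analyticAt_const.div (by fun_prop) ?_))).sub analyticAt_const)
    simpa using hn
  · simp only [zero_mul, zero_sub, unfoldConst]
    push_cast at hn ⊢
    simp [hn, h.isUnitSystem.det_ne]

/-- The residue is the value at 1 of the entire function (s - 1)Z(s). There the n factors 1/Γ(1/2)
cancel π^(n/2), so the residue agrees with that of the completed function. -/
theorem zetaCont_pole_one (h : IsZetaDatum L M ε) :
    meromorphicOrderAt (zetaCont h 0) 1 = -1 ∧
      Tendsto (fun s : ℂ => (s - 1) * zetaCont h 0 s) (𝓝[≠] 1)
        (𝓝 (((2 ^ (r + 1) * |(logMatrix ε).det| /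
          (((r + 1 : ℕ) : ℝ) * ZLattice.covolume L) : ℝ)) : ℂ)) := by
  have hn := natCast_succ_ne_zero r
  have hv : ((ZLattice.covolume L : ℝ) : ℂ) ≠ 0 :=
    Complex.ofReal_ne_zero.2 (ZLattice.covolume_ne_zero L)
  have hpi : (Real.pi : ℂ) ≠ 0 := Complex.ofReal_ne_zero.2 Real.pi_ne_zero
  have e : zetaNum h 0 1 = (((2 ^ (r + 1) * |(logMatrix ε).det| /
      (((r + 1 : ℕ) : ℝ) * ZLattice.covolume L) : ℝ)) : ℂ) := by
    have hp : (Real.pi : ℂ) ^ (((r + 1 : ℕ) : ℂ) * 1 / 2) =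
        ((Real.pi : ℂ) ^ (1 / 2 : ℂ)) ^ (r + 1) := by
      rw [← Complex.cpow_nat_mul]
      congr 1
      ring
    have hp0 : (Real.pi : ℂ) ^ (1 / 2 : ℂ) ≠ 0 := by
      rw [Complex.cpow_def_of_ne_zero hpi]
      exact Complex.exp_ne_zero _
    rw [zetaNum, zetaFactor, hp, unfoldConst]
    simp only [shift_zero_index, Complex.Gamma_one_half_eq, sub_self, zero_mul, mul_zero,
      zero_add, sub_zero, if_true, Finset.prod_const, Finset.card_univ, Fintype.card_fin]
    generalize (Real.pi : ℂ) ^ (1 / 2 : ℂ) = p at *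
    push_cast at hn ⊢
    rw [inv_pow]
    field_simp
    ring
  have hne : zetaNum h 0 1 ≠ 0 := by
    rw [e, Complex.ofReal_ne_zero]
    have := abs_pos.2 h.isUnitSystem.det_ne
    have := ZLattice.covolume_pos L
    positivity
  rw [← e]
  refine meromorphicOrderAt_eq_neg_one_and_tendsto ?_ ((differentiable_zetaNum h 0).analyticAt 1)
    hne
  filter_upwards [self_mem_nhdsWithin] with z hz
  exact zetaCont_eq_div h 0 hz

/-- The constants match because the covolumes are reciprocal. The second functions of the two pairs
need not be compared: Λ is built from the first function, the weight and the constants, so no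
identification of the double dual with L is required. -/
theorem Λ_symm_thetaPair (h : IsZetaDatum L M ε) (m : Fin r → ℤ) :
    (thetaPair h m).symm.Λ = (thetaPair h.dual (-m)).Λ := by
  have e1 : (thetaPair h m).symm.f = (thetaPair h.dual (-m)).f := rfl
  have e2 : (thetaPair h m).symm.k = (thetaPair h.dual (-m)).k := rfl
  have e3 : (thetaPair h m).symm.ε = (thetaPair h.dual (-m)).ε := by
    simp [thetaPair, covolume_dualLattice]
  have e4 : (thetaPair h m).symm.f₀ = (thetaPair h.dual (-m)).f₀ := by
    simp [thetaPair, neg_eq_zero]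
  have e5 : (thetaPair h m).symm.g₀ = (thetaPair h.dual (-m)).g₀ := by
    simp [thetaPair, neg_eq_zero]
  ext s
  simp only [WeakFEPair.Λ, WeakFEPair.Λ₀, WeakFEPair.f_modif, e1, e2, e3, e4, e5]

theorem shift_neg_one_sub (m : Fin r → ℤ) (s : ℂ) (k : Fin (r + 1)) :
    shift ε (-m) (1 - s) k = 1 - shift ε m s k := by
  simp only [shift, Pi.neg_apply, Int.cast_neg, mul_neg, neg_mul, Finset.sum_neg_distrib]
  ring

theorem Λ_functional_equation (h : IsZetaDatum L M ε) (m : Fin r → ℤ) (s : ℂ) :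
    (thetaPair h m).Λ (((r + 1 : ℕ) : ℂ) * s / 2) = (((ZLattice.covolume L)⁻¹ : ℝ) : ℂ) *
      (thetaPair h.dual (-m)).Λ (((r + 1 : ℕ) : ℂ) * (1 - s) / 2) := by
  rw [← Λ_symm_thetaPair h]
  have := (thetaPair h m).functional_equation (((r + 1 : ℕ) : ℂ) * (1 - s) / 2)
  rw [smul_eq_mul] at this
  refine Eq.trans ?_ this
  congr 1
  simp only [thetaPair]
  push_cast
  ring

/-- The identity for Λ is universal. The hypothesis only keeps the Gamma factors on both sides away
from their poles, where Γ has the default value 0 and `completed` is not a multiple of Λ. -/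
theorem completed_functional_equation (h : IsZetaDatum L M ε) (m : Fin r → ℤ) {s : ℂ}
    (hs : ∀ (k : Fin (r + 1)) (j : ℕ), shift ε m s k ≠ -(2 * (j : ℂ)) ∧
      shift ε m s k ≠ 1 + 2 * (j : ℂ)) :
    ((Real.sqrt (ZLattice.covolume L) : ℝ) : ℂ) * completed ε m (zetaCont h m) s =
      ((Real.sqrt (ZLattice.covolume (dualLattice L)) : ℝ) : ℂ) *
        completed ε (-m) (zetaCont h.dual (-m)) (1 - s) := by
  have h0 : m ≠ 0 ∨ s ≠ 0 := by
    by_contra! hc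
    obtain ⟨rfl, rfl⟩ := hc
    exact (hs 0 0).1 (by simp [shift_zero_index])
  have h1 : -m ≠ 0 ∨ 1 - s ≠ 0 := by
    by_contra! hc
    rw [neg_eq_zero, sub_eq_zero] at hc
    obtain ⟨rfl, rfl⟩ := hc
    exact (hs 0 0).2 (by simp [shift_zero_index])
  rw [completed_zetaCont h m h0, completed_zetaCont h.dual (-m) h1, Λ_functional_equation,
    covolume_dualLattice]
  · have hv := ZLattice.covolume_pos L
    have e : Real.sqrt (ZLattice.covolume L) * (ZLattice.covolume L)⁻¹ =
        Real.sqrt (ZLattice.covolume L)⁻¹ := by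
      rw [Real.sqrt_inv, ← div_eq_mul_inv, Real.sqrt_div_self', one_div]
    rw [← e]
    push_cast
    ring
  · intro k hk
    rw [Complex.Gamma_eq_zero_iff] at hk
    obtain ⟨j, hj⟩ := hk
    rw [shift_neg_one_sub] at hj
    exact (hs k j).2 (by linear_combination -2 * hj)
  · intro k hk
    rw [Complex.Gamma_eq_zero_iff] at hk
    obtain ⟨j, hj⟩ := hk
    exact (hs k j).1 (by linear_combination 2 * hj)

end Completed

end LatticeZeta

/-! ### Growth in vertical strips. -/

namespace LatticeZeta

open MeasureTheory

/-- Λ₀ is a Mellin integral converging absolutely for every exponent, and t^(σ-1) ≤ t^(a-1) +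
t^(b-1) for σ between a and b. -/
theorem norm_Λ₀_le_of_strip (P : WeakFEPair ℂ) (a b : ℝ) :
    ∃ B, 0 ≤ B ∧ ∀ s : ℂ, a ≤ s.re → s.re ≤ b → ‖P.Λ₀ s‖ ≤ B := by
  have hc : ∀ c : ℝ, IntegrableOn (fun t : ℝ => t ^ (c - 1) * ‖P.f_modif t‖) (Set.Ioi 0) := by
    intro c
    have h1 : MellinConvergent P.f_modif (c : ℂ) :=
      (P.isStrongFEPair_toStrongFEPair.hasMellin c).1
    refine (Integrable.norm h1).congr ?_
    filter_upwards [ae_restrict_mem measurableSet_Ioi] with t ht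
    rw [norm_smul, Complex.norm_cpow_eq_rpow_re_of_pos ht]
    simp
  refine ⟨∫ t in Set.Ioi (0 : ℝ), (t ^ (a - 1) * ‖P.f_modif t‖ + t ^ (b - 1) * ‖P.f_modif t‖),
    setIntegral_nonneg measurableSet_Ioi fun t (ht : 0 < t) => by positivity, fun s hs hs' => ?_⟩
  refine norm_integral_le_of_norm_le ((hc a).add (hc b)) ?_
  filter_upwards [ae_restrict_mem measurableSet_Ioi] with t ht
  have ht' : 0 < t := ht
  rw [norm_smul, Complex.norm_cpow_eq_rpow_re_of_pos ht, ← add_mul]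
  have h2 := rpow_neg_le_add (x := t⁻¹) (by positivity) (a := a - 1) (b := b - 1) (c := s.re - 1)
    (by linarith) (by linarith)
  simp only [Real.rpow_neg (inv_nonneg.2 ht'.le), Real.inv_rpow ht'.le, inv_inv] at h2
  simp only [Complex.sub_re, Complex.one_re]
  exact mul_le_mul_of_nonneg_right h2 (norm_nonneg _)

/-- Raising the exponent is free for t ≥ 1; heights between t₀ and 1 cost the factor t₀^(-D). -/
theorem rpow_le_mul_rpow_of_le {x y D t₀ t : ℝ} (ht₀ : 0 < t₀) (ht : t₀ ≤ t) (hxy : x ≤ y)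
    (hD : y - x ≤ D) : t ^ x ≤ (1 + t₀ ^ (-D)) * t ^ y := by
  have htp : 0 < t := ht₀.trans_le ht
  rcases le_total 1 t with h1 | h1
  · calc t ^ x ≤ 1 * t ^ y := by
          rw [one_mul]
          exact Real.rpow_le_rpow_of_exponent_le h1 hxy
      _ ≤ _ := by
          gcongr
          exact le_add_of_nonneg_right (by positivity)
  · have h2 : t ^ (x - y) ≤ t₀ ^ (-D) :=
      (Real.rpow_le_rpow_of_exponent_ge htp h1 (by linarith)).trans
        (Real.rpow_le_rpow_of_nonpos ht₀ ht (by linarith))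
    calc t ^ x = t ^ (x - y) * t ^ y := by
          rw [← Real.rpow_add htp]
          congr 1
          ring
      _ ≤ (1 + t₀ ^ (-D)) * t ^ y := by
          gcongr
          linarith

section Bounds

variable {r : ℕ} {L : Submodule ℤ (Fin (r + 1) → ℝ)} [DiscreteTopology L] [IsZLattice ℝ L]
  {M : Subgroup (PosVec r)} {ε : Fin r → PosVec r}

theorem shift_im (m : Fin r → ℤ) (s : ℂ) (k : Fin (r + 1)) :
    (shift ε m s k).im = s.im + (shift ε m 0 k).im := by
  simp [shift]

theorem norm_zetaCont_le_tsum (h : IsZetaDatum L M ε) (m : Fin r → ℤ) {s : ℂ} (hs : 1 < s.re) :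
    ‖zetaCont h m s‖ ≤ ∑' o : Orbits L M, |vecNorm (Quotient.out o).1| ^ (-s.re) := by
  rw [zetaCont_eq_zetaSeries h m hs, zetaSeries]
  refine (norm_tsum_le_tsum_norm (summable_norm_orbitTerm h m hs)).trans_eq ?_
  simp_rw [norm_orbitTerm h]

theorem exists_norm_zetaCont_le (h : IsZetaDatum L M ε) (m : Fin r → ℤ) {a : ℝ} (ha : 1 < a)
    (b : ℝ) : ∃ C, 0 ≤ C ∧ ∀ s : ℂ, a ≤ s.re → s.re ≤ b → ‖zetaCont h m s‖ ≤ C := by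
  have hb : 1 < max a b := lt_max_of_lt_left ha
  refine ⟨∑' o : Orbits L M, (|vecNorm (Quotient.out o).1| ^ (-a) +
    |vecNorm (Quotient.out o).1| ^ (-max a b)), tsum_nonneg fun o => by positivity,
    fun s hs hs' => ?_⟩
  refine (norm_zetaCont_le_tsum h m (ha.trans_le hs)).trans ?_
  exact Summable.tsum_le_tsum (fun o => rpow_neg_le_add (orbit_vecNorm_pos h o) hs
    (hs'.trans (le_max_right a b))) (summable_orbit_rpow h (ha.trans_le hs))
    ((summable_orbit_rpow h ha).add (summable_orbit_rpow h hb))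

/-- When all norms are at least 1, the terms |N l|^(-σ) decrease in σ, so the series at a dominates
the whole half-plane. -/
theorem exists_norm_zetaCont_le_of_one_le (h : IsZetaDatum L M ε) (m : Fin r → ℤ)
    (hL : ∀ l ∈ L, l ≠ 0 → 1 ≤ |vecNorm l|) {a : ℝ} (ha : 1 < a) :
    ∃ C, ∀ s : ℂ, a ≤ s.re → ‖zetaCont h m s‖ ≤ C := by
  refine ⟨∑' o : Orbits L M, |vecNorm (Quotient.out o).1| ^ (-a), fun s hs => ?_⟩
  refine (norm_zetaCont_le_tsum h m (ha.trans_le hs)).trans ?_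
  refine Summable.tsum_le_tsum (fun o => ?_) (summable_orbit_rpow h (ha.trans_le hs))
    (summable_orbit_rpow h ha)
  exact Real.rpow_le_rpow_of_exponent_le (hL _ (Quotient.out o).2.1 (Quotient.out o).2.2)
    (by linarith)

theorem norm_pi_cpow (r : ℕ) (s : ℂ) :
    ‖(Real.pi : ℂ) ^ (((r + 1 : ℕ) : ℂ) * s / 2)‖ =
      Real.pi ^ (((r + 1 : ℕ) : ℝ) * s.re / 2) := by
  rw [Complex.norm_cpow_eq_rpow_re_of_pos Real.pi_pos, Complex.div_ofNat_re,
    ← Complex.ofReal_natCast, Complex.re_ofReal_mul]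

theorem exists_norm_prod_inv_Gamma_le (m : Fin r → ℤ) (a : ℝ) {b : ℝ} (hb : b < 2) :
    ∃ B, 0 ≤ B ∧ ∀ s : ℂ, a ≤ s.re → s.re ≤ b →
      ‖∏ k, (Complex.Gamma (shift ε m s k / 2))⁻¹‖ ≤
        B * Real.exp (((r + 1 : ℕ) : ℝ) * Real.pi * |s.im|) := by
  obtain ⟨C, hC, h1⟩ := exists_norm_inv_Gamma_le (a := a / 2) (b := b / 2) (by linarith)
  refine ⟨∏ k : Fin (r + 1), (C * Real.exp (Real.pi * |(shift ε m 0 k).im|)),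
    Finset.prod_nonneg fun k _ => by positivity, fun s hs hs' => ?_⟩
  have e : Real.exp (((r + 1 : ℕ) : ℝ) * Real.pi * |s.im|) =
      ∏ _k : Fin (r + 1), Real.exp (Real.pi * |s.im|) := by
    rw [Finset.prod_const, Finset.card_univ, Fintype.card_fin, ← Real.exp_nat_mul, mul_assoc]
  rw [norm_prod, e, ← Finset.prod_mul_distrib]
  refine Finset.prod_le_prod (fun k _ => norm_nonneg _) fun k _ => ?_
  have h2 := h1 (shift ε m s k / 2) (by rw [Complex.div_ofNat_re, shift_re]; linarith)
    (by rw [Complex.div_ofNat_re, shift_re]; linarith)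
  refine h2.trans ?_
  rw [mul_assoc, ← Real.exp_add, ← mul_add]
  have hpi := Real.pi_pos
  gcongr
  rw [Complex.div_ofNat_im, shift_im, abs_div, abs_of_pos (two_pos : (0 : ℝ) < 2)]
  have := abs_add_le s.im (shift ε m 0 k).im
  have := abs_nonneg (s.im + (shift ε m 0 k).im)
  linarith

theorem exists_norm_Λ_le (h : IsZetaDatum L M ε) (m : Fin r → ℤ) (a b : ℝ) :
    ∃ B, 0 ≤ B ∧ ∀ s : ℂ, a ≤ s.re → s.re ≤ b → 1 ≤ |s.im| →
      ‖(thetaPair h m).Λ (((r + 1 : ℕ) : ℂ) * s / 2)‖ ≤ B := by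
  obtain ⟨B, hB, h1⟩ := norm_Λ₀_le_of_strip (thetaPair h m) (((r + 1 : ℕ) : ℝ) * a / 2)
    (((r + 1 : ℕ) : ℝ) * b / 2)
  have hv := ZLattice.covolume_pos L
  refine ⟨B + 1 * 2 + 1 * ((ZLattice.covolume L)⁻¹ * 2), by positivity, fun s hs hs' ht => ?_⟩
  have hre : (((r + 1 : ℕ) : ℂ) * s / 2).re = ((r + 1 : ℕ) : ℝ) * s.re / 2 := by
    rw [Complex.div_ofNat_re, ← Complex.ofReal_natCast, Complex.re_ofReal_mul]
  have h2 := h1 (((r + 1 : ℕ) : ℂ) * s / 2) (by rw [hre]; gcongr) (by rw [hre]; gcongr)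
  have hif : ‖(if m = 0 then 1 else 0 : ℂ)‖ ≤ 1 := by
    split_ifs <;> simp
  have hn : (1 : ℝ) ≤ ‖((r + 1 : ℕ) : ℂ)‖ := by
    rw [Complex.norm_natCast]
    exact_mod_cast Nat.le_add_left 1 r
  have hn1 : 1 ≤ ‖((r + 1 : ℕ) : ℂ) * s‖ := by
    rw [norm_mul]
    exact one_le_mul_of_one_le_of_one_le hn (ht.trans (Complex.abs_im_le_norm s))
  have hn2 : 1 ≤ ‖((r + 1 : ℕ) : ℂ) * (1 - s)‖ := by
    rw [norm_mul]
    refine one_le_mul_of_one_le_of_one_le hn (ht.trans ?_)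
    simpa using Complex.abs_im_le_norm (1 - s)
  rw [thetaPair_Λ]
  refine (norm_sub_le _ _).trans (add_le_add ((norm_sub_le _ _).trans (add_le_add h2 ?_)) ?_)
  · rw [norm_mul, norm_div, Complex.norm_ofNat]
    exact mul_le_mul hif (div_le_self zero_le_two hn1) (by positivity) zero_le_one
  · rw [norm_mul, norm_div, norm_mul, Complex.norm_ofNat, Complex.norm_real,
      Real.norm_of_nonneg (inv_nonneg.2 hv.le)]
    exact mul_le_mul hif (div_le_self (by positivity) hn2) (by positivity) zero_le_one

/-- The a priori growth needed for Phragmén–Lindelöf: Λ is bounded away from its poles and the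
inverse Gamma factors grow at most exponentially. The condition b < 2 makes Re(s_k/2) < 1, as the
reflection bound requires. -/
theorem exists_norm_zetaNum_le_exp (h : IsZetaDatum L M ε) (m : Fin r → ℤ) {a b : ℝ}
    (hb : b < 2) : ∃ B D, ∀ s : ℂ, a ≤ s.re → s.re ≤ b → 1 ≤ |s.im| →
      ‖zetaNum h m s‖ ≤ B * Real.exp (D * |s.im|) := by
  obtain ⟨B₁, hB₁, h1⟩ := exists_norm_prod_inv_Gamma_le (ε := ε) m a hb
  obtain ⟨B₂, hB₂, h2⟩ := exists_norm_Λ_le h m a b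
  refine ⟨(1 + |a - 1| + |b - 1|) * (‖unfoldConst ε‖ * Real.pi ^ (((r + 1 : ℕ) : ℝ) * b / 2) *
    B₁ * B₂), 1 + ((r + 1 : ℕ) : ℝ) * Real.pi, fun s hs hs' ht => ?_⟩
  have ht0 : s.im ≠ 0 := by
    rintro h0
    norm_num [h0] at ht
  have hs0 : s ≠ 0 := by
    rintro rfl
    exact ht0 rfl
  have hs1 : s ≠ 1 := by
    rintro rfl
    exact ht0 rfl
  have h3 : ‖s - 1‖ ≤ (1 + |a - 1| + |b - 1|) * Real.exp |s.im| := by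
    have e1 : ‖s - 1‖ ≤ |s.re - 1| + |s.im| := by
      simpa using Complex.norm_le_abs_re_add_abs_im (s - 1)
    have e2 : |s.re - 1| ≤ |a - 1| + |b - 1| := by
      rw [abs_le]
      have := abs_nonneg (a - 1)
      have := abs_nonneg (b - 1)
      have := neg_abs_le (a - 1)
      have := le_abs_self (b - 1)
      constructor <;> linarith
    have e3 := Real.add_one_le_exp |s.im|
    have e4 : 1 ≤ Real.exp |s.im| := Real.one_le_exp (abs_nonneg _)
    have e5 : 0 ≤ |a - 1| + |b - 1| := by positivity
    nlinarith
  have h4 : ‖(Real.pi : ℂ) ^ (((r + 1 : ℕ) : ℂ) * s / 2)‖ ≤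
      Real.pi ^ (((r + 1 : ℕ) : ℝ) * b / 2) := by
    rw [norm_pi_cpow]
    exact Real.rpow_le_rpow_of_exponent_le (by linarith [Real.two_le_pi]) (by gcongr)
  rw [zetaNum_eq h m hs1, zetaCont_eq h m (Or.inr hs0), norm_mul, norm_mul, norm_mul, norm_mul]
  calc _ ≤ (1 + |a - 1| + |b - 1|) * Real.exp |s.im| * (‖unfoldConst ε‖ *
        Real.pi ^ (((r + 1 : ℕ) : ℝ) * b / 2) *
        (B₁ * Real.exp (((r + 1 : ℕ) : ℝ) * Real.pi * |s.im|)) * B₂) := by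
        gcongr
        · exact h1 s hs hs'
        · exact h2 s hs hs' ht
    _ = _ := by
        rw [show (1 + ((r + 1 : ℕ) : ℝ) * Real.pi) * |s.im| =
          |s.im| + ((r + 1 : ℕ) : ℝ) * Real.pi * |s.im| by ring, Real.exp_add]
        ring

/-- The asymmetric functional equation: left of Re s = 0 it expresses Z through an absolutely
convergent dual series and Gamma quotients. -/
theorem zetaCont_eq_gammaRatio_mul (h : IsZetaDatum L M ε) (m : Fin r → ℤ) {s : ℂ}
    (hs : s.re < 0) : zetaCont h m s = (((ZLattice.covolume L)⁻¹ : ℝ) : ℂ) *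
      (Real.pi : ℂ) ^ (((r + 1 : ℕ) : ℂ) * s / 2) *
      (Real.pi : ℂ) ^ (-(((r + 1 : ℕ) : ℂ) * (1 - s) / 2)) *
      (∏ k, gammaRatio (shift ε m s k)) * zetaCont h.dual (-m) (1 - s) := by
  have hs0 : s ≠ 0 := by
    rintro rfl
    exact lt_irrefl _ hs
  have h1 : 1 < (1 - s).re := by
    rw [Complex.sub_re, Complex.one_re]
    linarith
  have h2 := completed_zetaSeries h.dual (-m) h1
  rw [zetaCont_eq h m (Or.inr hs0), zetaCont_eq_zetaSeries h.dual (-m) h1,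
    Λ_functional_equation]
  simp only [shift_neg_one_sub] at h2
  simp only [gammaRatio, Finset.prod_mul_distrib]
  rw [show ((2 ^ r * |(logMatrix ε).det| : ℝ) : ℂ) = unfoldConst ε from rfl] at h2
  linear_combination (-(((ZLattice.covolume L)⁻¹ : ℝ) : ℂ) *
    (Real.pi : ℂ) ^ (((r + 1 : ℕ) : ℂ) * s / 2) *
    ∏ k, (Complex.Gamma (shift ε m s k / 2))⁻¹) * h2

theorem exists_norm_prod_gammaRatio_le (m : Fin r → ℤ) : ∃ B, 0 ≤ B ∧ ∀ s : ℂ,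
    -(3 / 2) ≤ s.re → s.re ≤ 1 / 2 → ‖∏ k, gammaRatio (shift ε m s k)‖ ≤
      B * (1 + |s.im|) ^ (((r + 1 : ℕ) : ℝ) * (1 / 2 - s.re)) := by
  obtain ⟨C, hC, h1⟩ := exists_norm_gammaRatio_le
  refine ⟨∏ k : Fin (r + 1), (C * (1 + |(shift ε m 0 k).im|) ^ (2 : ℝ)),
    Finset.prod_nonneg fun k _ => by positivity, fun s hs hs' => ?_⟩
  have e : (1 + |s.im|) ^ (((r + 1 : ℕ) : ℝ) * (1 / 2 - s.re)) =
      ∏ _k : Fin (r + 1), (1 + |s.im|) ^ (1 / 2 - s.re) := by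
    rw [Finset.prod_const, Finset.card_univ, Fintype.card_fin, ← Real.rpow_natCast,
      ← Real.rpow_mul (by positivity), mul_comm]
  rw [norm_prod, e, ← Finset.prod_mul_distrib]
  refine Finset.prod_le_prod (fun k _ => norm_nonneg _) fun k _ => ?_
  have h2 := h1 (shift ε m s k) (by rwa [shift_re]) (by rwa [shift_re])
  refine h2.trans ?_
  rw [shift_re, shift_im, mul_assoc]
  refine mul_le_mul_of_nonneg_left ?_ hC
  have h3 : 1 + |s.im + (shift ε m 0 k).im| ≤ (1 + |(shift ε m 0 k).im|) * (1 + |s.im|) := by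
    have := abs_add_le s.im (shift ε m 0 k).im
    have := mul_nonneg (abs_nonneg s.im) (abs_nonneg (shift ε m 0 k).im)
    linarith
  refine (Real.rpow_le_rpow (by positivity) h3 (by linarith)).trans ?_
  rw [Real.mul_rpow (by positivity) (by positivity)]
  gcongr
  · exact le_add_of_nonneg_right (abs_nonneg _)
  · linarith

theorem exists_norm_zetaCont_le_left (h : IsZetaDatum L M ε) (m : Fin r → ℤ) {η : ℝ}
    (hη : 0 < η) (hη' : η ≤ 1 / 4) : ∃ B, 0 ≤ B ∧ ∀ s : ℂ, s.re = -η →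
      ‖zetaCont h m s‖ ≤ B * (1 + |s.im|) ^ (((r + 1 : ℕ) : ℝ) * (1 / 2 + η)) := by
  obtain ⟨B₁, hB₁, h1⟩ := exists_norm_prod_gammaRatio_le (ε := ε) m
  obtain ⟨B₂, hB₂, h2⟩ := exists_norm_zetaCont_le h.dual (-m) (a := 1 + η) (by linarith) (1 + η)
  have hv := ZLattice.covolume_pos L
  have hpi := Real.pi_pos
  refine ⟨(ZLattice.covolume L)⁻¹ * Real.pi ^ (((r + 1 : ℕ) : ℝ) * (-η) / 2) *
    (Real.pi ^ (((r + 1 : ℕ) : ℝ) * (1 + η) / 2))⁻¹ * B₁ * B₂, by positivity, fun s hs => ?_⟩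
  have hre : (1 - s).re = 1 + η := by
    rw [Complex.sub_re, Complex.one_re, hs]
    ring
  have h3 := h1 s (by linarith) (by linarith)
  have h4 := h2 (1 - s) hre.ge hre.le
  rw [hs, sub_neg_eq_add] at h3
  rw [zetaCont_eq_gammaRatio_mul h m (by linarith), norm_mul, norm_mul, norm_mul, norm_mul,
    Complex.cpow_neg, norm_inv, norm_pi_cpow, norm_pi_cpow, hre, hs, Complex.norm_real,
    Real.norm_of_nonneg (inv_nonneg.2 hv.le)]
  calc _ ≤ (ZLattice.covolume L)⁻¹ * Real.pi ^ (((r + 1 : ℕ) : ℝ) * (-η) / 2) *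
        (Real.pi ^ (((r + 1 : ℕ) : ℝ) * (1 + η) / 2))⁻¹ *
        (B₁ * (1 + |s.im|) ^ (((r + 1 : ℕ) : ℝ) * (1 / 2 + η))) * B₂ := by
        gcongr
    _ = _ := by ring

/-- The interpolation is applied to (s - 1)Z(s), which has no pole; the extra factor raises both
edge exponents by 1 and is divided out at the end by means of |s - 1| ≥ |Im s|. -/
theorem exists_norm_zetaCont_le_strip (h : IsZetaDatum L M ε) (m : Fin r → ℤ) {η t₀ : ℝ}
    (hη : 0 < η) (hη' : η ≤ 1 / 4) (ht₀ : 0 < t₀) : ∃ C, 0 ≤ C ∧ ∀ s : ℂ,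
      -η ≤ s.re → s.re ≤ 1 + η → t₀ ≤ |s.im| →
        ‖zetaCont h m s‖ ≤ C * |s.im| ^ (((r + 1 : ℕ) : ℝ) * (1 + η - s.re) / 2) := by
  set n : ℝ := ((r + 1 : ℕ) : ℝ) with hn
  have hn0 : 0 ≤ n := Nat.cast_nonneg _
  obtain ⟨B, D, h1⟩ := exists_norm_zetaNum_le_exp h m (a := -η) (b := 1 + η) (by linarith)
  obtain ⟨A₁, hA₁, h2⟩ := exists_norm_zetaCont_le_left h m hη hη'
  obtain ⟨A₂, hA₂, h3⟩ := exists_norm_zetaCont_le h m (a := 1 + η) (by linarith) (1 + η)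
  have hnorm : ∀ s : ℂ, -η ≤ s.re → s.re ≤ 1 + η → ‖s - 1‖ ≤ 2 * (1 + |s.im|) := by
    intro s hs hs'
    have e1 : ‖s - 1‖ ≤ |s.re - 1| + |s.im| := by
      simpa using Complex.norm_le_abs_re_add_abs_im (s - 1)
    have e2 : |s.re - 1| ≤ 2 := by
      rw [abs_le]
      constructor <;> linarith
    have := abs_nonneg s.im
    linarith
  have key := exists_norm_le_of_vertical_strip (f := zetaNum h m) (a := -η) (b := 1 + η)
    (p := n * (1 / 2 + η) + 1) (q := 1) (A := 2 * A₁ + 2 * A₂) (B := B) (D := D) (by linarith)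
    (differentiable_zetaNum h m).diffContOnCl (by positivity) zero_le_one h1 ?_ ?_
  · obtain ⟨C, hC, h4⟩ := key
    refine ⟨C * (1 + t₀⁻¹) ^ (1 + n), by positivity, fun s hs hs' ht => ?_⟩
    have htp : 0 < |s.im| := ht₀.trans_le ht
    have hs1 : s ≠ 1 := by
      rintro rfl
      simp at htp
    have h5 := h4 s hs hs'
    -- The strip has width 1 + 2η and the edge exponents differ by n(1 + 2η)/2, so the slope is
    -- exactly -n/2.
    have e : ((n * (1 / 2 + η) + 1) * (1 + η - s.re) + 1 * (s.re - -η)) / (1 + η - -η) =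
        n * (1 + η - s.re) / 2 + 1 := by
      rw [div_eq_iff (by linarith)]
      ring
    rw [e, zetaNum_eq h m hs1, norm_mul] at h5
    have h6 : |s.im| ≤ ‖s - 1‖ := by
      simpa using Complex.abs_im_le_norm (s - 1)
    have h7 : 1 + |s.im| ≤ (1 + t₀⁻¹) * |s.im| := by
      have : 1 ≤ t₀⁻¹ * |s.im| := by
        rwa [← div_eq_inv_mul, one_le_div ht₀]
      linarith
    have h8 : 0 ≤ n * (1 + η - s.re) / 2 := by
      have : 0 ≤ 1 + η - s.re := by linarith
      positivity
    have h9 : n * (1 + η - s.re) / 2 + 1 ≤ 1 + n := by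
      have : n * (1 + η - s.re) ≤ n * 2 := by
        gcongr
        linarith
      linarith
    have h10 : |s.im| * ‖zetaCont h m s‖ ≤
        |s.im| * (C * (1 + t₀⁻¹) ^ (1 + n) * |s.im| ^ (n * (1 + η - s.re) / 2)) := by
      calc |s.im| * ‖zetaCont h m s‖ ≤ ‖s - 1‖ * ‖zetaCont h m s‖ := by gcongr
        _ ≤ C * (1 + |s.im|) ^ (n * (1 + η - s.re) / 2 + 1) := h5
        _ ≤ C * ((1 + t₀⁻¹) * |s.im|) ^ (n * (1 + η - s.re) / 2 + 1) := by gcongr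
        _ = C * ((1 + t₀⁻¹) ^ (n * (1 + η - s.re) / 2 + 1) *
            |s.im| ^ (n * (1 + η - s.re) / 2 + 1)) := by
          rw [Real.mul_rpow (by positivity) htp.le]
        _ ≤ C * ((1 + t₀⁻¹) ^ (1 + n) * |s.im| ^ (n * (1 + η - s.re) / 2 + 1)) := by
          gcongr
          exact le_add_of_nonneg_right (by positivity)
        _ = _ := by
          rw [Real.rpow_add_one htp.ne']
          ring
    exact le_of_mul_le_mul_left h10 htp
  · intro s hs
    have hs1 : s ≠ 1 := by
      rintro rfl
      rw [Complex.one_re] at hs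
      linarith
    rw [zetaNum_eq h m hs1, norm_mul, Real.rpow_add_one (by positivity)]
    calc _ ≤ 2 * (1 + |s.im|) * (A₁ * (1 + |s.im|) ^ (n * (1 / 2 + η))) := by
          gcongr
          · exact hnorm s (by linarith) (by linarith)
          · exact h2 s hs
      _ = 2 * A₁ * ((1 + |s.im|) ^ (n * (1 / 2 + η)) * (1 + |s.im|)) := by ring
      _ ≤ _ := by
          gcongr
          linarith
  · intro s hs
    have hs1 : s ≠ 1 := by
      rintro rfl
      rw [Complex.one_re] at hs
      linarith
    rw [zetaNum_eq h m hs1, norm_mul, Real.rpow_one]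
    calc _ ≤ 2 * (1 + |s.im|) * A₂ := by
          gcongr
          · exact hnorm s (by linarith) (by linarith)
          · exact h3 s hs.ge hs.le
      _ = 2 * A₂ * (1 + |s.im|) := by ring
      _ ≤ _ := by
          gcongr
          linarith

theorem exists_small_exponent {n δ : ℝ} (hn : 0 < n) (hδ : 0 < δ) :
    ∃ η : ℝ, 0 < η ∧ η ≤ 1 / 4 ∧ n * η / 2 ≤ δ := by
  refine ⟨min (1 / 4) (2 * δ / n), by positivity, min_le_left _ _, ?_⟩
  have : n * min (1 / 4) (2 * δ / n) ≤ n * (2 * δ / n) := by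
    gcongr
    exact min_le_right _ _
  rw [mul_div_cancel₀ _ hn.ne'] at this
  linarith

theorem exists_norm_zetaCont_le_critical (h : IsZetaDatum L M ε) (m : Fin r → ℤ) {δ t₀ : ℝ}
    (hδ : 0 < δ) (ht₀ : 0 < t₀) : ∃ C : ℝ, ∀ s : ℂ, 0 ≤ s.re → s.re ≤ 1 → t₀ ≤ |s.im| →
      ‖zetaCont h m s‖ ≤ C * |s.im| ^ (((r + 1 : ℕ) : ℝ) * (1 - s.re) / 2 + δ) := by
  have hn : (0 : ℝ) < ((r + 1 : ℕ) : ℝ) := Nat.cast_pos.2 r.succ_pos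
  obtain ⟨η, hη, hη', hηδ⟩ := exists_small_exponent hn hδ
  obtain ⟨C, hC, h1⟩ := exists_norm_zetaCont_le_strip h m hη hη' ht₀
  refine ⟨C * (1 + t₀ ^ (-δ)), fun s hs hs' ht => ?_⟩
  refine (h1 s (by linarith) (by linarith) ht).trans ?_
  rw [mul_assoc]
  refine mul_le_mul_of_nonneg_left (rpow_le_mul_rpow_of_le ht₀ ht ?_ ?_) hC
  · linarith
  · have := mul_pos hn hη
    linarith

/-- A bound for the series on Re s ≥ a is assumed only for each a > 1, so the range 1 < Re s ≤ 1 + η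
is left to the strip estimate. The set S lets one argument cover both bounded real part and, when
norms are at least 1, the full half-plane. -/
theorem exists_norm_zetaCont_le_right (h : IsZetaDatum L M ε) (m : Fin r → ℤ) {δ t₀ : ℝ}
    (hδ : 0 < δ) (ht₀ : 0 < t₀) (S : Set ℂ)
    (hS : ∀ a : ℝ, 1 < a → ∃ C, ∀ s ∈ S, a ≤ s.re → ‖zetaCont h m s‖ ≤ C) :
    ∃ C : ℝ, ∀ s ∈ S, 1 < s.re → t₀ ≤ |s.im| → ‖zetaCont h m s‖ ≤ C * |s.im| ^ δ := by
  have hn : (0 : ℝ) < ((r + 1 : ℕ) : ℝ) := Nat.cast_pos.2 r.succ_pos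
  obtain ⟨η, hη, hη', hηδ⟩ := exists_small_exponent hn hδ
  obtain ⟨C, hC, h1⟩ := exists_norm_zetaCont_le_strip h m hη hη' ht₀
  obtain ⟨C', h2⟩ := hS (1 + η) (by linarith)
  refine ⟨max C C' * (1 + t₀ ^ (-δ)), fun s hsS hs ht => ?_⟩
  have hC' : 0 ≤ max C C' := le_max_of_le_left hC
  rw [mul_assoc]
  rcases le_total s.re (1 + η) with hle | hle
  · have h3 : 0 ≤ ((r + 1 : ℕ) : ℝ) * (1 + η - s.re) := mul_nonneg hn.le (by linarith)
    have h4 : ((r + 1 : ℕ) : ℝ) * (1 + η - s.re) ≤ ((r + 1 : ℕ) : ℝ) * η :=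
      mul_le_mul_of_nonneg_left (by linarith) hn.le
    refine (h1 s (by linarith) hle ht).trans (mul_le_mul (le_max_left _ _)
      (rpow_le_mul_rpow_of_le ht₀ ht ?_ ?_) (by positivity) hC')
    · linarith
    · linarith
  · refine (h2 s hsS hle).trans ((le_max_right C C').trans (le_mul_of_one_le_right hC' ?_))
    -- Exponent 0 against δ: this says that (1 + t₀^(-δ))|Im s|^δ is at least 1.
    simpa using rpow_le_mul_rpow_of_le (x := 0) (y := δ) (D := δ) ht₀ ht hδ.le (by simp)

end Bounds

end LatticeZeta

/-! ### The main theorem, with n = r + 1. -/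

theorem mainTheorem6 (r : ℕ)
    (L : Submodule ℤ (Fin (r + 1) → ℝ)) [DiscreteTopology L] [IsZLattice ℝ L]
    (hLnorm : ∀ l ∈ L, (∃ k, l k = 0) → l = 0)
    (M : Subgroup (LatticeZeta.PosVec r)) (hMdisc : DiscreteTopology M)
    (hMrank : Nonempty (M ≃* Multiplicative (Fin r → ℤ)))
    (hMnorm : ∀ η ∈ M, ∏ k, (η k : ℝ) = 1)
    (hML : ∀ η ∈ M, ∀ l ∈ L, LatticeZeta.scale η l ∈ L)
    (ε : Fin r → LatticeZeta.PosVec r) (hε : Subgroup.closure (Set.range ε) = M) :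
    -- the summand depends only on the orbit
    (∀ η ∈ M, ∀ l : Fin (r + 1) → ℝ, (l ∈ L ∨ l ∈ LatticeZeta.dualLattice L) → l ≠ 0 →
      ∀ (m : Fin r → ℤ) (s : ℂ),
        LatticeZeta.zetaTerm ε m s (LatticeZeta.scale η l) = LatticeZeta.zetaTerm ε m s l) ∧
    ∀ m : Fin r → ℤ,
      -- absolute and locally uniform convergence, analyticity
      (∀ s : ℂ, 1 < s.re →
        Summable fun o : LatticeZeta.Orbits L M => ‖LatticeZeta.orbitTerm L M ε m o s‖) ∧
      HasSumLocallyUniformlyOn (LatticeZeta.orbitTerm L M ε m) (LatticeZeta.zetaSeries L M ε m)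
        {s : ℂ | 1 < s.re} ∧
      AnalyticOnNhd ℂ (LatticeZeta.zetaSeries L M ε m) {s : ℂ | 1 < s.re} ∧
      -- meromorphic continuation
      ∃ Z : ℂ → ℂ, LatticeZeta.IsZetaContinuation L M ε m Z ∧
        -- poles of the zeta function
        (∀ s : ℂ, (m ≠ 0 ∨ s ≠ 1) → AnalyticAt ℂ Z s) ∧
        (m = 0 → meromorphicOrderAt Z 1 = -1 ∧
          Tendsto (fun s : ℂ => (s - 1) * Z s) (𝓝[≠] 1)
            (𝓝 (((2 ^ (r + 1) * |(LatticeZeta.logMatrix ε).det| /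
              (((r + 1 : ℕ) : ℝ) * ZLattice.covolume L) : ℝ)) : ℂ))) ∧
        -- poles of the completed function
        Meromorphic (LatticeZeta.completed ε m Z) ∧
        (∀ s : ℂ, (m ≠ 0 ∨ (s ≠ 0 ∧ s ≠ 1)) →
          0 ≤ meromorphicOrderAt (LatticeZeta.completed ε m Z) s) ∧
        (m = 0 →
          meromorphicOrderAt (LatticeZeta.completed ε m Z) 1 = -1 ∧
          meromorphicOrderAt (LatticeZeta.completed ε m Z) 0 = -1 ∧
          Tendsto (fun s : ℂ => (s - 1) * LatticeZeta.completed ε m Z s) (𝓝[≠] 1)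
            (𝓝 (((2 ^ (r + 1) * |(LatticeZeta.logMatrix ε).det| /
              (((r + 1 : ℕ) : ℝ) * ZLattice.covolume L) : ℝ)) : ℂ)) ∧
          Tendsto (fun s : ℂ => s * LatticeZeta.completed ε m Z s) (𝓝[≠] 0)
            (𝓝 ((-(2 ^ (r + 1) * |(LatticeZeta.logMatrix ε).det| / ((r + 1 : ℕ) : ℝ)) : ℝ) :
              ℂ))) ∧
        -- functional equation
        (∃ Z' : ℂ → ℂ,
          LatticeZeta.IsZetaContinuation (LatticeZeta.dualLattice L) M ε (-m) Z' ∧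
          (∀ s : ℂ, (m ≠ 0 ∨ s ≠ 1) → AnalyticAt ℂ Z' s) ∧
          ∀ s : ℂ,
            (∀ (k : Fin (r + 1)) (j : ℕ), LatticeZeta.shift ε m s k ≠ -(2 * (j : ℂ)) ∧
              LatticeZeta.shift ε m s k ≠ 1 + 2 * (j : ℂ)) →
            ((Real.sqrt (ZLattice.covolume L) : ℝ) : ℂ) * LatticeZeta.completed ε m Z s =
              ((Real.sqrt (ZLattice.covolume (LatticeZeta.dualLattice L)) : ℝ) : ℂ) *
                LatticeZeta.completed ε (-m) Z' (1 - s)) ∧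
        -- convexity bound in the strip
        (∀ δ : ℝ, 0 < δ → ∀ t₀ : ℝ, 0 < t₀ → ∃ C : ℝ, ∀ s : ℂ,
          0 ≤ s.re → s.re ≤ 1 → t₀ ≤ |s.im| →
            ‖Z s‖ ≤ C * |s.im| ^ (((r + 1 : ℕ) : ℝ) * (1 - s.re) / 2 + δ)) ∧
        -- bound to the right of the strip, uniformly for bounded real part
        (∀ δ : ℝ, 0 < δ → ∀ t₀ : ℝ, 0 < t₀ → ∀ A : ℝ, ∃ C : ℝ, ∀ s : ℂ,
          1 < s.re → s.re ≤ A → t₀ ≤ |s.im| → ‖Z s‖ ≤ C * |s.im| ^ δ) ∧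
        -- the same bound on the whole half-plane when all the norms are at least 1
        ((∀ l ∈ L, l ≠ 0 → 1 ≤ |LatticeZeta.vecNorm l|) →
          ∀ δ : ℝ, 0 < δ → ∀ t₀ : ℝ, 0 < t₀ → ∃ C : ℝ, ∀ s : ℂ,
            1 < s.re → t₀ ≤ |s.im| → ‖Z s‖ ≤ C * |s.im| ^ δ) := by
  have h : LatticeZeta.IsZetaDatum L M ε :=
    ⟨hε, LatticeZeta.isUnitSystem hMdisc hMrank hMnorm hε, hML⟩
  refine ⟨?_, fun m => ⟨fun s hs => LatticeZeta.summable_norm_orbitTerm h m hs,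
    LatticeZeta.hasSumLocallyUniformlyOn_orbitTerm h m,
    LatticeZeta.analyticOnNhd_zetaSeries h m, LatticeZeta.zetaCont h m,
    LatticeZeta.isZetaContinuation_zetaCont h m,
    fun s hs => LatticeZeta.analyticAt_zetaCont h m hs, ?_,
    LatticeZeta.meromorphic_completed h m,
    fun s hs => LatticeZeta.meromorphicOrderAt_completed_nonneg h m hs, ?_,
    ⟨LatticeZeta.zetaCont h.dual (-m), LatticeZeta.isZetaContinuation_zetaCont h.dual (-m),
      fun s hs => LatticeZeta.analyticAt_zetaCont h.dual (-m) (hs.imp_left neg_ne_zero.2),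
      fun s hs => LatticeZeta.completed_functional_equation h m hs⟩,
    fun δ hδ t₀ ht₀ => LatticeZeta.exists_norm_zetaCont_le_critical h m hδ ht₀, ?_, ?_⟩⟩
  · rintro η hη l (hl | hl) hl0 m s
    · exact LatticeZeta.zetaTerm_scale hε h.isUnitSystem hη (h.coord_ne_zero hl hl0) m s
    · exact LatticeZeta.zetaTerm_scale hε h.isUnitSystem hη (h.dual.coord_ne_zero hl hl0) m s
  · rintro rfl
    exact LatticeZeta.zetaCont_pole_one h
  · rintro rfl
    have h1 := LatticeZeta.completed_pole_one h
    have h0 := LatticeZeta.completed_pole_zero h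
    exact ⟨h1.1, h0.1, h1.2, h0.2⟩
  · intro δ hδ t₀ ht₀ A
    obtain ⟨C, hC⟩ := LatticeZeta.exists_norm_zetaCont_le_right h m hδ ht₀ {s | s.re ≤ A}
      fun a ha => by
        obtain ⟨C, -, hC⟩ := LatticeZeta.exists_norm_zetaCont_le h m ha A
        exact ⟨C, fun s hsA hs => hC s hs hsA⟩
    exact ⟨C, fun s hs hsA ht => hC s hsA hs ht⟩
  · intro hL δ hδ t₀ ht₀
    obtain ⟨C, hC⟩ := LatticeZeta.exists_norm_zetaCont_le_right h m hδ ht₀ Set.univ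
      fun a ha => by
        obtain ⟨C, hC⟩ := LatticeZeta.exists_norm_zetaCont_le_of_one_le h m hL ha
        exact ⟨C, fun s _ hs => hC s hs⟩
    exact ⟨C, fun s hs ht => hC s (Set.mem_univ s) hs ht⟩
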